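/- Let $W^{\mathrm{full}}=(X,T,S(0),S(1),Y(0),Y(1),R)$ have law $\mathbb P$, where $X\in\mathcal X$ and $S(t)\in\mathcal S$ ($\mathcal X,\mathcal S$ standard Borel spaces, e.g. Borel subsets of Euclidean spaces), $T,R\in\{0,1\}$, $Y(t)\in\mathbb R$ with $\mathbb E[Y(t)^2]<\infty$; put $S=S(T)$, $Y=Y(T)$, $\delta^*=\mathbb E[Y(1)]-\mathbb E[Y(0)]$. Write $e^*(x)=\mathbb P(T=1\mid X=x)$, $r^*(t,x,s)=\mathbb P(R=1\mid T=t,X=x,S=s)$, $r^*(t,x)=\mathbb P(R=1\mid T=t,X=x)$, $\mu^*(t,x)=\mathbb E[Y\mid T=t,R=1,X=x]$, $\tilde\mu^*(t,x,s)=\mathbb E[Y\mid T=t,R=1,X=x,S=s]$ (any versions). Assume, for $t=0,1$ and some $\epsilon\in(0,1/2)$: (i) $(Y(t),S(t))\perp T\mid X$ and $R\perp Y(t)\mid (X,T=t,S(t))$; (ii) almost surely $\epsilon\le e^*(X)\le 1-\epsilon$ and $\epsilon\le r^*(t,X,S(t))\le 1$; (iii) $R\perp S(t)\mid T,X$. Consider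 four settings. I: $(X,T,Y)$ is observed if $R=1$ and $(X,T)$ if $R=0$. II: $(X,T,S,Y)$ if $R=1$ and $(X,T)$ if $R=0$. III: $(X,T,S,Y)$ if $R=1$ and $(X,T,S)$ if $R=0$. IV: $(X,T,S,Y)$ is observed for all units. In each setting the model consists of the laws of the observed data induced by all laws of the full data with $\mathbb E[Y(t)^2]<\infty$ that satisfy (i)-(iii) with the same $\epsilon$. A regular submodel is a one-parameter family in the model which passes through the true law at parameter $0$, is differentiable in quadratic mean there, and has bounded second moments of $Y(0),Y(1)$; the efficient influence function is the square-integrable function $\psi$ in the closed linear span of the scores $g$ of regular submodels such that along each of them $\delta$ has derivative $\mathbb E[\psi g]$ at $0$; the efficiency lower bound is the supremum over regular submodels of the Cramér-Rao bounds $(d\delta)^2/\mathbb E[g^2]$ (with $0/0=0$). Then in setting $j\in\{I,II,III,IV\}$ the efficient influence function for $\delta^*$ is $\psi_j$ and the efficiency lower bound is $V_j^*=\mathbb E[\psi_j^2]$, where \begin{align*} \psi_I=\psi_{II}&=\mu^*(1,X)-\mu^*(0,X)+\frac{TR}{e^*(X)r^*(1,X)}(Y-\mu^*(1,X))-\frac{(1-T)R}{(1-e^*(X))r^*(0,X)}(Y-\mu^*(0,X))-\delta^*,\\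 \psi_{III}&=\mu^*(1,X)-\mu^*(0,X)+\frac{TR}{e^*(X)r^*(1,X)}(Y-\tilde\mu^*(1,X,S))-\frac{(1-T)R}{(1-e^*(X))r^*(0,X)}(Y-\tilde\mu^*(0,X,S))\\ &\quad+\frac{T}{e^*(X)}(\tilde\mu^*(1,X,S)-\mu^*(1,X))-\frac{1-T}{1-e^*(X)}(\tilde\mu^*(0,X,S)-\mu^*(0,X))-\delta^*,\\ \psi_{IV}&=\mu^*(1,X)-\mu^*(0,X)+\frac{T}{e^*(X)}(Y-\mu^*(1,X))-\frac{1-T}{1-e^*(X)}(Y-\mu^*(0,X))-\delta^*. \end{align*} The same holds if in addition $e^*$, or $r^*$, or both are known, i.e. if the model is restricted to laws with these propensity scores. Moreover, $\psi_{III}$ is almost surely unchanged if $r^*(t,X)$ is replaced in it by $r^*(t,X,S)$. -/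

import Mathlib

open MeasureTheory ProbabilityTheory Filter Topology
open scoped ENNReal

namespace SurrogateATE

noncomputable section

/-! ### The population and its variables -/

/-- The space of full data points `(X, T, (S(0), S(1)), (Y(0), Y(1)), R)`; the value `true` of a
binary variable stands for `1`, the value `false` for `0`. -/
abbrev FullData (𝒳 𝒮 : Type*) := 𝒳 × Bool × (Bool → 𝒮) × (Bool → ℝ) × Bool

section Variables

variable {𝒳 𝒮 : Type*}

/-- Covariates. -/
def X (w : FullData 𝒳 𝒮) : 𝒳 := w.1

/-- Treatment indicator. -/
def T (w : FullData 𝒳 𝒮) : Bool := w.2.1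

/-- Potential surrogate `S(a)`. -/
def Spot (a : Bool) (w : FullData 𝒳 𝒮) : 𝒮 := w.2.2.1 a

/-- Potential outcome `Y(a)`. -/
def Ypot (a : Bool) (w : FullData 𝒳 𝒮) : ℝ := w.2.2.2.1 a

/-- Labelling indicator. -/
def R (w : FullData 𝒳 𝒮) : Bool := w.2.2.2.2

/-- The actual surrogate `S = S(T)`. -/
def S (w : FullData 𝒳 𝒮) : 𝒮 := Spot (T w) w

/-- The actual outcome `Y = Y(T)`. -/
def Y (w : FullData 𝒳 𝒮) : ℝ := Ypot (T w) w

end Variables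

/-- The numerical value of a binary variable. -/
def ind (b : Bool) : ℝ := if b then 1 else 0

section Measurability

variable {𝒳 𝒮 : Type*} [MeasurableSpace 𝒳] [MeasurableSpace 𝒮]

theorem measurable_X : Measurable (X : FullData 𝒳 𝒮 → 𝒳) := measurable_fst

theorem measurable_T : Measurable (T : FullData 𝒳 𝒮 → Bool) := by
  unfold T; fun_prop

theorem measurable_Spot (a : Bool) : Measurable (Spot a : FullData 𝒳 𝒮 → 𝒮) := by
  unfold Spot; fun_prop

theorem measurable_XSpot (a : Bool) :
    Measurable (fun w : FullData 𝒳 𝒮 => (X w, Spot a w)) :=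
  measurable_X.prodMk (measurable_Spot a)

theorem measurable_TX : Measurable (fun w : FullData 𝒳 𝒮 => (T w, X w)) :=
  measurable_T.prodMk measurable_X

end Measurability

/-! ### Regression functions, assumptions and models -/

/-- `m` is a version of the regression function `u ↦ E_Q[Z | A, U = u]`, that is, of the conditional
expectation of `Z` given `U` under the conditional law `Q(· | A)`. -/
def IsRegression {F 𝒰 : Type*} [MeasurableSpace F] [MeasurableSpace 𝒰]
    (Q : Measure F) (Z : F → ℝ) (A : Set F) (U : F → 𝒰) (m : 𝒰 → ℝ) : Prop :=
  Measurable m ∧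
    (Q[|A])[Z | MeasurableSpace.comap U inferInstance] =ᵐ[Q[|A]] fun w => m (U w)

section Models

variable {𝒳 𝒮 : Type*} [MeasurableSpace 𝒳] [MeasurableSpace 𝒮]

/-- `e` is a version of `e(x) = Q(T = 1 | X = x)`. -/
def IsTreatmentPropensity (Q : Measure (FullData 𝒳 𝒮)) (e : 𝒳 → ℝ) : Prop :=
  IsRegression Q (fun w => ind (T w)) Set.univ X e

/-- `r` is a version of `r(t, x) = Q(R = 1 | T = t, X = x)`. -/
def IsLabelPropensity (Q : Measure (FullData 𝒳 𝒮)) (r : Bool → 𝒳 → ℝ) : Prop :=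
  ∀ t, IsRegression Q (fun w => ind (R w)) {w | T w = t} X (r t)

/-- `r` is a version of `r(t, x, s) = Q(R = 1 | T = t, X = x, S = s)`. -/
def IsLabelPropensityS (Q : Measure (FullData 𝒳 𝒮)) (r : Bool → 𝒳 × 𝒮 → ℝ) : Prop :=
  ∀ t, IsRegression Q (fun w => ind (R w)) {w | T w = t} (fun w => (X w, S w)) (r t)

/-- `μ` is a version of `μ(t, x) = E_Q[Y | T = t, R = 1, X = x]`. -/
def IsOutcomeRegression (Q : Measure (FullData 𝒳 𝒮)) (μ : Bool → 𝒳 → ℝ) : Prop :=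
  ∀ t, IsRegression Q Y {w | T w = t ∧ R w = true} X (μ t)

/-- `μS` is a version of `E_Q[Y | T = t, R = 1, X = x, S = s]`. -/
def IsOutcomeRegressionS (Q : Measure (FullData 𝒳 𝒮)) (μS : Bool → 𝒳 × 𝒮 → ℝ) : Prop :=
  ∀ t, IsRegression Q Y {w | T w = t ∧ R w = true} (fun w => (X w, S w)) (μS t)

/-- The assumptions on a population law: square-integrable potential outcomes, unconfoundedness of
treatment and of labelling, strict overlap with constant `ε`, and `R ⊥ S(t) | T, X`. -/
structure Assumptions [StandardBorelSpace 𝒳] [StandardBorelSpace 𝒮] (ε : ℝ)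
    (Q : ProbabilityMeasure (FullData 𝒳 𝒮)) : Prop where
  memLp : ∀ a, MemLp (Ypot a) 2 (Q : Measure (FullData 𝒳 𝒮))
  /-- `(Y(t), S(t)) ⊥ T | X` -/
  unconfounded_treatment : ∀ t,
    CondIndepFun (MeasurableSpace.comap X inferInstance) measurable_X.comap_le
      (fun w => (Ypot t w, Spot t w)) T (Q : Measure (FullData 𝒳 𝒮))
  /-- `R ⊥ Y(t) | (X, T = t, S(t))` -/
  unconfounded_label : ∀ t,
    CondIndepFun (MeasurableSpace.comap (fun w => (X w, Spot t w)) inferInstance)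
      (measurable_XSpot t).comap_le R (Ypot t) ((Q : Measure (FullData 𝒳 𝒮))[|{w | T w = t}])
  /-- `ε ≤ e(X) ≤ 1 - ε` -/
  overlap_treatment : ∃ e, IsTreatmentPropensity (Q : Measure (FullData 𝒳 𝒮)) e ∧
    ∀ᵐ w ∂(Q : Measure (FullData 𝒳 𝒮)), ε ≤ e (X w) ∧ e (X w) ≤ 1 - ε
  /-- `ε ≤ r(t, X, S(t)) ≤ 1` -/
  overlap_label : ∃ r, IsLabelPropensityS (Q : Measure (FullData 𝒳 𝒮)) r ∧
    ∀ t, ∀ᵐ w ∂(Q : Measure (FullData 𝒳 𝒮)), ε ≤ r t (X w, Spot t w) ∧ r t (X w, Spot t w) ≤ 1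
  /-- `R ⊥ S(t) | T, X` -/
  label_surrogate : ∀ t,
    CondIndepFun (MeasurableSpace.comap (fun w => (T w, X w)) inferInstance)
      measurable_TX.comap_le R (Spot t) (Q : Measure (FullData 𝒳 𝒮))

/-- The model: all population laws that satisfy the assumptions and, if the treatment propensity
score is known (`knowE`), have treatment propensity score `e`, and, if the labelling propensity score
is known (`knowR`), have labelling propensity score `r`. -/
def model [StandardBorelSpace 𝒳] [StandardBorelSpace 𝒮] (ε : ℝ) (e : 𝒳 → ℝ) (r : Bool → 𝒳 → ℝ)
    (knowE knowR : Prop) : Set (ProbabilityMeasure (FullData 𝒳 𝒮)) :=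
  {Q | Assumptions ε Q ∧
    (knowE → IsTreatmentPropensity (Q : Measure (FullData 𝒳 𝒮)) e) ∧
    (knowR → IsLabelPropensity (Q : Measure (FullData 𝒳 𝒮)) r)}

/-- The average treatment effect `E_Q[Y(1)] - E_Q[Y(0)]`. -/
def ate (Q : ProbabilityMeasure (FullData 𝒳 𝒮)) : ℝ :=
  ∫ w, Ypot true w ∂(Q : Measure (FullData 𝒳 𝒮)) - ∫ w, Ypot false w ∂(Q : Measure (FullData 𝒳 𝒮))

end Models

/-! ### Observed data in the four settings -/

section Settings

variable {𝒳 𝒮 : Type*}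

/-- Setting I: `(X, T, Y)` is observed for `R = 1`, and `(X, T)` for `R = 0`. -/
def obsI (w : FullData 𝒳 𝒮) : (𝒳 × Bool × ℝ) ⊕ (𝒳 × Bool) :=
  if R w then Sum.inl (X w, T w, Y w) else Sum.inr (X w, T w)

/-- Setting II: `(X, T, S, Y)` is observed for `R = 1`, and `(X, T)` for `R = 0`. -/
def obsII (w : FullData 𝒳 𝒮) : (𝒳 × Bool × 𝒮 × ℝ) ⊕ (𝒳 × Bool) :=
  if R w then Sum.inl (X w, T w, S w, Y w) else Sum.inr (X w, T w)

/-- Setting III: `(X, T, S, Y)` is observed for `R = 1`, and `(X, T, S)` for `R = 0`. -/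
def obsIII (w : FullData 𝒳 𝒮) : (𝒳 × Bool × 𝒮 × ℝ) ⊕ (𝒳 × Bool × 𝒮) :=
  if R w then Sum.inl (X w, T w, S w, Y w) else Sum.inr (X w, T w, S w)

/-- Setting IV: `(X, T, S, Y)` is observed for all units. -/
def obsIV (w : FullData 𝒳 𝒮) : 𝒳 × Bool × 𝒮 × ℝ := (X w, T w, S w, Y w)

/-! ### The four functions -/

/-- The function of settings I and II. -/
def psiI (e : 𝒳 → ℝ) (r μ : Bool → 𝒳 → ℝ) (δ : ℝ) (w : FullData 𝒳 𝒮) : ℝ :=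
  μ true (X w) - μ false (X w)
    + ind (T w) * ind (R w) / (e (X w) * r true (X w)) * (Y w - μ true (X w))
    - (1 - ind (T w)) * ind (R w) / ((1 - e (X w)) * r false (X w)) * (Y w - μ false (X w))
    - δ

/-- The general function for surrogates observed on all units, with a labelling propensity score that
may depend on the surrogates. -/
def psiGeneral (e : 𝒳 → ℝ) (rS : Bool → 𝒳 × 𝒮 → ℝ) (μ : Bool → 𝒳 → ℝ) (μS : Bool → 𝒳 × 𝒮 → ℝ)
    (δ : ℝ) (w : FullData 𝒳 𝒮) : ℝ :=
  μ true (X w) - μ false (X w)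
    + ind (T w) * ind (R w) / (e (X w) * rS true (X w, S w)) * (Y w - μS true (X w, S w))
    - (1 - ind (T w)) * ind (R w) / ((1 - e (X w)) * rS false (X w, S w))
        * (Y w - μS false (X w, S w))
    + ind (T w) / e (X w) * (μS true (X w, S w) - μ true (X w))
    - (1 - ind (T w)) / (1 - e (X w)) * (μS false (X w, S w) - μ false (X w))
    - δ

/-- The function of setting III. -/
def psiIII (e : 𝒳 → ℝ) (r μ : Bool → 𝒳 → ℝ) (μS : Bool → 𝒳 × 𝒮 → ℝ) (δ : ℝ)
    (w : FullData 𝒳 𝒮) : ℝ :=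
  μ true (X w) - μ false (X w)
    + ind (T w) * ind (R w) / (e (X w) * r true (X w)) * (Y w - μS true (X w, S w))
    - (1 - ind (T w)) * ind (R w) / ((1 - e (X w)) * r false (X w)) * (Y w - μS false (X w, S w))
    + ind (T w) / e (X w) * (μS true (X w, S w) - μ true (X w))
    - (1 - ind (T w)) / (1 - e (X w)) * (μS false (X w, S w) - μ false (X w))
    - δ

/-- The function of setting IV. -/
def psiIV (e : 𝒳 → ℝ) (μ : Bool → 𝒳 → ℝ) (δ : ℝ) (w : FullData 𝒳 𝒮) : ℝ :=
  μ true (X w) - μ false (X w)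
    + ind (T w) / e (X w) * (Y w - μ true (X w))
    - (1 - ind (T w)) / (1 - e (X w)) * (Y w - μ false (X w))
    - δ

end Settings

/-! ### Semiparametric efficiency -/

/-- The family `p` of laws is differentiable in quadratic mean at `0` with score function `g`:
for a dominating measure `ν`, with densities `dp_t`,
`∫ ((√dp_t - √dp_0) / t - (1/2) g √dp_0)² dν → 0` as `t → 0`. -/
def IsQMD {O : Type*} [MeasurableSpace O] (p : ℝ → Measure O) (g : O → ℝ) : Prop :=
  MemLp g 2 (p 0) ∧
  ∃ ν : Measure O, SigmaFinite ν ∧ (∀ t, p t ≪ ν) ∧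
    Tendsto (fun t : ℝ => ∫⁻ o, ENNReal.ofReal
        (((√((p t).rnDeriv ν o).toReal - √((p 0).rnDeriv ν o).toReal) / t
          - 1 / 2 * g o * √((p 0).rnDeriv ν o).toReal) ^ 2) ∂ν)
      (𝓝[≠] 0) (𝓝 0)

section Efficiency

variable {𝒳 𝒮 O : Type*} [MeasurableSpace 𝒳] [MeasurableSpace 𝒮] [MeasurableSpace O]

/-- `Q` is a regular one-dimensional parametric submodel of `M` through `P`, with score function `g`,
when only `obs w` is observed: every `Q t` belongs to `M`, the observed law at `t = 0` is the one of
`P`, the observed laws are differentiable in quadratic mean with score `g`, and the second moments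
of the potential outcomes are bounded along the submodel. -/
structure IsRegularSubmodel (M : Set (ProbabilityMeasure (FullData 𝒳 𝒮))) (obs : FullData 𝒳 𝒮 → O)
    (P : ProbabilityMeasure (FullData 𝒳 𝒮)) (Q : ℝ → ProbabilityMeasure (FullData 𝒳 𝒮))
    (g : O → ℝ) : Prop where
  mem : ∀ t, Q t ∈ M
  obs_zero : (Q 0 : Measure (FullData 𝒳 𝒮)).map obs = (P : Measure (FullData 𝒳 𝒮)).map obs
  qmd : IsQMD (fun t => (Q t : Measure (FullData 𝒳 𝒮)).map obs) g
  moment : ∃ C : ℝ, ∀ t a, ∫ w, Ypot a w ^ 2 ∂(Q t : Measure (FullData 𝒳 𝒮)) ≤ C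

/-- The tangent set, as a subset of `L²(P)`: all scores of regular submodels. -/
def tangentSet (M : Set (ProbabilityMeasure (FullData 𝒳 𝒮))) (obs : FullData 𝒳 𝒮 → O)
    (P : ProbabilityMeasure (FullData 𝒳 𝒮)) :
    Set (Lp ℝ 2 (P : Measure (FullData 𝒳 𝒮))) :=
  {f | ∃ Q g, IsRegularSubmodel M obs P Q g ∧
    f =ᵐ[(P : Measure (FullData 𝒳 𝒮))] fun w => g (obs w)}

/-- `ψ` is the efficient influence function of the parameter `θ` at `P` in the model `M` when `obs w`
is observed: it is square-integrable; `θ` is differentiable along every regular submodel, with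
derivative the inner product of `ψ` and the score; and `ψ` lies in the closed linear span of the
tangent set. -/
def IsEfficientInfluenceFunction (M : Set (ProbabilityMeasure (FullData 𝒳 𝒮)))
    (obs : FullData 𝒳 𝒮 → O) (θ : ProbabilityMeasure (FullData 𝒳 𝒮) → ℝ)
    (P : ProbabilityMeasure (FullData 𝒳 𝒮)) (ψ : FullData 𝒳 𝒮 → ℝ) : Prop :=
  (∀ Q g, IsRegularSubmodel M obs P Q g →
    HasDerivAt (fun t => θ (Q t))
      (∫ w, ψ w * g (obs w) ∂(P : Measure (FullData 𝒳 𝒮))) 0) ∧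
  ∃ h : MemLp ψ 2 (P : Measure (FullData 𝒳 𝒮)),
    h.toLp ψ ∈ (Submodule.span ℝ (tangentSet M obs P)).topologicalClosure

/-- The efficiency lower bound: the supremum, over all regular submodels, of the Cramér-Rao bounds
`(dθ/dt)² / E[g²]` (in `[0, ∞]`, where `0 / 0 = 0` and `c / 0 = ∞` for `c > 0`). -/
def efficiencyBound (M : Set (ProbabilityMeasure (FullData 𝒳 𝒮)))
    (obs : FullData 𝒳 𝒮 → O) (θ : ProbabilityMeasure (FullData 𝒳 𝒮) → ℝ)
    (P : ProbabilityMeasure (FullData 𝒳 𝒮)) : ℝ≥0∞ :=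
  sSup {c | ∃ Q g d, IsRegularSubmodel M obs P Q g ∧ HasDerivAt (fun t => θ (Q t)) d 0 ∧
    c = ENNReal.ofReal (d ^ 2)
      / ENNReal.ofReal (∫ w, g (obs w) ^ 2 ∂(P : Measure (FullData 𝒳 𝒮)))}

/-- `ψ` is the efficient influence function, and `E[ψ²]` is the efficiency lower bound. -/
def IsEfficient (M : Set (ProbabilityMeasure (FullData 𝒳 𝒮)))
    (obs : FullData 𝒳 𝒮 → O) (θ : ProbabilityMeasure (FullData 𝒳 𝒮) → ℝ)
    (P : ProbabilityMeasure (FullData 𝒳 𝒮)) (ψ : FullData 𝒳 𝒮 → ℝ) : Prop :=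
  IsEfficientInfluenceFunction M obs θ P ψ ∧
    efficiencyBound M obs θ P
      = ENNReal.ofReal (∫ w, ψ w ^ 2 ∂(P : Measure (FullData 𝒳 𝒮)))

end Efficiency

end

end SurrogateATE

open MeasureTheory ProbabilityTheory Filter Topology
open scoped ENNReal

namespace SurrogateATE

/-! Two facts are needed in each setting: the stated function is a gradient of the treatment effect
along every regular submodel, and it is an L² limit of scores. Efficiency then follows from
Cauchy–Schwarz (`isEfficient_of_tendsto`).

The settings are instances of one `Scheme`. Let A indicate arm a, let L indicate that the outcome is
observed, and let M be the regression of Y(a) on what is seen of (X, S) for unlabelled units. The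
mean of arm a has the influence function μ + A/e (M − μ) + AL/(e r) (y − M), up to centring. In
settings I and II, M = μ. In setting IV, L = r = 1, so M cancels and may be taken to be μ as well.

Gradient. A submodel is only known to be differentiable in quadratic mean for the observed law;
nothing is assumed about smoothness of its propensity scores e_t, r_t. Inverse weighting identifies
E[Y(a)] at parameter t through e_t and r_t, and the doubly robust expansion
`IsWeighting.integral_armInfluence` rewrites it as the expectation of one fixed function plus a
remainder. In the remainder e_0/e_t − 1 and r_0/r_t − 1 multiply residuals of y. Quadratic mean
differentiability alone forces these two factors to be O(t) in L²
(`HasRootDensities.integral_sq_le`). Hence replacing the law at t by the law at 0 in the remainder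
costs o(t) (`IsQMD.tendsto_integral_mul`), and under the law at 0 the residuals are centred, so the
remainder vanishes. Along the submodel only second moments of the outcomes are controlled, so the
regression functions are truncated first and the truncation is removed at the end. The result is
`IsQMD.hasDerivAt_of_isWeighting`.

Attainment. The assumptions relate treatment and labelling to one arm at a time, and the joint law
of the two arms is never observed. One may therefore redraw the potential variables of the
unassigned arm from their conditional law given X (`recouple`). The observed law does not change,
and afterwards treatment and labelling are randomized given X with respect to all potential
variables together (`IsRandomized`). This property, with the same propensity scores, survives any
change of density by a function of X and the potential variables (`IsRandomized.withDensity`). The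
resulting submodels thus stay in the model even when both propensity scores are known, which is why
such knowledge does not change the bound. The direction of the change is `fullScore`: its
conditional mean given the observed data is the influence function
(`Scheme.integral_mul_fullScore`), because the redrawn arm averages to zero given X and so do the
unseen residuals of the unlabelled units. Truncating `fullScore` gives bounded directions, and
conditional expectation, being an L² contraction, carries their convergence over to the observed
scores (`Scheme.isEfficient`).

The last claim rests on `Assumptions.ae_label_eq`: conditional independence of R and S(t) makes the
two labelling scores agree on the arm T = t. -/

/-! ### Quadratic mean differentiability -/

section QuadraticMean

variable {O : Type*} [MeasurableSpace O]

/-- `s t` is a square root of the density of `p t` with respect to `ν`, and `t ↦ s t` is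
differentiable in `L²(ν)` at `0`, with derivative `(1/2) g s 0`. -/
structure HasRootDensities (p : ℝ → Measure O) (g : O → ℝ) (ν : Measure O) (s : ℝ → O → ℝ) :
    Prop where
  measurable_root : ∀ t, Measurable (s t)
  measurable_score : Measurable g
  integral_eq : ∀ t (f : O → ℝ), ∫ o, f o ∂p t = ∫ o, f o * s t o ^ 2 ∂ν
  integrable_iff : ∀ t (f : O → ℝ), Integrable f (p t) ↔ Integrable (fun o => f o * s t o ^ 2) ν
  integrable_score : Integrable (fun o => (1 / 2 * g o * s 0 o) ^ 2) ν
  integrable_sub : ∀ t, Integrable (fun o => ((s t o - s 0 o) / t - 1 / 2 * g o * s 0 o) ^ 2) ν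
  tendsto_sub : Tendsto (fun t => ∫ o, ((s t o - s 0 o) / t - 1 / 2 * g o * s 0 o) ^ 2 ∂ν)
    (𝓝[≠] 0) (𝓝 0)

theorem integrable_of_abs_le {μ : Measure O} {f h : O → ℝ} (hh : Integrable h μ)
    (hf : AEStronglyMeasurable f μ) (hfh : ∀ o, |f o| ≤ h o) : Integrable f μ :=
  hh.mono' hf (ae_of_all _ hfh)

/-- The score is determined only up to null sets of `p 0`. A Borel version of it makes all later
integrands measurable and turns the limit of lower integrals into one of Bochner integrals. -/
theorem IsQMD.exists_hasRootDensities {p : ℝ → Measure O} {g : O → ℝ} (h : IsQMD p g)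
    [∀ t, IsProbabilityMeasure (p t)] :
    ∃ ν s g', g =ᵐ[p 0] g' ∧ MemLp g' 2 (p 0) ∧ HasRootDensities p g' ν s := by
  obtain ⟨hg, ν, hν, hp, hlim⟩ := h
  set g' := hg.1.mk g with hg'
  have hgg' : g =ᵐ[p 0] g' := hg.1.ae_eq_mk
  have hmem' : MemLp g' 2 (p 0) := hg.ae_eq hgg'
  have hmg : Measurable g' := hg.1.stronglyMeasurable_mk.measurable
  set s : ℝ → O → ℝ := fun t o => √((p t).rnDeriv ν o).toReal with hs
  have hms : ∀ t, Measurable (s t) := fun t =>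
    ((p t).measurable_rnDeriv ν).ennreal_toReal.sqrt
  have hsq : ∀ t o, s t o ^ 2 = ((p t).rnDeriv ν o).toReal := fun t o =>
    Real.sq_sqrt ENNReal.toReal_nonneg
  have hint : ∀ t (f : O → ℝ), ∫ o, f o ∂p t = ∫ o, f o * s t o ^ 2 ∂ν := by
    intro t f
    rw [← integral_rnDeriv_smul (hp t)]
    simp only [hsq, smul_eq_mul, mul_comm]
  have hiff : ∀ t (f : O → ℝ), Integrable f (p t) ↔ Integrable (fun o => f o * s t o ^ 2) ν := by
    intro t f
    rw [← integrable_rnDeriv_smul_iff (hp t)]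
    simp only [hsq, smul_eq_mul, mul_comm]
  have hs2 : ∀ t, Integrable (fun o => s t o ^ 2) ν := by
    intro t
    simpa using (hiff t (fun _ => 1)).1 (integrable_const _)
  have hgs : Integrable (fun o => (1 / 2 * g' o * s 0 o) ^ 2) ν := by
    have := ((hiff 0 _).1 hmem'.integrable_sq).const_mul (1 / 4)
    refine this.congr (ae_of_all _ fun o => ?_)
    simp only; ring
  have hsub : ∀ t, Integrable (fun o => ((s t o - s 0 o) / t - 1 / 2 * g' o * s 0 o) ^ 2) ν := by
    intro t
    refine integrable_of_abs_le (((((hs2 t).add (hs2 0)).const_mul (4 / t ^ 2))).add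
      (hgs.const_mul 2)) ?_ fun o => ?_
    · exact (((((hms t).sub (hms 0)).div_const _).sub
        ((hmg.const_mul _).mul (hms 0))).pow_const 2).aestronglyMeasurable
    · rw [abs_of_nonneg (sq_nonneg _)]
      simp only [Pi.add_apply]
      have h1 : 4 / t ^ 2 * (s t o ^ 2 + s 0 o ^ 2)
          = 2 * ((s t o - s 0 o) / t) ^ 2 + 2 * ((s t o + s 0 o) / t) ^ 2 := by
        ring
      rw [h1]
      nlinarith [sq_nonneg ((s t o - s 0 o) / t + 1 / 2 * g' o * s 0 o),
        sq_nonneg ((s t o + s 0 o) / t)]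
  -- Where the density of `p 0` is zero both products vanish; elsewhere a null set of `p 0` is a
  -- null set of `ν`.
  have hae : ∀ᵐ o ∂ν, g o * s 0 o = g' o * s 0 o := by
    have h0 := hgg'
    rw [← Measure.withDensity_rnDeriv_eq _ _ (hp 0), Filter.EventuallyEq,
      ae_withDensity_iff ((p 0).measurable_rnDeriv ν)] at h0
    filter_upwards [h0] with o ho
    by_cases hz : (p 0).rnDeriv ν o = 0
    · simp [hs, hz]
    · rw [ho hz]
  refine ⟨ν, s, g', hgg', hmem', hms, hmg, hint, hiff, hgs, hsub, ?_⟩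
  have h2 := (ENNReal.tendsto_toReal ENNReal.zero_ne_top).comp hlim
  refine h2.congr fun t => ?_
  simp only [Function.comp_apply]
  rw [integral_eq_lintegral_of_nonneg_ae (ae_of_all _ fun o => sq_nonneg _)
    (hsub t).aestronglyMeasurable]
  congr 1
  refine lintegral_congr_ae ?_
  filter_upwards [hae] with o ho
  have : 1 / 2 * g o * √((p 0).rnDeriv ν o).toReal = 1 / 2 * g' o * s 0 o := by
    rw [mul_assoc, mul_assoc]; exact congrArg _ ho
  rw [this]

variable {p : ℝ → Measure O} {g : O → ℝ} {ν : Measure O} {s : ℝ → O → ℝ}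

theorem mul_le_weighted_sq {lam : ℝ} (hlam : 0 < lam) (x y : ℝ) :
    x * y ≤ lam * x ^ 2 + 1 / (4 * lam) * y ^ 2 := by
  have h1 : 0 ≤ lam * (x - 1 / (2 * lam) * y) ^ 2 := by positivity
  have h2 : lam * (x - 1 / (2 * lam) * y) ^ 2
      = lam * x ^ 2 + 1 / (4 * lam) * y ^ 2 - x * y := by
    field_simp; ring
  linarith

theorem abs_mul_le_weighted_sq {lam : ℝ} (hlam : 0 < lam) (x y : ℝ) :
    |x * y| ≤ lam * x ^ 2 + 1 / (4 * lam) * y ^ 2 := by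
  have := mul_le_weighted_sq hlam |x| |y|
  rwa [sq_abs, sq_abs, ← abs_mul] at this

/-- Here `a` and `b` play the roots of the densities at `t` and `0`, `d` is their difference
quotient and `D` its L² limit. The first product is small because `d - D` is. In the second the
factor `t` suffices where |Z| ≤ N, and where |Z| > N only a tail of D² is left. -/
theorem abs_remainder_le {a b d D F Z t lam N : ℝ} (had : a - b = t * d) (hFZ : |F| ≤ |Z|)
    (hlam : 0 < lam) (hN : 0 < N) :
    |F * (a + b) * (d - D) + F * (t * d) * D| ≤
      4 * lam * (Z ^ 2 * a ^ 2 + Z ^ 2 * b ^ 2) + 1 / (4 * lam) * (d - D) ^ 2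
        + N * |t| * ((d - D) ^ 2 + 2 * D ^ 2)
        + 1 / (4 * lam) * (D ^ 2 * (if N < |Z| then 1 else 0)) := by
  have hF2 : F ^ 2 ≤ Z ^ 2 := sq_le_sq.2 hFZ
  have hsum : ∀ c : ℝ, c ^ 2 ≤ 2 * (a ^ 2 + b ^ 2) →
      lam * (F * c) ^ 2 ≤ 2 * lam * (Z ^ 2 * a ^ 2 + Z ^ 2 * b ^ 2) := by
    intro c hc
    calc lam * (F * c) ^ 2 = lam * (F ^ 2 * c ^ 2) := by ring
      _ ≤ lam * (Z ^ 2 * (2 * (a ^ 2 + b ^ 2))) := by gcongr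
      _ = _ := by ring
  have b1 : |F * (a + b) * (d - D)| ≤
      2 * lam * (Z ^ 2 * a ^ 2 + Z ^ 2 * b ^ 2) + 1 / (4 * lam) * (d - D) ^ 2 :=
    (abs_mul_le_weighted_sq hlam _ _).trans
      (add_le_add_left (hsum _ (by nlinarith [sq_nonneg (a - b)])) _)
  have b2 : |F * (t * d) * D| ≤ 2 * lam * (Z ^ 2 * a ^ 2 + Z ^ 2 * b ^ 2)
      + N * |t| * ((d - D) ^ 2 + 2 * D ^ 2)
      + 1 / (4 * lam) * (D ^ 2 * (if N < |Z| then 1 else 0)) := by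
    split_ifs with hN'
    · have h1 := abs_mul_le_weighted_sq hlam (F * (t * d)) D
      have h2 := hsum (t * d) (by rw [← had]; nlinarith [sq_nonneg (a + b)])
      have h3 : 0 ≤ N * |t| * ((d - D) ^ 2 + 2 * D ^ 2) := by positivity
      rw [mul_one]
      linarith
    · have h1 : |F| ≤ N := hFZ.trans (not_lt.1 hN')
      have h2 : |F * (t * d) * D| = |F| * (|t| * |d * D|) := by
        simp only [abs_mul]; ring
      have h3 : |d * D| ≤ (d - D) ^ 2 + 2 * D ^ 2 := by
        rw [abs_le]
        constructor
        · nlinarith [sq_nonneg (2 * d - D), sq_nonneg D]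
        · nlinarith [sq_nonneg (2 * d - 3 * D), sq_nonneg D]
      have h4 : 0 ≤ 2 * lam * (Z ^ 2 * a ^ 2 + Z ^ 2 * b ^ 2) := by positivity
      rw [h2, mul_zero, mul_zero, add_zero]
      calc |F| * (|t| * |d * D|) ≤ N * (|t| * ((d - D) ^ 2 + 2 * D ^ 2)) := by gcongr
        _ = N * |t| * ((d - D) ^ 2 + 2 * D ^ 2) := by ring
        _ ≤ _ := le_add_of_nonneg_left h4
  refine (abs_add_le _ _).trans ?_
  linarith

/-- The integrand may vary with the parameter: a common envelope whose second moment is bounded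
along the family is enough. This generality is needed for the remainder terms, which contain the
propensity scores at `t`. -/
theorem HasRootDensities.tendsto_integral (h : HasRootDensities p g ν s)
    {Z : O → ℝ} (hZ : Measurable Z) {K : ℝ}
    (hZi : ∀ t, Integrable (fun o => Z o ^ 2) (p t)) (hZK : ∀ t, ∫ o, Z o ^ 2 ∂p t ≤ K)
    {F : ℝ → O → ℝ} (hF : ∀ t, Measurable (F t)) (hFZ : ∀ t o, |F t o| ≤ |Z o|)
    (hone : ∀ t, Integrable (fun _ => (1 : ℝ)) (p t)) :
    Tendsto (fun t => (∫ o, F t o ∂p t - ∫ o, F t o ∂p 0) / t - ∫ o, F t o * g o ∂p 0)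
      (𝓝[≠] 0) (𝓝 0) := by
  have hms := h.measurable_root
  have hmg := h.measurable_score
  have hZs : ∀ t, Integrable (fun o => Z o ^ 2 * s t o ^ 2) ν := fun t =>
      (h.integrable_iff t _).1 (hZi t)
  have hFint : ∀ t u, Integrable (fun o => F t o * s u o ^ 2) ν := by
    intro t u
    rw [← h.integrable_iff]
    refine integrable_of_abs_le ((hone u).add (hZi u)) (hF t).aestronglyMeasurable fun o => ?_
    have := hFZ t o
    simp only [Pi.add_apply]
    nlinarith [sq_abs (Z o), sq_nonneg (|Z o| - 1), abs_nonneg (Z o)]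
  have hD := h.integrable_score
  have hFg : ∀ t, Integrable (fun o => F t o * g o * s 0 o ^ 2) ν := by
    intro t
    refine integrable_of_abs_le ((hZs 0).add (hD.const_mul 4)) ?_ fun o => ?_
    · exact (((hF t).mul hmg).mul ((hms 0).pow_const 2)).aestronglyMeasurable
    · have h1 := hFZ t o
      have h2 : F t o * g o * s 0 o ^ 2 = (F t o * s 0 o) * (g o * s 0 o) := by ring
      have h3 : F t o ^ 2 ≤ Z o ^ 2 := sq_le_sq.2 h1
      simp only [Pi.add_apply]
      rw [h2, abs_le]
      constructor <;>
        nlinarith [sq_nonneg (F t o * s 0 o + g o * s 0 o), sq_nonneg (F t o * s 0 o - g o * s 0 o),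
          mul_le_mul_of_nonneg_right h3 (sq_nonneg (s 0 o)), sq_nonneg (g o * s 0 o)]
  set D : O → ℝ := fun o => 1 / 2 * g o * s 0 o with hDdef
  set err : ℝ → ℝ := fun t => ∫ o, ((s t o - s 0 o) / t - D o) ^ 2 ∂ν with herr
  set tail : ℝ → ℝ := fun N => ∫ o, D o ^ 2 * (if N < |Z o| then 1 else 0) ∂ν with htail
  have htint : ∀ N : ℝ, Integrable (fun o => D o ^ 2 * (if N < |Z o| then 1 else 0)) ν := by
    intro N
    refine integrable_of_abs_le hD ?_ fun o => ?_
    · exact (hD.aestronglyMeasurable.mul (Measurable.ite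
        (measurableSet_lt measurable_const hZ.abs) measurable_const
        measurable_const).aestronglyMeasurable)
    · change |D o ^ 2 * _| ≤ D o ^ 2
      split_ifs <;> simp [sq_nonneg]
  have hsub := h.integrable_sub
  have hmain : ∀ t ≠ 0, ∀ lam > 0, ∀ N > 0,
      |(∫ o, F t o ∂p t - ∫ o, F t o ∂p 0) / t - ∫ o, F t o * g o ∂p 0| ≤
        8 * lam * K + 1 / (4 * lam) * err t + N * |t| * (err t + 2 * ∫ o, D o ^ 2 ∂ν)
          + 1 / (4 * lam) * tail N := by
    intro t ht lam hlam N hN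
    have e1 : (∫ o, F t o ∂p t - ∫ o, F t o ∂p 0) / t - ∫ o, F t o * g o ∂p 0
        = ∫ o, ((F t o * s t o ^ 2 - F t o * s 0 o ^ 2) / t - F t o * g o * s 0 o ^ 2) ∂ν := by
      rw [h.integral_eq, h.integral_eq, h.integral_eq, integral_sub, integral_div, integral_sub]
      · exact hFint t t
      · exact hFint t 0
      · exact ((hFint t t).sub (hFint t 0)).div_const t
      · exact hFg t
    have i1 : Integrable (fun o => 4 * lam * (Z o ^ 2 * s t o ^ 2 + Z o ^ 2 * s 0 o ^ 2)) ν :=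
      ((hZs t).add (hZs 0)).const_mul _
    have i2 : Integrable (fun o => 1 / (4 * lam) * ((s t o - s 0 o) / t - D o) ^ 2) ν :=
      (hsub t).const_mul _
    have i3 : Integrable (fun o => N * |t| * (((s t o - s 0 o) / t - D o) ^ 2 + 2 * D o ^ 2)) ν :=
      ((hsub t).add (hD.const_mul 2)).const_mul _
    have i4 : Integrable (fun o => 1 / (4 * lam) * (D o ^ 2 * (if N < |Z o| then 1 else 0))) ν :=
      (htint N).const_mul _
    have e2 : ∫ o, (4 * lam * (Z o ^ 2 * s t o ^ 2 + Z o ^ 2 * s 0 o ^ 2)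
          + 1 / (4 * lam) * ((s t o - s 0 o) / t - D o) ^ 2
          + N * |t| * (((s t o - s 0 o) / t - D o) ^ 2 + 2 * D o ^ 2)
          + 1 / (4 * lam) * (D o ^ 2 * (if N < |Z o| then 1 else 0))) ∂ν
        ≤ 8 * lam * K + 1 / (4 * lam) * err t + N * |t| * (err t + 2 * ∫ o, D o ^ 2 ∂ν)
          + 1 / (4 * lam) * tail N := by
      have i12 : Integrable (fun o => 4 * lam * (Z o ^ 2 * s t o ^ 2 + Z o ^ 2 * s 0 o ^ 2)
          + 1 / (4 * lam) * ((s t o - s 0 o) / t - D o) ^ 2) ν := i1.add i2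
      have i123 : Integrable (fun o => 4 * lam * (Z o ^ 2 * s t o ^ 2 + Z o ^ 2 * s 0 o ^ 2)
          + 1 / (4 * lam) * ((s t o - s 0 o) / t - D o) ^ 2
          + N * |t| * (((s t o - s 0 o) / t - D o) ^ 2 + 2 * D o ^ 2)) ν := i12.add i3
      rw [integral_add i123 i4, integral_add i12 i3, integral_add i1 i2,
        integral_const_mul, integral_const_mul, integral_const_mul, integral_const_mul,
        integral_add (hZs t) (hZs 0), integral_add (hsub t) (hD.const_mul 2), integral_const_mul,
        ← h.integral_eq, ← h.integral_eq]
      have := hZK t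
      have := hZK 0
      rw [show 8 * lam * K = 4 * lam * (K + K) by ring]
      gcongr
    rw [e1]
    refine (abs_integral_le_integral_abs).trans (le_trans ?_ e2)
    refine integral_mono_ae ?_ (((i1.add i2).add i3).add i4) (ae_of_all _ fun o => ?_)
    · exact ((((hFint t t).sub (hFint t 0)).div_const t).sub (hFg t)).abs
    simp only
    set a := s t o
    set b := s 0 o
    set d := (a - b) / t with hd
    have had : a - b = t * d := by rw [hd]; field_simp
    -- Since D = g b / 2, the identity is (a² − b²)/t − g b² = (a + b)(d − D) + (a − b) D.
    have e3 : (F t o * a ^ 2 - F t o * b ^ 2) / t - F t o * g o * b ^ 2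
        = F t o * (a + b) * (d - D o) + F t o * (t * d) * D o := by
      have h1 : (F t o * a ^ 2 - F t o * b ^ 2) / t = F t o * (a + b) * d := by
        rw [hd]; ring
      have h2 : D o = 1 / 2 * g o * b := rfl
      rw [h1, ← had, h2]; ring
    rw [e3]
    exact abs_remainder_le had (hFZ t o) hlam hN
  have htail0 : Tendsto (fun n : ℕ => tail n) atTop (𝓝 0) := by
    have : Tendsto (fun n : ℕ => tail n) atTop (𝓝 (∫ o, (0 : ℝ) ∂ν)) := by
      refine tendsto_integral_of_dominated_convergence (fun o => D o ^ 2)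
        (fun n => (htint n).aestronglyMeasurable) hD (fun n => ae_of_all _ fun o => ?_)
        (ae_of_all _ fun o => ?_)
      · split_ifs <;> simp [sq_nonneg]
      · obtain ⟨n₀, hn₀⟩ := exists_nat_ge |Z o|
        refine tendsto_const_nhds.congr' ?_
        filter_upwards [eventually_ge_atTop n₀] with n hn
        have : ¬ ((n : ℝ) < |Z o|) := not_lt.2 (hn₀.trans (by exact_mod_cast hn))
        simp [this]
    simpa using this
  rw [Metric.tendsto_nhds]
  intro η hη
  have hK0 : 0 ≤ K := (integral_nonneg fun o => sq_nonneg _).trans (hZK 0)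
  -- The error is split in quarters of `η`: `lam` makes 8 lam K at most η/4, then `n` makes the tail
  -- term at most η/4, and with `lam` and `n` fixed the remaining terms vanish as t → 0.
  set lam := η / (32 * (K + 1)) with hlam
  have hlam0 : 0 < lam := by positivity
  obtain ⟨n, hn, hn0⟩ := ((htail0.eventually (gt_mem_nhds (show 0 < lam * η by positivity))).and
    (eventually_gt_atTop 0)).exists
  have hn0' : (0 : ℝ) < n := by exact_mod_cast hn0
  have herr0 : Tendsto err (𝓝[≠] 0) (𝓝 0) := h.tendsto_sub
  have habs : Tendsto (fun t : ℝ => |t|) (𝓝[≠] 0) (𝓝 0) := by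
    have : Tendsto (fun t : ℝ => |t|) (𝓝 0) (𝓝 |0|) := continuous_abs.tendsto 0
    rw [abs_zero] at this
    exact this.mono_left nhdsWithin_le_nhds
  have hlim : Tendsto (fun t => 1 / (4 * lam) * err t + n * |t| * (err t + 2 * ∫ o, D o ^ 2 ∂ν))
      (𝓝[≠] 0) (𝓝 (1 / (4 * lam) * 0 + n * 0 * (0 + 2 * ∫ o, D o ^ 2 ∂ν))) :=
    (herr0.const_mul _).add ((habs.const_mul _).mul (herr0.add_const _))
  simp only [mul_zero, zero_mul, add_zero] at hlim
  filter_upwards [hlim.eventually (gt_mem_nhds (show 0 < η / 4 by positivity)),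
    self_mem_nhdsWithin] with t ht1 ht0
  rw [Real.dist_eq, sub_zero]
  refine (hmain t ht0 lam hlam0 n hn0').trans_lt ?_
  have h1 : 8 * lam * K ≤ η / 4 := by
    rw [hlam, show 8 * (η / (32 * (K + 1))) * K = η / 4 * (K / (K + 1)) by field_simp; ring]
    have : K / (K + 1) ≤ 1 := by rw [div_le_one (by linarith)]; linarith
    nlinarith
  have h2 : 1 / (4 * lam) * tail n ≤ η / 4 := by
    calc 1 / (4 * lam) * tail n ≤ 1 / (4 * lam) * (lam * η) := by gcongr
      _ = η / 4 := by field_simp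
  linarith

/-- A self-bounding argument. Since φ_t k has mean zero at parameter 0, c ∫ φ_t² dp_t is at most the
integral of φ_t k against p_t − p_0. That is at most a multiple of the L² norm of φ_t (s_t + s_0)
times that of s_t − s_0. The first factor is absorbed on the left, and the second is O(t) by
differentiability of the roots. No regularity of φ in t enters. -/
theorem HasRootDensities.integral_sq_le (h : HasRootDensities p g ν s)
    (hone : ∀ t, Integrable (fun _ => (1 : ℝ)) (p t))
    {φ : ℝ → O → ℝ} {k : O → ℝ} {C c : ℝ} (hc : 0 < c) (hφ : ∀ t, Measurable (φ t))
    (hφC : ∀ t o, |φ t o| ≤ C) (hk : Measurable k) (hkC : ∀ o, |k o| ≤ C)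
    (h0 : ∀ t, ∫ o, φ t o * k o ∂p 0 = 0)
    (ht : ∀ t, c * ∫ o, φ t o ^ 2 ∂p t ≤ ∫ o, φ t o * k o ∂p t) :
    ∃ C', ∀ᶠ t in 𝓝[≠] 0, ∫ o, φ t o ^ 2 ∂p 0 ≤ C' * t ^ 2 := by
  have hms := h.measurable_root
  have hmg := h.measurable_score
  have hD := h.integrable_score
  set D : O → ℝ := fun o => 1 / 2 * g o * s 0 o with hDdef
  have hs2 : ∀ t, Integrable (fun o => s t o ^ 2) ν := by
    intro t
    simpa using (h.integrable_iff t (fun _ => 1)).1 (hone t)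
  have hd2 : ∀ t, Integrable (fun o => (s t o - s 0 o) ^ 2) ν := by
    intro t
    refine integrable_of_abs_le (((hs2 t).add (hs2 0)).const_mul 2)
      (((hms t).sub (hms 0)).pow_const 2).aestronglyMeasurable fun o => ?_
    rw [abs_of_nonneg (sq_nonneg _)]
    simp only [Pi.add_apply]
    nlinarith [sq_nonneg (s t o + s 0 o)]
  have hφk : ∀ t u, Integrable (fun o => φ t o * k o * s u o ^ 2) ν := by
    intro t u
    refine integrable_of_abs_le ((hs2 u).const_mul (C * C))
      (((hφ t).mul hk).mul ((hms u).pow_const 2)).aestronglyMeasurable fun o => ?_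
    rw [abs_mul, abs_mul, abs_of_nonneg (sq_nonneg (s u o))]
    have := hφC t o
    have := hkC o
    have hC : 0 ≤ C := (abs_nonneg _).trans this
    gcongr
  have hφsq : ∀ t o, φ t o ^ 2 ≤ C ^ 2 := by
    intro t o
    have := hφC t o
    rw [← sq_abs (φ t o)]
    gcongr
  have hksq : ∀ o, k o ^ 2 ≤ C ^ 2 := by
    intro o
    have := hkC o
    rw [← sq_abs (k o)]
    gcongr
  have hφ2 : ∀ t u, Integrable (fun o => φ t o ^ 2 * s u o ^ 2) ν := by
    intro t u
    refine integrable_of_abs_le ((hs2 u).const_mul (C ^ 2))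
      (((hφ t).pow_const 2).mul ((hms u).pow_const 2)).aestronglyMeasurable fun o => ?_
    rw [abs_of_nonneg (by positivity)]
    exact mul_le_mul_of_nonneg_right (hφsq t o) (sq_nonneg _)
  -- With this choice 8η = c/2, so half of the left-hand side of `key` absorbs the first term on the
  -- right.
  set η := c / 16 with hη
  have hη0 : 0 < η := by positivity
  set B := 2 * η * C ^ 2 + C ^ 2 / (4 * η) with hB
  have hB0 : 0 ≤ B := by positivity
  have key : ∀ t, c * ∫ o, φ t o ^ 2 * s t o ^ 2 ∂ν ≤
      8 * η * ∫ o, φ t o ^ 2 * s t o ^ 2 ∂ν + B * ∫ o, (s t o - s 0 o) ^ 2 ∂ν := by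
    intro t
    have e1 : ∫ o, φ t o * k o ∂p t
        = ∫ o, (φ t o * k o * s t o ^ 2 - φ t o * k o * s 0 o ^ 2) ∂ν := by
      rw [integral_sub (hφk t t) (hφk t 0), ← h.integral_eq, ← h.integral_eq, h0, sub_zero]
    rw [← h.integral_eq]
    refine (ht t).trans ?_
    rw [e1, h.integral_eq, ← integral_const_mul, ← integral_const_mul,
      ← integral_add ((hφ2 t t).const_mul _) ((hd2 t).const_mul _)]
    refine integral_mono ((hφk t t).sub (hφk t 0))
      (((hφ2 t t).const_mul _).add ((hd2 t).const_mul _)) fun o => ?_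
    set a := s t o
    set b := s 0 o
    have e2 : φ t o * k o * a ^ 2 - φ t o * k o * b ^ 2
        = (φ t o * (a + b)) * (k o * (a - b)) := by ring
    rw [e2]
    refine (mul_le_weighted_sq hη0 _ _).trans ?_
    have h3 : (a + b) ^ 2 ≤ 8 * a ^ 2 + 2 * (a - b) ^ 2 := by
      nlinarith [sq_nonneg (2 * a - (a - b) + 2 * a - 2 * b), sq_nonneg (3 * a - b)]
    have h4 : (φ t o * (a + b)) ^ 2 ≤ 8 * (φ t o ^ 2 * a ^ 2) + 2 * (C ^ 2 * (a - b) ^ 2) := by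
      have := mul_le_mul_of_nonneg_left h3 (sq_nonneg (φ t o))
      have := mul_le_mul_of_nonneg_right (hφsq t o) (sq_nonneg (a - b))
      nlinarith
    have h5 : (k o * (a - b)) ^ 2 ≤ C ^ 2 * (a - b) ^ 2 := by
      have := mul_le_mul_of_nonneg_right (hksq o) (sq_nonneg (a - b))
      nlinarith
    calc η * (φ t o * (a + b)) ^ 2 + 1 / (4 * η) * (k o * (a - b)) ^ 2
        ≤ η * (8 * (φ t o ^ 2 * a ^ 2) + 2 * (C ^ 2 * (a - b) ^ 2))
          + 1 / (4 * η) * (C ^ 2 * (a - b) ^ 2) := by gcongr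
      _ = 8 * η * (φ t o ^ 2 * a ^ 2) + B * (a - b) ^ 2 := by rw [hB]; ring
  refine ⟨(2 * (2 * B / c) + 2 * C ^ 2) * (2 + 2 * ∫ o, D o ^ 2 ∂ν), ?_⟩
  filter_upwards [h.tendsto_sub.eventually (gt_mem_nhds one_pos), self_mem_nhdsWithin] with t he ht0
  have ht0 : t ≠ 0 := ht0
  have hh : ∫ o, (s t o - s 0 o) ^ 2 ∂ν ≤ (2 + 2 * ∫ o, D o ^ 2 ∂ν) * t ^ 2 := by
    have : ∫ o, (s t o - s 0 o) ^ 2 ∂ν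
        ≤ ∫ o, t ^ 2 * (2 * ((s t o - s 0 o) / t - D o) ^ 2 + 2 * D o ^ 2) ∂ν := by
      refine integral_mono (hd2 t)
        ((((h.integrable_sub t).const_mul 2).add (hD.const_mul 2)).const_mul _) fun o => ?_
      simp only
      set d := (s t o - s 0 o) / t with hd
      have had : s t o - s 0 o = t * d := by rw [hd]; field_simp
      rw [had]
      nlinarith [mul_nonneg (sq_nonneg t) (sq_nonneg (d - 2 * D o))]
    refine this.trans ?_
    rw [integral_const_mul, integral_add ((h.integrable_sub t).const_mul 2) (hD.const_mul 2),
      integral_const_mul, integral_const_mul, mul_comm]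
    gcongr
    linarith
  have hk' := key t
  have ha : ∫ o, φ t o ^ 2 * s t o ^ 2 ∂ν ≤ 2 * B / c * ∫ o, (s t o - s 0 o) ^ 2 ∂ν := by
    rw [div_mul_eq_mul_div, le_div_iff₀ hc]
    rw [hη] at hk'
    linarith
  -- Returning from the law at `t` to the law at `0` costs another multiple of ‖s t − s 0‖², by b² ≤
  -- 2a² + 2(a − b)².
  have hb : ∫ o, φ t o ^ 2 ∂p 0 ≤
      2 * ∫ o, φ t o ^ 2 * s t o ^ 2 ∂ν + 2 * C ^ 2 * ∫ o, (s t o - s 0 o) ^ 2 ∂ν := by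
    rw [h.integral_eq, ← integral_const_mul, ← integral_const_mul,
      ← integral_add ((hφ2 t t).const_mul _) ((hd2 t).const_mul _)]
    refine integral_mono (hφ2 t 0) (((hφ2 t t).const_mul _).add ((hd2 t).const_mul _)) fun o => ?_
    have h1 := mul_le_mul_of_nonneg_right (hφsq t o) (sq_nonneg (s t o - s 0 o))
    nlinarith [mul_nonneg (sq_nonneg (φ t o)) (sq_nonneg (2 * s t o - s 0 o))]
  have hA : 0 ≤ 2 * (2 * B / c) + 2 * C ^ 2 := by positivity
  calc ∫ o, φ t o ^ 2 ∂p 0 ≤ (2 * (2 * B / c) + 2 * C ^ 2) * ∫ o, (s t o - s 0 o) ^ 2 ∂ν := by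
        linarith
    _ ≤ (2 * (2 * B / c) + 2 * C ^ 2) * ((2 + 2 * ∫ o, D o ^ 2 ∂ν) * t ^ 2) := by gcongr
    _ = _ := by ring

end QuadraticMean

/-! ### Truncation to a bounded interval -/

section Clamp

/-- The projection of `z` to the interval `[a, b]`. -/
def clamp (a b z : ℝ) : ℝ := max a (min b z)

theorem measurable_clamp (a b : ℝ) : Measurable (clamp a b) :=
  measurable_const.max (measurable_const.min measurable_id)

theorem clamp_mem {a b : ℝ} (h : a ≤ b) (z : ℝ) : clamp a b z ∈ Set.Icc a b :=
  ⟨le_max_left _ _, max_le h (min_le_left _ _)⟩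

theorem clamp_eq_self {a b z : ℝ} (h : z ∈ Set.Icc a b) : clamp a b z = z := by
  rw [clamp, min_eq_right h.2, max_eq_right h.1]

theorem abs_clamp_le {n : ℝ} (hn : 0 ≤ n) (z : ℝ) : |clamp (-n) n z| ≤ n :=
  abs_le.2 (clamp_mem (by linarith) z)

theorem abs_sub_clamp_le {n : ℝ} (hn : 0 ≤ n) (z : ℝ) : |z - clamp (-n) n z| ≤ |z| := by
  unfold clamp
  rcases le_total z 0 with hz | hz
  · have : min n z = z := min_eq_right (hz.trans hn)
    rw [this, abs_of_nonpos hz, abs_le]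
    rcases max_cases (-n) z with h | h <;> constructor <;> linarith
  · have h1 : max (-n) (min n z) = min n z := max_eq_right (by
      rcases min_cases n z with h | h <;> linarith)
    rw [h1, abs_of_nonneg hz, abs_le]
    rcases min_cases n z with h | h <;> constructor <;> linarith

theorem abs_clamp_le_abs {n : ℝ} (hn : 0 ≤ n) (z : ℝ) : |clamp (-n) n z| ≤ |z| := by
  unfold clamp
  rcases le_total z 0 with hz | hz
  · have : min n z = z := min_eq_right (hz.trans hn)
    rw [this, abs_of_nonpos hz, abs_le]
    rcases max_cases (-n) z with h | h <;> constructor <;> linarith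
  · have h1 : max (-n) (min n z) = min n z := max_eq_right (by
      rcases min_cases n z with h | h <;> linarith)
    rw [h1, abs_of_nonneg hz, abs_le]
    rcases min_cases n z with h | h <;> constructor <;> linarith

theorem eventually_clamp_eq (z : ℝ) : ∀ᶠ n : ℕ in atTop, clamp (-n) n z = z := by
  obtain ⟨n₀, hn₀⟩ := exists_nat_ge |z|
  filter_upwards [eventually_ge_atTop n₀] with n hn
  have h : |z| ≤ n := hn₀.trans (by exact_mod_cast hn)
  exact clamp_eq_self (abs_le.1 h)

theorem tendsto_clamp (z : ℝ) : Tendsto (fun n : ℕ => clamp (-n) n z) atTop (𝓝 z) :=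
  tendsto_const_nhds.congr' ((eventually_clamp_eq z).mono fun _ h => h.symm)

variable {O : Type*} [MeasurableSpace O]

theorem tendsto_integral_sub_clamp_sq {μ : Measure O} {W : O → ℝ} (hW : MemLp W 2 μ) :
    Tendsto (fun n : ℕ => ∫ o, (W o - clamp (-n) n (W o)) ^ 2 ∂μ) atTop (𝓝 0) := by
  have : Tendsto (fun n : ℕ => ∫ o, (W o - clamp (-n) n (W o)) ^ 2 ∂μ) atTop
      (𝓝 (∫ o, (0 : ℝ) ∂μ)) := by
    refine tendsto_integral_of_dominated_convergence (fun o => W o ^ 2) (fun n => ?_)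
      hW.integrable_sq (fun n => ae_of_all _ fun o => ?_) (ae_of_all _ fun o => ?_)
    · exact (hW.1.sub ((measurable_clamp _ _).comp_aemeasurable
        hW.1.aemeasurable).aestronglyMeasurable).pow 2
    · rw [Real.norm_eq_abs, abs_of_nonneg (sq_nonneg _)]
      exact sq_le_sq.2 (abs_sub_clamp_le (Nat.cast_nonneg n) _)
    · refine tendsto_const_nhds.congr' ((eventually_clamp_eq (W o)).mono fun n hn => ?_)
      simp [hn]
  simpa using this

end Clamp

/-! ### Derivatives of expectations along a differentiable family -/

section Derivative

variable {O : Type*} [MeasurableSpace O] {p : ℝ → Measure O} {g : O → ℝ}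

theorem integrable_mul_of_bounded {μ : Measure O} {f h : O → ℝ} {C : ℝ} (hf : Measurable f)
    (hC : ∀ o, |f o| ≤ C) (hh : Integrable h μ) : Integrable (fun o => f o * h o) μ :=
  hh.bdd_mul hf.aestronglyMeasurable (ae_of_all _ hC)

theorem IsQMD.tendsto_integral [∀ t, IsProbabilityMeasure (p t)] (h : IsQMD p g)
    {Z : O → ℝ} (hZ : Measurable Z) {K : ℝ}
    (hZi : ∀ t, Integrable (fun o => Z o ^ 2) (p t)) (hZK : ∀ t, ∫ o, Z o ^ 2 ∂p t ≤ K) :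
    Tendsto (fun t => (∫ o, Z o ∂p t - ∫ o, Z o ∂p 0) / t) (𝓝[≠] 0)
      (𝓝 (∫ o, Z o * g o ∂p 0)) := by
  obtain ⟨ν, s, g', hgg', hmem, hr⟩ := h.exists_hasRootDensities
  have := hr.tendsto_integral hZ hZi hZK (F := fun _ => Z) (fun _ => hZ) (fun _ _ => le_rfl)
    (fun _ => integrable_const _)
  have e : ∫ o, Z o * g o ∂p 0 = ∫ o, Z o * g' o ∂p 0 :=
    integral_congr_ae (hgg'.mono fun o ho => by simp only [ho])
  rw [e]
  simpa using this.add_const (∫ o, Z o * g' o ∂p 0)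

theorem IsQMD.integral_score_eq_zero [∀ t, IsProbabilityMeasure (p t)] (h : IsQMD p g) :
    ∫ o, g o ∂p 0 = 0 := by
  have := h.tendsto_integral (Z := fun _ => 1) (K := 1) measurable_const
    (fun _ => integrable_const _) (by simp)
  simp only [integral_const, probReal_univ, sub_self, zero_div, one_mul] at this
  exact (tendsto_nhds_unique this tendsto_const_nhds)

/-- The difference quotient is asymptotically the integral of φ_t Z g under `p 0`. This tends to
zero because φ_t is bounded and tends to zero in L², while Z g is integrable: split according to
whether |Z g| exceeds a large n. -/
theorem IsQMD.tendsto_integral_mul [∀ t, IsProbabilityMeasure (p t)] (h : IsQMD p g)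
    {Z : O → ℝ} (hZ : Measurable Z) {K : ℝ}
    (hZi : ∀ t, Integrable (fun o => Z o ^ 2) (p t)) (hZK : ∀ t, ∫ o, Z o ^ 2 ∂p t ≤ K)
    {φ : ℝ → O → ℝ} {C C' : ℝ} (hφ : ∀ t, Measurable (φ t)) (hφC : ∀ t o, |φ t o| ≤ C)
    (hφ2 : ∀ᶠ t in 𝓝[≠] 0, ∫ o, φ t o ^ 2 ∂p 0 ≤ C' * t ^ 2) :
    Tendsto (fun t => (∫ o, φ t o * Z o ∂p t - ∫ o, φ t o * Z o ∂p 0) / t) (𝓝[≠] 0) (𝓝 0) := by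
  obtain ⟨ν, s, g', hgg', hmem, hr⟩ := h.exists_hasRootDensities
  obtain ⟨o₀⟩ : Nonempty O := (p 0).nonempty_of_neZero
  have hC : 0 ≤ C := (abs_nonneg _).trans (hφC 0 o₀)
  have h1 := hr.tendsto_integral (hZ.const_mul C) (K := C ^ 2 * K)
    (fun t => by simpa only [mul_pow] using (hZi t).const_mul (C ^ 2))
    (fun t => by
      simp only [mul_pow]
      rw [integral_const_mul]
      exact mul_le_mul_of_nonneg_left (hZK t) (sq_nonneg C))
    (F := fun t o => φ t o * Z o) (fun t => (hφ t).mul hZ)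
    (fun t o => by
      rw [abs_mul, abs_mul, abs_of_nonneg hC]
      exact mul_le_mul_of_nonneg_right (hφC t o) (abs_nonneg _))
    (fun _ => integrable_const _)
  have hW : Integrable (fun o => Z o * g' o) (p 0) := by
    have hZ2 : MemLp Z 2 (p 0) := (memLp_two_iff_integrable_sq hZ.aestronglyMeasurable).2 (hZi 0)
    exact hZ2.integrable_mul hmem
  have h2 : Tendsto (fun t => ∫ o, φ t o * Z o * g' o ∂p 0) (𝓝[≠] 0) (𝓝 0) := by
    set W : O → ℝ := fun o => Z o * g' o with hWdef
    have hWm : Measurable W := hZ.mul hr.measurable_score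
    have hti : ∀ n : ℝ, Integrable (fun o => |W o| * (if n < |W o| then 1 else 0)) (p 0) := by
      intro n
      refine integrable_of_abs_le hW.abs (hWm.abs.mul (Measurable.ite
        (measurableSet_lt measurable_const hWm.abs) measurable_const
        measurable_const)).aestronglyMeasurable fun o => ?_
      split_ifs <;> simp
    have htail : Tendsto (fun n : ℕ => ∫ o, |W o| * (if (n : ℝ) < |W o| then 1 else 0) ∂p 0)
        atTop (𝓝 0) := by
      have : Tendsto (fun n : ℕ => ∫ o, |W o| * (if (n : ℝ) < |W o| then 1 else 0) ∂p 0)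
          atTop (𝓝 (∫ o, (0 : ℝ) ∂p 0)) := by
        refine tendsto_integral_of_dominated_convergence (fun o => |W o|)
          (fun n => (hti n).aestronglyMeasurable) hW.abs (fun n => ae_of_all _ fun o => ?_)
          (ae_of_all _ fun o => ?_)
        · split_ifs <;> simp
        · obtain ⟨n₀, hn₀⟩ := exists_nat_ge |W o|
          refine tendsto_const_nhds.congr' ?_
          filter_upwards [eventually_ge_atTop n₀] with n hn
          have : ¬ ((n : ℝ) < |W o|) := not_lt.2 (hn₀.trans (by exact_mod_cast hn))
          simp [this]
      simpa using this
    rw [Metric.tendsto_nhds]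
    intro η hη
    obtain ⟨n, hn⟩ := (htail.eventually
      (gt_mem_nhds (show 0 < η / (2 * (C + 1)) by positivity))).exists
    have habs : Tendsto (fun t : ℝ => n * |t| * (1 + C' / 4)) (𝓝[≠] 0) (𝓝 0) := by
      have : Tendsto (fun t : ℝ => n * |t| * (1 + C' / 4)) (𝓝 0) (𝓝 (n * |0| * (1 + C' / 4))) :=
        ((continuous_abs.tendsto 0).const_mul _).mul_const _
      rw [abs_zero, mul_zero, zero_mul] at this
      exact this.mono_left nhdsWithin_le_nhds
    filter_upwards [habs.eventually (gt_mem_nhds (show 0 < η / 2 by positivity)), hφ2,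
      self_mem_nhdsWithin] with t ht1 ht2 ht0
    have ht0 : 0 < |t| := abs_pos.2 ht0
    rw [Real.dist_eq, sub_zero]
    have hφi : Integrable (fun o => φ t o ^ 2) (p 0) := by
      refine integrable_of_abs_le (integrable_const (C ^ 2))
        ((hφ t).pow_const 2).aestronglyMeasurable fun o => ?_
      rw [abs_of_nonneg (sq_nonneg _), ← sq_abs]
      have := hφC t o
      gcongr
    have i2 : Integrable (fun o => n * (|t| + 1 / (4 * |t|) * φ t o ^ 2)) (p 0) :=
      ((integrable_const _).add (hφi.const_mul _)).const_mul _
    have i1 : Integrable (fun o => C * (|W o| * (if (n : ℝ) < |W o| then 1 else 0))) (p 0) :=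
      (hti n).const_mul C
    calc |∫ o, φ t o * Z o * g' o ∂p 0| ≤ ∫ o, |φ t o * Z o * g' o| ∂p 0 :=
          abs_integral_le_integral_abs
      _ ≤ ∫ o, (C * (|W o| * (if (n : ℝ) < |W o| then 1 else 0))
            + n * (|t| + 1 / (4 * |t|) * φ t o ^ 2)) ∂p 0 := by
          refine integral_mono_of_nonneg (ae_of_all _ fun o => abs_nonneg _) (i1.add i2)
            (ae_of_all _ fun o => ?_)
          simp only
          rw [mul_assoc, abs_mul]
          -- Young's inequality with weight |t|: as the integral of φ_t² is O(t²), the right-hand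
          -- side integrates to O(|t|).
          have hy : |φ t o| ≤ |t| + 1 / (4 * |t|) * φ t o ^ 2 := by
            have := mul_le_weighted_sq ht0 1 |φ t o|
            rw [sq_abs] at this
            linarith
          have hy0 : 0 ≤ |t| + 1 / (4 * |t|) * φ t o ^ 2 := by positivity
          split_ifs with hlt
          · have : |φ t o| * |W o| ≤ C * |W o| := by
              have := hφC t o
              gcongr
            have h0 : 0 ≤ n * (|t| + 1 / (4 * |t|) * φ t o ^ 2) := by positivity
            rw [mul_one]
            exact this.trans (le_add_of_nonneg_right h0)
          · rw [mul_zero, mul_zero, zero_add, mul_comm]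
            exact mul_le_mul (not_lt.1 hlt) hy (abs_nonneg _) (Nat.cast_nonneg n)
      _ = C * (∫ o, |W o| * (if (n : ℝ) < |W o| then 1 else 0) ∂p 0)
            + n * (|t| + 1 / (4 * |t|) * ∫ o, φ t o ^ 2 ∂p 0) := by
          rw [integral_add i1 i2, integral_const_mul, integral_const_mul,
            integral_add (integrable_const _) (hφi.const_mul _), integral_const_mul]
          simp
      _ ≤ C * (η / (2 * (C + 1))) + n * (|t| + 1 / (4 * |t|) * (C' * t ^ 2)) := by
          gcongr
      _ = η / 2 * (C / (C + 1)) + n * |t| * (1 + C' / 4) := by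
          rw [← sq_abs t]
          field_simp
      _ < η := by
          have : C / (C + 1) ≤ 1 := by rw [div_le_one (by linarith)]; linarith
          nlinarith
  simpa using h1.add h2

end Derivative

theorem div_mem_of_mem_Icc {ε a b : ℝ} (hε : 0 < ε) (ha : a ∈ Set.Icc ε 1) (hb : b ∈ Set.Icc ε 1) :
    a / b ∈ Set.Icc ε (1 / ε) := by
  have hb0 : 0 < b := hε.trans_le hb.1
  constructor
  · rw [le_div_iff₀ hb0]
    nlinarith [ha.1, hb.2]
  · exact div_le_div₀ zero_le_one ha.2 hε hb.1

theorem abs_div_sub_one_le {ε a b : ℝ} (hε : 0 < ε) (ha : a ∈ Set.Icc ε 1)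
    (hb : b ∈ Set.Icc ε 1) : |a / b - 1| ≤ 1 / ε := by
  have h := div_mem_of_mem_Icc hε ha hb
  have h1 : 1 ≤ 1 / ε := by
    rw [le_div_iff₀ hε]; linarith [ha.1, ha.2]
  rw [abs_le]
  constructor <;> linarith [h.1, h.2]

/-! ### Inverse probability weighting and its second-order expansion -/

section Weighting

variable {O 𝒰 : Type*} [MeasurableSpace O] [MeasurableSpace 𝒰]

/-- Under the law `p`, `e` is the conditional probability of `A = 1` given `x`, and `r` is the
conditional probability of `L = 1` given `A = 1`, `x` and `M`. -/
structure IsWeighting (ε : ℝ) (x : O → 𝒰) (A L M : O → ℝ) (e r : 𝒰 → ℝ) (p : Measure O) :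
    Prop where
  measurable_e : Measurable e
  measurable_r : Measurable r
  e_mem : ∀ u, e u ∈ Set.Icc ε 1
  r_mem : ∀ u, r u ∈ Set.Icc ε 1
  integral_treat : ∀ φ : 𝒰 → ℝ, Measurable φ → (∃ C, ∀ u, |φ u| ≤ C) →
    ∫ o, φ (x o) * A o ∂p = ∫ o, φ (x o) * e (x o) ∂p
  integral_label : ∀ (φ : 𝒰 → ℝ) (β : ℝ → ℝ), Measurable φ → (∃ C, ∀ u, |φ u| ≤ C) →
    Measurable β → (∃ C, ∀ z, |β z| ≤ C) →
    ∫ o, φ (x o) * β (M o) * (A o * L o) ∂p = ∫ o, φ (x o) * β (M o) * (A o * r (x o)) ∂p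

/-- The uncentered influence function of the mean of one arm. -/
noncomputable def armInfluence (x : O → 𝒰) (A L M y : O → ℝ) (e r μ : 𝒰 → ℝ) (o : O) : ℝ :=
  μ (x o) + A o / e (x o) * (M o - μ (x o)) + A o * L o / (e (x o) * r (x o)) * (y o - M o)

variable {p : ℝ → Measure O} {g : O → ℝ} {ε : ℝ} {x : O → 𝒰} {A L M y : O → ℝ}
  {e r : ℝ → 𝒰 → ℝ} {μ : 𝒰 → ℝ}

/-- Double robustness as an exact identity: `e₁`, `r₁` are the true scores under `q`, while `e₀`,
`r₀`, `m` are arbitrary. Each term of the influence function can be reweighted to carry the factor A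
L and the scores of `q`, after which the claim is pointwise algebra. The clamp on `M` keeps the test
functions bounded, as `IsWeighting` requires. -/
theorem IsWeighting.integral_armInfluence {q : Measure O} [IsProbabilityMeasure q] (hε : 0 < ε)
    (hx : Measurable x) (hA : Measurable A)
    (hL : Measurable L) (hM : Measurable M) (hA01 : ∀ o, A o = 0 ∨ A o = 1)
    (hL01 : ∀ o, L o = 0 ∨ L o = 1)
    {e₁ r₁ e₀ r₀ m : 𝒰 → ℝ} (hw : IsWeighting ε x A L M e₁ r₁ q)
    (he₀ : Measurable e₀) (hr₀ : Measurable r₀) (he₀_mem : ∀ u, e₀ u ∈ Set.Icc ε 1)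
    (hr₀_mem : ∀ u, r₀ u ∈ Set.Icc ε 1) (hm : Measurable m) {n : ℝ} (hn : 0 ≤ n)
    (hmn : ∀ u, |m u| ≤ n) (hyi : Integrable y q) :
    ∫ o, A o * L o * y o / (e₁ (x o) * r₁ (x o)) ∂q
      - ∫ o, armInfluence x A L (fun o => clamp (-n) n (M o)) y e₀ r₀ m o ∂q
      = ∫ o, ((e₀ (x o) / e₁ (x o) - 1) * (r₀ (x o) / r₁ (x o)))
            * (A o * L o / (e₀ (x o) * r₀ (x o)) * (y o - m (x o)))
          + (A o * (r₀ (x o) / r₁ (x o) - 1))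
            * (A o * L o / (e₀ (x o) * r₀ (x o)) * (y o - clamp (-n) n (M o))) ∂q := by
  have hMn : ∀ o, |clamp (-n) n (M o)| ≤ n := fun o => abs_clamp_le hn _
  have hcM : Measurable fun o => clamp (-n) n (M o) := (measurable_clamp _ _).comp hM
  have hpos : ∀ {f : 𝒰 → ℝ}, (∀ u, f u ∈ Set.Icc ε 1) → ∀ u, 0 < f u := fun hf u =>
    hε.trans_le (hf u).1
  have he0 := hpos he₀_mem
  have hr0 := hpos hr₀_mem
  have he1 := hpos hw.e_mem
  have hr1 := hpos hw.r_mem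
  have hinv : ∀ {f : 𝒰 → ℝ}, (∀ u, f u ∈ Set.Icc ε 1) → ∀ u, |(f u)⁻¹| ≤ ε⁻¹ := fun hf u => by
    rw [abs_of_pos (inv_pos.2 (hpos hf u))]
    exact inv_anti₀ hε (hf u).1
  have hA1 : ∀ o, |A o| ≤ 1 := fun o => by rcases hA01 o with h | h <;> simp [h]
  have hL1 : ∀ o, |L o| ≤ 1 := fun o => by rcases hL01 o with h | h <;> simp [h]
  have hε' : 0 ≤ ε⁻¹ := by positivity
  have hiA : ∀ {f : 𝒰 → ℝ}, Measurable f → (∃ C, ∀ u, |f u| ≤ C) →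
      ∀ {h : O → ℝ}, Integrable h q → Integrable (fun o => f (x o) * h o) q := by
    rintro f hf ⟨C, hC⟩ h hh
    exact integrable_mul_of_bounded (hf.comp hx) (fun o => hC _) hh
  have hAi : Integrable A q := by
    simpa using integrable_mul_of_bounded hA hA1 (integrable_const (1 : ℝ) (μ := q))
  have hALm : Measurable fun o => A o * L o := hA.mul hL
  have hAL1 : ∀ o, |A o * L o| ≤ 1 := fun o => by
    rw [abs_mul]; exact mul_le_one₀ (hA1 o) (abs_nonneg _) (hL1 o)
  have hALi : Integrable (fun o => A o * L o) q := by
    simpa using integrable_mul_of_bounded hALm hAL1 (integrable_const (1 : ℝ) (μ := q))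
  have hALy : Integrable (fun o => A o * L o * y o) q :=
    integrable_mul_of_bounded hALm hAL1 hyi
  have hMAL : Integrable (fun o => clamp (-n) n (M o) * (A o * L o)) q :=
    integrable_mul_of_bounded hcM hMn hALi
  have hMA : Integrable (fun o => clamp (-n) n (M o) * A o) q :=
    integrable_mul_of_bounded hcM hMn hAi
  have bmul : ∀ {f h : 𝒰 → ℝ}, (∃ C, ∀ u, |f u| ≤ C) → (∃ C, ∀ u, |h u| ≤ C) →
      ∃ C, ∀ u, |f u * h u| ≤ C := by
    rintro f h ⟨C, hC⟩ ⟨C', hC'⟩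
    exact ⟨C * C', fun u => by
      rw [abs_mul]
      exact mul_le_mul (hC u) (hC' u) (abs_nonneg _) ((abs_nonneg _).trans (hC u))⟩
  have be0 : ∃ C, ∀ u, |(e₀ u)⁻¹| ≤ C := ⟨_, hinv he₀_mem⟩
  have br0 : ∃ C, ∀ u, |(r₀ u)⁻¹| ≤ C := ⟨_, hinv hr₀_mem⟩
  have be1 : ∃ C, ∀ u, |(e₁ u)⁻¹| ≤ C := ⟨_, hinv hw.e_mem⟩
  have br1 : ∃ C, ∀ u, |(r₁ u)⁻¹| ≤ C := ⟨_, hinv hw.r_mem⟩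
  have bm : ∃ C, ∀ u, |m u| ≤ C := ⟨n, hmn⟩
  have me1 := hw.measurable_e
  have mr1 := hw.measurable_r
  -- all terms are expectations weighted by `A L`
  have I1 : ∫ o, m (x o) ∂q = ∫ o, (m (x o) * ((e₁ (x o))⁻¹ * (r₁ (x o))⁻¹)) * (A o * L o) ∂q := by
    have h1 := hw.integral_treat (fun u => m u * (e₁ u)⁻¹) (hm.mul me1.inv) (bmul bm be1)
    have h2 := hw.integral_label (fun u => m u * ((e₁ u)⁻¹ * (r₁ u)⁻¹)) (fun _ => 1)
      (hm.mul (me1.inv.mul mr1.inv)) (bmul bm (bmul be1 br1)) measurable_const ⟨1, by simp⟩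
    simp only [mul_one] at h2
    rw [h2]
    calc ∫ o, m (x o) ∂q = ∫ o, m (x o) * (e₁ (x o))⁻¹ * e₁ (x o) ∂q := by
          refine integral_congr_ae (ae_of_all _ fun o => ?_)
          have := (he1 (x o)).ne'
          simp only; field_simp
      _ = ∫ o, m (x o) * (e₁ (x o))⁻¹ * A o ∂q := h1.symm
      _ = _ := by
          refine integral_congr_ae (ae_of_all _ fun o => ?_)
          have := (hr1 (x o)).ne'
          simp only; field_simp
  have I2 : ∫ o, (e₀ (x o))⁻¹ * (clamp (-n) n (M o) * A o) ∂q
      = ∫ o, ((e₀ (x o))⁻¹ * (r₁ (x o))⁻¹) * (clamp (-n) n (M o) * (A o * L o)) ∂q := by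
    have h2 := hw.integral_label (fun u => (e₀ u)⁻¹ * (r₁ u)⁻¹) (clamp (-n) n)
      (he₀.inv.mul mr1.inv) (bmul be0 br1) (measurable_clamp _ _) ⟨n, abs_clamp_le hn⟩
    simp only [mul_assoc] at h2 ⊢
    rw [h2]
    refine integral_congr_ae (ae_of_all _ fun o => ?_)
    have := (hr1 (x o)).ne'
    simp only; field_simp
  have I3 : ∫ o, (m (x o) * (e₀ (x o))⁻¹) * A o ∂q
      = ∫ o, (m (x o) * ((e₀ (x o))⁻¹ * (r₁ (x o))⁻¹)) * (A o * L o) ∂q := by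
    have h2 := hw.integral_label (fun u => m u * ((e₀ u)⁻¹ * (r₁ u)⁻¹)) (fun _ => 1)
      (hm.mul (he₀.inv.mul mr1.inv)) (bmul bm (bmul be0 br1)) measurable_const ⟨1, by simp⟩
    simp only [mul_one] at h2
    rw [h2]
    refine integral_congr_ae (ae_of_all _ fun o => ?_)
    have := (hr1 (x o)).ne'
    simp only; field_simp
  have i0 : Integrable (fun o => m (x o)) q := by
    simpa using hiA hm bm (integrable_const (1 : ℝ))
  have i1 : Integrable (fun o => (e₀ (x o))⁻¹ * (clamp (-n) n (M o) * A o)) q :=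
    hiA he₀.inv be0 hMA
  have i2 : Integrable (fun o => m (x o) * (e₀ (x o))⁻¹ * A o) q :=
    hiA (hm.mul he₀.inv) (bmul bm be0) hAi
  have i3 : Integrable (fun o => (e₀ (x o))⁻¹ * (r₀ (x o))⁻¹
      * (A o * L o * y o - clamp (-n) n (M o) * (A o * L o))) q :=
    hiA (he₀.inv.mul hr₀.inv) (bmul be0 br0) (hALy.sub hMAL)
  have j0 : Integrable (fun o => (e₁ (x o))⁻¹ * (r₁ (x o))⁻¹ * (A o * L o * y o)) q :=
    hiA (me1.inv.mul mr1.inv) (bmul be1 br1) hALy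
  have j1 : Integrable (fun o => m (x o) * ((e₁ (x o))⁻¹ * (r₁ (x o))⁻¹) * (A o * L o)) q :=
    hiA (hm.mul (me1.inv.mul mr1.inv)) (bmul bm (bmul be1 br1)) hALi
  have j2 : Integrable (fun o => (e₀ (x o))⁻¹ * (r₁ (x o))⁻¹
      * (clamp (-n) n (M o) * (A o * L o))) q :=
    hiA (he₀.inv.mul mr1.inv) (bmul be0 br1) hMAL
  have j3 : Integrable (fun o => m (x o) * ((e₀ (x o))⁻¹ * (r₁ (x o))⁻¹) * (A o * L o)) q :=
    hiA (hm.mul (he₀.inv.mul mr1.inv)) (bmul bm (bmul be0 br1)) hALi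
  have E1 : ∫ o, armInfluence x A L (fun o => clamp (-n) n (M o)) y e₀ r₀ m o ∂q
      = ∫ o, m (x o) ∂q + (∫ o, (e₀ (x o))⁻¹ * (clamp (-n) n (M o) * A o) ∂q
        - ∫ o, (m (x o) * (e₀ (x o))⁻¹) * A o ∂q)
        + ∫ o, ((e₀ (x o))⁻¹ * (r₀ (x o))⁻¹)
          * (A o * L o * y o - clamp (-n) n (M o) * (A o * L o)) ∂q := by
    have i12 : Integrable (fun o => (e₀ (x o))⁻¹ * (clamp (-n) n (M o) * A o)
      - (m (x o) * (e₀ (x o))⁻¹) * A o) q := i1.sub i2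
    rw [← integral_sub i1 i2, ← integral_add i0 i12]
    have i012 : Integrable (fun o => m (x o) + ((e₀ (x o))⁻¹ * (clamp (-n) n (M o) * A o)
      - (m (x o) * (e₀ (x o))⁻¹) * A o)) q := i0.add i12
    refine (integral_congr_ae (ae_of_all _ fun o => ?_)).trans (integral_add i012 i3)
    simp only [armInfluence, div_eq_mul_inv, mul_inv]
    ring
  have E2 : ∫ o, A o * L o * y o / (e₁ (x o) * r₁ (x o)) ∂q
      = ∫ o, ((e₁ (x o))⁻¹ * (r₁ (x o))⁻¹) * (A o * L o * y o) ∂q := by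
    refine integral_congr_ae (ae_of_all _ fun o => ?_)
    simp only [div_eq_mul_inv, mul_inv]
    ring
  have j23 : Integrable (fun o => ((e₀ (x o))⁻¹ * (r₁ (x o))⁻¹)
        * (clamp (-n) n (M o) * (A o * L o))
      - (m (x o) * ((e₀ (x o))⁻¹ * (r₁ (x o))⁻¹)) * (A o * L o)) q := j2.sub j3
  rw [E1, E2, I1, I2, I3, ← integral_sub j2 j3, ← integral_add j1 j23]
  have j123 : Integrable (fun o => (m (x o) * ((e₁ (x o))⁻¹ * (r₁ (x o))⁻¹)) * (A o * L o) +
      (((e₀ (x o))⁻¹ * (r₁ (x o))⁻¹) * (clamp (-n) n (M o) * (A o * L o))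
      - (m (x o) * ((e₀ (x o))⁻¹ * (r₁ (x o))⁻¹)) * (A o * L o))) q := j1.add j23
  rw [← sub_sub, ← integral_sub j0 j123]
  refine (integral_sub (j0.sub j123) i3).symm.trans (integral_congr_ae (ae_of_all _ fun o => ?_))
  have h1 := (he1 (x o)).ne'
  have h2 := (hr1 (x o)).ne'
  have h3 := (he0 (x o)).ne'
  have h4 := (hr0 (x o)).ne'
  simp only [Pi.sub_apply]
  rcases hA01 o with h | h
  · simp [h]
  · simp only [h]
    field_simp
    ring

/-- The test function k = 1 − A/e_0 has conditional mean zero given x at parameter 0. At parameter t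
its conditional mean is 1 − e_t/e_0, and the product with φ_t = e_0/e_t − 1 equals (e_t/e_0) φ_t² ≥
ε φ_t². This is the hypothesis of `HasRootDensities.integral_sq_le`. -/
theorem IsQMD.treat_sq_le [∀ t, IsProbabilityMeasure (p t)] (h : IsQMD p g) (hε : 0 < ε)
    (hx : Measurable x) (hA : Measurable A) (hA01 : ∀ o, A o = 0 ∨ A o = 1)
    (hw : ∀ t, IsWeighting ε x A L M (e t) (r t) (p t)) :
    ∃ C, ∀ᶠ t in 𝓝[≠] 0, ∫ o, (e 0 (x o) / e t (x o) - 1) ^ 2 ∂p 0 ≤ C * t ^ 2 := by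
  obtain ⟨ν, s, g', -, -, hr⟩ := h.exists_hasRootDensities
  have hpos : ∀ t u, 0 < e t u := fun t u => hε.trans_le ((hw t).e_mem u).1
  have hme : ∀ t, Measurable fun o => e t (x o) := fun t => (hw t).measurable_e.comp hx
  have hφm : ∀ t, Measurable fun u => e 0 u / e t u - 1 := fun t =>
    ((hw 0).measurable_e.div (hw t).measurable_e).sub_const 1
  have hφC : ∀ t u, |e 0 u / e t u - 1| ≤ 1 / ε := fun t u =>
    abs_div_sub_one_le hε ((hw 0).e_mem u) ((hw t).e_mem u)
  have hint : ∀ s t, ∫ o, (e 0 (x o) / e t (x o) - 1) * (1 - A o / e 0 (x o)) ∂p s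
      = ∫ o, (e 0 (x o) / e t (x o) - 1) * (1 - e s (x o) / e 0 (x o)) ∂p s := by
    intro s t
    have h1 := (hw s).integral_treat (fun u => (e 0 u / e t u - 1) * (e 0 u)⁻¹)
      ((hφm t).mul (hw 0).measurable_e.inv) ⟨1 / ε * ε⁻¹, fun u => by
        rw [abs_mul, abs_of_pos (inv_pos.2 (hpos 0 u))]
        exact mul_le_mul (hφC t u) (inv_anti₀ hε ((hw 0).e_mem u).1)
          (inv_pos.2 (hpos 0 u)).le (by positivity)⟩
    have hb1 : Integrable (fun o => e 0 (x o) / e t (x o) - 1) (p s) :=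
      integrable_of_abs_le (integrable_const (1 / ε)) ((hφm t).comp hx).aestronglyMeasurable
        fun o => hφC t _
    have hb2 : ∀ B : O → ℝ, Measurable B → (∀ o, |B o| ≤ 1) →
        Integrable (fun o => (e 0 (x o) / e t (x o) - 1) * (e 0 (x o))⁻¹ * B o) (p s) := by
      intro B hB hB1
      refine integrable_mul_of_bounded (((hφm t).comp hx).mul (hme 0).inv) (C := 1 / ε * ε⁻¹)
        (fun o => ?_) (integrable_of_abs_le (integrable_const 1) hB.aestronglyMeasurable hB1)
      rw [abs_mul]
      refine mul_le_mul (hφC t _) ?_ (abs_nonneg _) (by positivity)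
      rw [abs_of_pos (inv_pos.2 (hpos 0 _))]
      exact inv_anti₀ hε ((hw 0).e_mem _).1
    have e1 : ∀ B : O → ℝ, Measurable B → (∀ o, |B o| ≤ 1) →
        ∫ o, (e 0 (x o) / e t (x o) - 1) * (1 - B o / e 0 (x o)) ∂p s
          = ∫ o, (e 0 (x o) / e t (x o) - 1) ∂p s
            - ∫ o, (e 0 (x o) / e t (x o) - 1) * (e 0 (x o))⁻¹ * B o ∂p s := by
      intro B hB hB1
      rw [← integral_sub hb1 (hb2 B hB hB1)]
      refine integral_congr_ae (ae_of_all _ fun o => ?_)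
      simp only; ring
    rw [e1 A hA fun o => by rcases hA01 o with h | h <;> simp [h],
      e1 (fun o => e s (x o)) (hme s) fun o => by
        rw [abs_of_pos (hpos s _)]; exact ((hw s).e_mem _).2, h1]
  have h1ε : (1 : ℝ) ≤ 1 / ε := by
    obtain ⟨o⟩ : Nonempty O := (p 0).nonempty_of_neZero
    rw [le_div_iff₀ hε]
    linarith [((hw 0).e_mem (x o)).1, ((hw 0).e_mem (x o)).2]
  refine hr.integral_sq_le (fun _ => integrable_const _) (k := fun o => 1 - A o / e 0 (x o))
    (C := 1 / ε) hε (fun t => (hφm t).comp hx) (fun t o => hφC t _)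
    (measurable_const.sub (hA.div (hme 0))) (fun o => ?_) (fun t => ?_) (fun t => ?_)
  · rcases hA01 o with h | h
    · simpa [h] using h1ε
    · rw [h, abs_le]
      have h1 : 1 / e 0 (x o) ≤ 1 / ε := one_div_le_one_div_of_le hε ((hw 0).e_mem _).1
      have h2 : 0 < 1 / e 0 (x o) := one_div_pos.2 (hpos 0 _)
      constructor <;> linarith
  · rw [hint 0 t]
    refine (integral_congr_ae (ae_of_all _ fun o => ?_)).trans (integral_zero _ _)
    simp [div_self (hpos 0 (x o)).ne']
  · rw [hint t t, ← integral_const_mul]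
    have hb : ∀ o, |e 0 (x o) / e t (x o) - 1| ≤ 1 / ε := fun o => hφC t _
    have hm := (hφm t).comp hx
    refine integral_mono_of_nonneg (ae_of_all _ fun o => by positivity) ?_ (ae_of_all _ fun o => ?_)
    · refine integrable_mul_of_bounded hm hb (integrable_of_abs_le (integrable_const (1 / ε))
        (measurable_const.sub ((hme t).div (hme 0))).aestronglyMeasurable fun o => ?_)
      rw [abs_sub_comm]
      exact abs_div_sub_one_le hε ((hw t).e_mem _) ((hw 0).e_mem _)
    · have h1 := (hpos t (x o)).ne'
      have h2 := (hpos 0 (x o)).ne'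
      have h3 : (e 0 (x o) / e t (x o) - 1) * (1 - e t (x o) / e 0 (x o))
          = e t (x o) / e 0 (x o) * (e 0 (x o) / e t (x o) - 1) ^ 2 := by
        field_simp
      simp only [h3]
      exact mul_le_mul_of_nonneg_right
        (div_mem_of_mem_Icc hε ((hw t).e_mem _) ((hw 0).e_mem _)).1 (sq_nonneg _)

/-- The same argument with k = 1 − L/r_0. The factor A is kept because the labelling score describes
only units of the arm. -/
theorem IsQMD.label_sq_le [∀ t, IsProbabilityMeasure (p t)] (h : IsQMD p g) (hε : 0 < ε)
    (hx : Measurable x) (hA : Measurable A) (hA01 : ∀ o, A o = 0 ∨ A o = 1)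
    (hL : Measurable L) (hL01 : ∀ o, L o = 0 ∨ L o = 1)
    (hw : ∀ t, IsWeighting ε x A L M (e t) (r t) (p t)) :
    ∃ C, ∀ᶠ t in 𝓝[≠] 0, ∫ o, (A o * (r 0 (x o) / r t (x o) - 1)) ^ 2 ∂p 0 ≤ C * t ^ 2 := by
  obtain ⟨ν, s, g', -, -, hr⟩ := h.exists_hasRootDensities
  have hpos : ∀ t u, 0 < r t u := fun t u => hε.trans_le ((hw t).r_mem u).1
  have hme : ∀ t, Measurable fun o => r t (x o) := fun t => (hw t).measurable_r.comp hx
  have hA1 : ∀ o, |A o| ≤ 1 := fun o => by rcases hA01 o with h | h <;> simp [h]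
  have hφm : ∀ t, Measurable fun u => r 0 u / r t u - 1 := fun t =>
    ((hw 0).measurable_r.div (hw t).measurable_r).sub_const 1
  have hφC : ∀ t u, |r 0 u / r t u - 1| ≤ 1 / ε := fun t u =>
    abs_div_sub_one_le hε ((hw 0).r_mem u) ((hw t).r_mem u)
  have hAφm : ∀ t, Measurable fun o => A o * (r 0 (x o) / r t (x o) - 1) := fun t =>
    hA.mul ((hφm t).comp hx)
  have hAφC : ∀ t o, |A o * (r 0 (x o) / r t (x o) - 1)| ≤ 1 / ε := fun t o => by
    rw [abs_mul]
    exact (mul_le_of_le_one_left (abs_nonneg _) (hA1 o)).trans (hφC t _)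
  have hint : ∀ s t, ∫ o, A o * (r 0 (x o) / r t (x o) - 1) * (1 - L o / r 0 (x o)) ∂p s
      = ∫ o, A o * (r 0 (x o) / r t (x o) - 1) * (1 - r s (x o) / r 0 (x o)) ∂p s := by
    intro s t
    have h1 := (hw s).integral_label (fun u => (r 0 u / r t u - 1) * (r 0 u)⁻¹) (fun _ => 1)
      ((hφm t).mul (hw 0).measurable_r.inv) ⟨1 / ε * ε⁻¹, fun u => by
        rw [abs_mul, abs_of_pos (inv_pos.2 (hpos 0 u))]
        exact mul_le_mul (hφC t u) (inv_anti₀ hε ((hw 0).r_mem u).1)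
          (inv_pos.2 (hpos 0 u)).le (by positivity)⟩ measurable_const ⟨1, by simp⟩
    simp only [mul_one] at h1
    have hb1 : Integrable (fun o => A o * (r 0 (x o) / r t (x o) - 1)) (p s) :=
      integrable_of_abs_le (integrable_const (1 / ε)) (hAφm t).aestronglyMeasurable
        fun o => hAφC t _
    have hb2 : ∀ B : O → ℝ, Measurable B → (∀ o, |B o| ≤ 1) →
        Integrable (fun o => (r 0 (x o) / r t (x o) - 1) * (r 0 (x o))⁻¹ * (A o * B o)) (p s) := by
      intro B hB hB1
      refine integrable_mul_of_bounded (((hφm t).comp hx).mul (hme 0).inv) (C := 1 / ε * ε⁻¹)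
        (fun o => ?_) (integrable_of_abs_le (integrable_const 1)
          (hA.mul hB).aestronglyMeasurable fun o => ?_)
      · rw [abs_mul]
        refine mul_le_mul (hφC t _) ?_ (abs_nonneg _) (by positivity)
        rw [abs_of_pos (inv_pos.2 (hpos 0 _))]
        exact inv_anti₀ hε ((hw 0).r_mem _).1
      · rw [abs_mul]
        exact mul_le_one₀ (hA1 o) (abs_nonneg _) (hB1 o)
    have e1 : ∀ B : O → ℝ, Measurable B → (∀ o, |B o| ≤ 1) →
        ∫ o, A o * (r 0 (x o) / r t (x o) - 1) * (1 - B o / r 0 (x o)) ∂p s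
          = ∫ o, A o * (r 0 (x o) / r t (x o) - 1) ∂p s
            - ∫ o, (r 0 (x o) / r t (x o) - 1) * (r 0 (x o))⁻¹ * (A o * B o) ∂p s := by
      intro B hB hB1
      rw [← integral_sub hb1 (hb2 B hB hB1)]
      refine integral_congr_ae (ae_of_all _ fun o => ?_)
      simp only; ring
    rw [e1 L hL fun o => by rcases hL01 o with h | h <;> simp [h],
      e1 (fun o => r s (x o)) (hme s) fun o => by
        rw [abs_of_pos (hpos s _)]; exact ((hw s).r_mem _).2, h1]
  have h1ε : (1 : ℝ) ≤ 1 / ε := by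
    obtain ⟨o⟩ : Nonempty O := (p 0).nonempty_of_neZero
    rw [le_div_iff₀ hε]
    linarith [((hw 0).e_mem (x o)).1, ((hw 0).e_mem (x o)).2]
  refine hr.integral_sq_le (fun _ => integrable_const _) (k := fun o => 1 - L o / r 0 (x o))
    (C := 1 / ε) hε hAφm hAφC
    (measurable_const.sub (hL.div (hme 0))) (fun o => ?_) (fun t => ?_) (fun t => ?_)
  · rcases hL01 o with h | h
    · simpa [h] using h1ε
    · rw [h, abs_le]
      have h1 : 1 / r 0 (x o) ≤ 1 / ε := one_div_le_one_div_of_le hε ((hw 0).r_mem _).1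
      have h2 : 0 < 1 / r 0 (x o) := one_div_pos.2 (hpos 0 _)
      constructor <;> linarith
  · rw [hint 0 t]
    refine (integral_congr_ae (ae_of_all _ fun o => ?_)).trans (integral_zero _ _)
    simp [div_self (hpos 0 (x o)).ne']
  · rw [hint t t, ← integral_const_mul]
    refine integral_mono_of_nonneg (ae_of_all _ fun o => by positivity) ?_ (ae_of_all _ fun o => ?_)
    · refine integrable_mul_of_bounded (hAφm t) (hAφC t) (integrable_of_abs_le
        (integrable_const (1 / ε))
        (measurable_const.sub ((hme t).div (hme 0))).aestronglyMeasurable fun o => ?_)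
      rw [abs_sub_comm]
      exact abs_div_sub_one_le hε ((hw t).r_mem _) ((hw 0).r_mem _)
    · have h1 := (hpos t (x o)).ne'
      have h2 := (hpos 0 (x o)).ne'
      have h3 : A o * (r 0 (x o) / r t (x o) - 1) * (1 - r t (x o) / r 0 (x o))
          = r t (x o) / r 0 (x o) * (A o * (r 0 (x o) / r t (x o) - 1)) ^ 2 := by
        rcases hA01 o with h | h
        · simp [h]
        · rw [h]; field_simp
      simp only [h3]
      exact mul_le_mul_of_nonneg_right
        (div_mem_of_mem_Icc hε ((hw t).r_mem _) ((hw 0).r_mem _)).1 (sq_nonneg _)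

end Weighting

/-! ### Differentiability of an arm mean along a submodel -/

section Pathwise

variable {O 𝒰 : Type*} [MeasurableSpace O] [MeasurableSpace 𝒰]

/-- Cauchy–Schwarz in the form of Young's inequality with weight κ/|t|. The bound is proportional to
|t| because the first factor is O(t) in L²; `κ` stays free so that it can be fixed before the
truncation level. -/
theorem abs_integral_le_of_abs_le_mul {q : Measure O} {a b w : O → ℝ} {c C δ κ t : ℝ}
    (hc : 0 ≤ c) (hκ : 0 < κ) (ht : t ≠ 0) (ha : Integrable (fun o => a o ^ 2) q)
    (hb : Integrable (fun o => b o ^ 2) q) (hw : ∀ o, |w o| ≤ c * (|a o| * |b o|))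
    (haC : ∫ o, a o ^ 2 ∂q ≤ C * t ^ 2) (hbδ : ∫ o, b o ^ 2 ∂q ≤ δ) :
    |∫ o, w o ∂q| ≤ |t| * (c * (κ * C + δ / (4 * κ))) := by
  have ht' : 0 < |t| := abs_pos.2 ht
  have hlam : 0 < κ / |t| := by positivity
  have hi : Integrable (fun o => κ / |t| * a o ^ 2 + 1 / (4 * (κ / |t|)) * b o ^ 2) q :=
    (ha.const_mul _).add (hb.const_mul _)
  calc |∫ o, w o ∂q| ≤ ∫ o, |w o| ∂q := abs_integral_le_integral_abs
    _ ≤ ∫ o, c * (κ / |t| * a o ^ 2 + 1 / (4 * (κ / |t|)) * b o ^ 2) ∂q := by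
        refine integral_mono_of_nonneg (ae_of_all _ fun o => abs_nonneg _) (hi.const_mul c)
          (ae_of_all _ fun o => (hw o).trans ?_)
        refine mul_le_mul_of_nonneg_left ?_ hc
        rw [← abs_mul]
        exact abs_mul_le_weighted_sq hlam _ _
    _ = c * (κ / |t| * ∫ o, a o ^ 2 ∂q + 1 / (4 * (κ / |t|)) * ∫ o, b o ^ 2 ∂q) := by
        rw [integral_const_mul, integral_add (ha.const_mul _) (hb.const_mul _),
          integral_const_mul, integral_const_mul]
    _ ≤ c * (κ / |t| * (C * t ^ 2) + 1 / (4 * (κ / |t|)) * δ) := by gcongr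
    _ = |t| * (c * (κ * C + δ / (4 * κ))) := by
        rw [← sq_abs t]; field_simp

variable {p : ℝ → Measure O} {g : O → ℝ} {ε : ℝ} {x : O → 𝒰} {A L M y : O → ℝ}
  {e r : ℝ → 𝒰 → ℝ} {μ : 𝒰 → ℝ}

/-- The mean of one arm is differentiable along every submodel that is differentiable in quadratic
mean. -/
theorem IsQMD.hasDerivAt_of_isWeighting [∀ t, IsProbabilityMeasure (p t)] (h : IsQMD p g)
    (hε : 0 < ε) (hx : Measurable x) (hA : Measurable A) (hL : Measurable L) (hM : Measurable M)
    (hy : Measurable y) (hA01 : ∀ o, A o = 0 ∨ A o = 1) (hL01 : ∀ o, L o = 0 ∨ L o = 1)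
    (hw : ∀ t, IsWeighting ε x A L M (e t) (r t) (p t))
    {θ : ℝ → ℝ} (hθ : ∀ t, θ t = ∫ o, A o * L o * y o / (e t (x o) * r t (x o)) ∂p t)
    {K : ℝ} (hyi : ∀ t, Integrable (fun o => y o ^ 2) (p t)) (hyK : ∀ t, ∫ o, y o ^ 2 ∂p t ≤ K)
    (hμ : Measurable μ) (hμ2 : MemLp (fun o => μ (x o)) 2 (p 0)) (hM2 : MemLp M 2 (p 0))
    (hμ0 : ∀ φ : 𝒰 → ℝ, Measurable φ → (∃ C, ∀ u, |φ u| ≤ C) →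
      ∫ o, φ (x o) * (A o * L o * (y o - μ (x o))) ∂p 0 = 0)
    (hM0 : ∀ φ : 𝒰 → ℝ, Measurable φ → (∃ C, ∀ u, |φ u| ≤ C) →
      ∫ o, φ (x o) * (A o * L o * (y o - M o)) ∂p 0 = 0) :
    HasDerivAt θ (∫ o, armInfluence x A L M y (e 0) (r 0) μ o * g o ∂p 0) 0 := by
  obtain ⟨o₀⟩ : Nonempty O := (p 0).nonempty_of_neZero
  have hε1 : ε ≤ 1 := ((hw 0).e_mem (x o₀)).1.trans ((hw 0).e_mem (x o₀)).2
  have hinv1 : 1 ≤ ε⁻¹ := (one_le_inv₀ hε).2 hε1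
  have hε' : 0 < ε⁻¹ := by positivity
  have hepos : ∀ t u, 0 < e t u := fun t u => hε.trans_le ((hw t).e_mem u).1
  have hrpos : ∀ t u, 0 < r t u := fun t u => hε.trans_le ((hw t).r_mem u).1
  have hem : ∀ t, Measurable (e t) := fun t => (hw t).measurable_e
  have hrm : ∀ t, Measurable (r t) := fun t => (hw t).measurable_r
  have hA1 : ∀ o, |A o| ≤ 1 := fun o => by rcases hA01 o with h | h <;> simp [h]
  have hL1 : ∀ o, |L o| ≤ 1 := fun o => by rcases hL01 o with h | h <;> simp [h]
  have hy1 : ∀ t, Integrable y (p t) := fun t =>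
    ((memLp_two_iff_integrable_sq hy.aestronglyMeasurable).2 (hyi t)).integrable one_le_two
  have hy2 : MemLp y 2 (p 0) := (memLp_two_iff_integrable_sq hy.aestronglyMeasurable).2 (hyi 0)
  have hmoment : ∀ (Z : O → ℝ), Measurable Z → ∀ c, (∀ o, |Z o| ≤ c * (|y o| + 1)) →
      (∀ t, Integrable (fun o => Z o ^ 2) (p t)) ∧ ∀ t, ∫ o, Z o ^ 2 ∂p t ≤ 2 * c ^ 2 * (K + 1) :=
          by
    intro Z hZ c hc
    have hle : ∀ o, Z o ^ 2 ≤ 2 * c ^ 2 * (y o ^ 2 + 1) := by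
      intro o
      have h1 : Z o ^ 2 ≤ (c * (|y o| + 1)) ^ 2 := by
        rw [← sq_abs (Z o)]
        exact pow_le_pow_left₀ (abs_nonneg _) (hc o) 2
      refine h1.trans ?_
      rw [mul_pow, mul_comm 2, mul_assoc]
      refine mul_le_mul_of_nonneg_left ?_ (sq_nonneg c)
      rw [← sq_abs (y o)]
      nlinarith [sq_nonneg (|y o| - 1)]
    have hi : ∀ t, Integrable (fun o => 2 * c ^ 2 * (y o ^ 2 + 1)) (p t) := fun t =>
      ((hyi t).add (integrable_const 1)).const_mul _
    refine ⟨fun t => integrable_of_abs_le (hi t) (hZ.pow_const 2).aestronglyMeasurable fun o => ?_,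
      fun t => ?_⟩
    · rw [abs_of_nonneg (sq_nonneg _)]; exact hle o
    · refine (integral_mono_of_nonneg (ae_of_all _ fun o => sq_nonneg _) (hi t)
        (ae_of_all _ hle)).trans ?_
      rw [integral_const_mul, integral_add (hyi t) (integrable_const 1)]
      have := hyK t
      simp only [integral_const, probReal_univ, one_smul]
      gcongr
  set W : O → ℝ := fun o => A o * L o / (e 0 (x o) * r 0 (x o)) with hWdef
  have hWm : Measurable W := (hA.mul hL).div (((hem 0).comp hx).mul ((hrm 0).comp hx))
  have hW0 : ∀ u, |(e 0 u * r 0 u)⁻¹| ≤ ε⁻¹ * ε⁻¹ := by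
    intro u
    rw [mul_inv, abs_mul, abs_of_pos (inv_pos.2 (hepos 0 u)), abs_of_pos (inv_pos.2 (hrpos 0 u))]
    exact mul_le_mul (inv_anti₀ hε ((hw 0).e_mem u).1) (inv_anti₀ hε ((hw 0).r_mem u).1)
      (inv_pos.2 (hrpos 0 u)).le hε'.le
  have hAL1 : ∀ o, |A o * L o| ≤ 1 := fun o => by
    rw [abs_mul]; exact mul_le_one₀ (hA1 o) (abs_nonneg _) (hL1 o)
  have hWC : ∀ o, |W o| ≤ ε⁻¹ * ε⁻¹ := by
    intro o
    rw [hWdef]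
    simp only
    rw [div_eq_mul_inv, abs_mul]
    exact (mul_le_of_le_one_left (abs_nonneg _) (hAL1 o)).trans (hW0 _)
  have hAe : ∀ o, |A o / e 0 (x o)| ≤ ε⁻¹ := by
    intro o
    rw [div_eq_mul_inv, abs_mul, abs_of_pos (inv_pos.2 (hepos 0 _))]
    exact (mul_le_of_le_one_left (inv_pos.2 (hepos 0 _)).le (hA1 o)).trans
      (inv_anti₀ hε ((hw 0).e_mem _).1)
  -- Both regression functions are square-integrable at parameter 0 only. Their truncations keep the
  -- second moments of `f n`, `Z₁ n` and `Z₂ n` bounded along the whole family.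
  set m : ℕ → 𝒰 → ℝ := fun n u => clamp (-n) n (μ u) with hm
  set N : ℕ → O → ℝ := fun n o => clamp (-n) n (M o) with hN
  have hmm : ∀ n, Measurable (m n) := fun n => (measurable_clamp _ _).comp hμ
  have hNm : ∀ n, Measurable (N n) := fun n => (measurable_clamp _ _).comp hM
  have hmn : ∀ n u, |m n u| ≤ n := fun n u => abs_clamp_le (Nat.cast_nonneg n) _
  have hNn : ∀ n o, |N n o| ≤ n := fun n o => abs_clamp_le (Nat.cast_nonneg n) _
  set f : ℕ → O → ℝ := fun n => armInfluence x A L (N n) y (e 0) (r 0) (m n) with hf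
  set Z₁ : ℕ → O → ℝ := fun n o => W o * (y o - m n (x o)) with hZ₁
  set Z₂ : ℕ → O → ℝ := fun n o => W o * (y o - N n o) with hZ₂
  have hZ₁m : ∀ n, Measurable (Z₁ n) := fun n => hWm.mul (hy.sub ((hmm n).comp hx))
  have hZ₂m : ∀ n, Measurable (Z₂ n) := fun n => hWm.mul (hy.sub (hNm n))
  have hWy : ∀ o (b : ℝ) (n : ℕ), |b| ≤ n → |W o * (y o - b)| ≤ ε⁻¹ * ε⁻¹ * (n + 1) * (|y o| + 1) :=
      by
    intro o b n hb
    rw [abs_mul, mul_assoc]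
    refine mul_le_mul (hWC o) ?_ (abs_nonneg _) (by positivity)
    have h1 := abs_sub (y o) b
    have h2 : (0 : ℝ) ≤ n * |y o| := by positivity
    nlinarith [abs_nonneg (y o)]
  have hZ₁b : ∀ n o, |Z₁ n o| ≤ ε⁻¹ * ε⁻¹ * (n + 1) * (|y o| + 1) := fun n o =>
    hWy o _ n (hmn n _)
  have hZ₂b : ∀ n o, |Z₂ n o| ≤ ε⁻¹ * ε⁻¹ * (n + 1) * (|y o| + 1) := fun n o =>
    hWy o _ n (hNn n _)
  have hmx : Measurable fun o => μ (x o) := hμ.comp hx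
  have hfm : ∀ n, Measurable (f n) := by
    intro n
    exact (((hmm n).comp hx).add ((hA.div ((hem 0).comp hx)).mul
      ((hNm n).sub ((hmm n).comp hx)))).add (hZ₂m n)
  have hfeq : ∀ n o, f n o = m n (x o) + A o / e 0 (x o) * (N n o - m n (x o)) + Z₂ n o :=
    fun n o => rfl
  have hfb : ∀ n o, |f n o| ≤ (n + ε⁻¹ * (n + n) + ε⁻¹ * ε⁻¹ * (n + 1)) * (|y o| + 1) := by
    intro n o
    rw [hfeq]
    have h1 : |m n (x o) + A o / e 0 (x o) * (N n o - m n (x o))| ≤ n + ε⁻¹ * (n + n) := by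
      refine (abs_add_le _ _).trans (add_le_add (hmn n _) ?_)
      rw [abs_mul]
      exact mul_le_mul (hAe o) ((abs_sub _ _).trans (add_le_add (hNn n o) (hmn n _)))
        (abs_nonneg _) hε'.le
    have h2 : (0 : ℝ) ≤ (n + ε⁻¹ * (n + n)) * |y o| := by positivity
    refine (abs_add_le _ _).trans ((add_le_add h1 (hZ₂b n o)).trans ?_)
    nlinarith
  -- the remainder
  set φ₁ : ℝ → 𝒰 → ℝ := fun t u => (e 0 u / e t u - 1) * (r 0 u / r t u) with hφ₁
  set φ₂ : ℝ → O → ℝ := fun t o => A o * (r 0 (x o) / r t (x o) - 1) with hφ₂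
  have hφ₁m : ∀ t, Measurable (φ₁ t) := fun t =>
    (((hem 0).div (hem t)).sub_const 1).mul ((hrm 0).div (hrm t))
  have hφ₂m : ∀ t, Measurable (φ₂ t) := fun t =>
    hA.mul ((((hrm 0).div (hrm t)).sub_const 1).comp hx)
  have hrr : ∀ t u, |r 0 u / r t u| ≤ 1 / ε := fun t u => by
    have := div_mem_of_mem_Icc hε ((hw 0).r_mem u) ((hw t).r_mem u)
    rw [abs_of_pos (hε.trans_le this.1)]; exact this.2
  have hφ₁le : ∀ t u, |φ₁ t u| ≤ 1 / ε * |e 0 u / e t u - 1| := fun t u => by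
    rw [hφ₁]; simp only; rw [abs_mul, mul_comm]
    exact mul_le_mul_of_nonneg_right (hrr t u) (abs_nonneg _)
  have hφ₁C : ∀ t u, |φ₁ t u| ≤ 1 / ε * (1 / ε) := fun t u =>
    (hφ₁le t u).trans (mul_le_mul_of_nonneg_left
      (abs_div_sub_one_le hε ((hw 0).e_mem u) ((hw t).e_mem u)) (by positivity))
  have hφ₂C : ∀ t o, |φ₂ t o| ≤ 1 / ε := fun t o => by
    rw [hφ₂]; simp only; rw [abs_mul]
    exact (mul_le_of_le_one_left (abs_nonneg _) (hA1 o)).trans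
      (abs_div_sub_one_le hε ((hw 0).r_mem _) ((hw t).r_mem _))
  obtain ⟨C₁', hC₁'⟩ := h.treat_sq_le hε hx hA hA01 hw
  obtain ⟨C₂', hC₂'⟩ := h.label_sq_le hε hx hA hA01 hL hL01 hw
  set C₁ := max C₁' 0
  set C₂ := max C₂' 0
  have hC₁ : ∀ᶠ t in 𝓝[≠] 0, ∫ o, (e 0 (x o) / e t (x o) - 1) ^ 2 ∂p 0 ≤ C₁ * t ^ 2 :=
    hC₁'.mono fun t ht => ht.trans (mul_le_mul_of_nonneg_right (le_max_left _ _) (sq_nonneg t))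
  have hC₂ : ∀ᶠ t in 𝓝[≠] 0, ∫ o, φ₂ t o ^ 2 ∂p 0 ≤ C₂ * t ^ 2 :=
    hC₂'.mono fun t ht => ht.trans (mul_le_mul_of_nonneg_right (le_max_left _ _) (sq_nonneg t))
  have hC₁0 : 0 ≤ C₁ := le_max_right _ _
  have hC₂0 : 0 ≤ C₂ := le_max_right _ _
  have hsq1 : ∀ t, Integrable (fun o => (e 0 (x o) / e t (x o) - 1) ^ 2) (p 0) := fun t => by
    refine integrable_of_abs_le (integrable_const ((1 / ε) ^ 2))
      (((((hem 0).div (hem t)).sub_const 1).comp hx).pow_const 2).aestronglyMeasurable fun o => ?_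
    rw [abs_of_nonneg (sq_nonneg _), ← sq_abs]
    exact pow_le_pow_left₀ (abs_nonneg _)
      (abs_div_sub_one_le hε ((hw 0).e_mem _) ((hw t).e_mem _)) 2
  have hsq2 : ∀ t, Integrable (fun o => φ₂ t o ^ 2) (p 0) := fun t => by
    refine integrable_of_abs_le (integrable_const ((1 / ε) ^ 2))
      ((hφ₂m t).pow_const 2).aestronglyMeasurable fun o => ?_
    rw [abs_of_nonneg (sq_nonneg _), ← sq_abs]
    exact pow_le_pow_left₀ (abs_nonneg _) (hφ₂C t o) 2
  have hφ₁sq : ∀ᶠ t in 𝓝[≠] 0, ∫ o, φ₁ t (x o) ^ 2 ∂p 0 ≤ ((1 / ε) ^ 2 * C₁) * t ^ 2 := by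
    filter_upwards [hC₁] with t ht
    rw [mul_assoc]
    refine le_trans ?_ (mul_le_mul_of_nonneg_left ht (by positivity))
    rw [← integral_const_mul]
    refine integral_mono_of_nonneg (ae_of_all _ fun o => sq_nonneg _) ((hsq1 t).const_mul _)
      (ae_of_all _ fun o => ?_)
    simp only
    rw [← sq_abs, ← sq_abs (e 0 (x o) / e t (x o) - 1), ← mul_pow]
    exact pow_le_pow_left₀ (abs_nonneg _) (hφ₁le t _) 2
  -- The parameter of the integrand and that of the law are separated, so that the law can be moved
  -- to 0 while the integrand stays at `t`.
  set Rem : ℕ → ℝ → ℝ → ℝ := fun n t s => ∫ o, (φ₁ t (x o) * Z₁ n o + φ₂ t o * Z₂ n o) ∂p s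
    with hRem
  have hdecomp : ∀ n t, θ t = ∫ o, f n o ∂p t + Rem n t t := by
    intro n t
    have := (hw t).integral_armInfluence hε hx hA hL hM hA01 hL01 (hem 0) (hrm 0) (hw 0).e_mem
      (hw 0).r_mem (hmm n) (Nat.cast_nonneg n) (hmn n) (hy1 t)
    rw [hθ t]
    linarith
  have hdecomp0 : ∀ n, θ 0 = ∫ o, f n o ∂p 0 := by
    intro n
    rw [hdecomp n 0, hRem]
    simp only
    have : ∀ o, φ₁ 0 (x o) * Z₁ n o + φ₂ 0 o * Z₂ n o = 0 := by
      intro o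
      simp only [hφ₁, hφ₂, div_self (hepos 0 (x o)).ne', div_self (hrpos 0 (x o)).ne']
      simp
    simp [this]
  have hZ₁i : ∀ n t, Integrable (Z₁ n) (p t) := fun n t =>
    ((memLp_two_iff_integrable_sq (hZ₁m n).aestronglyMeasurable).2
      ((hmoment _ (hZ₁m n) _ (hZ₁b n)).1 t)).integrable one_le_two
  have hZ₂i : ∀ n t, Integrable (Z₂ n) (p t) := fun n t =>
    ((memLp_two_iff_integrable_sq (hZ₂m n).aestronglyMeasurable).2
      ((hmoment _ (hZ₂m n) _ (hZ₂b n)).1 t)).integrable one_le_two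
  have hφZ₁ : ∀ n t s, Integrable (fun o => φ₁ t (x o) * Z₁ n o) (p s) := fun n t s =>
    integrable_mul_of_bounded ((hφ₁m t).comp hx) (fun o => hφ₁C t _) (hZ₁i n s)
  have hφZ₂ : ∀ n t s, Integrable (fun o => φ₂ t o * Z₂ n o) (p s) := fun n t s =>
    integrable_mul_of_bounded (hφ₂m t) (hφ₂C t) (hZ₂i n s)
  have hlim1 : ∀ n, Tendsto (fun t => (∫ o, f n o ∂p t - ∫ o, f n o ∂p 0) / t) (𝓝[≠] 0)
      (𝓝 (∫ o, f n o * g o ∂p 0)) := fun n =>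
    h.tendsto_integral (hfm n) (hmoment _ (hfm n) _ (hfb n)).1 (hmoment _ (hfm n) _ (hfb n)).2
  have hlim2 : ∀ n, Tendsto (fun t => (Rem n t t - Rem n t 0) / t) (𝓝[≠] 0) (𝓝 0) := by
    intro n
    have t1 := h.tendsto_integral_mul (hZ₁m n) (hmoment _ (hZ₁m n) _ (hZ₁b n)).1
      (hmoment _ (hZ₁m n) _ (hZ₁b n)).2 (φ := fun t o => φ₁ t (x o))
      (fun t => (hφ₁m t).comp hx) (fun t o => hφ₁C t _) hφ₁sq
    have t2 := h.tendsto_integral_mul (hZ₂m n) (hmoment _ (hZ₂m n) _ (hZ₂b n)).1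
      (hmoment _ (hZ₂m n) _ (hZ₂b n)).2 hφ₂m hφ₂C hC₂
    have t12 := t1.add t2
    rw [add_zero] at t12
    refine t12.congr fun t => ?_
    simp only [hRem]
    rw [integral_add (hφZ₁ n t t) (hφZ₂ n t t), integral_add (hφZ₁ n t 0) (hφZ₂ n t 0)]
    ring
  set δ : ℕ → ℝ := fun n => ∫ o, (μ (x o) - m n (x o)) ^ 2 ∂p 0 with hδ
  set δ' : ℕ → ℝ := fun n => ∫ o, (M o - N n o) ^ 2 ∂p 0 with hδ'
  have hδ0 : Tendsto δ atTop (𝓝 0) := tendsto_integral_sub_clamp_sq hμ2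
  have hδ'0 : Tendsto δ' atTop (𝓝 0) := tendsto_integral_sub_clamp_sq hM2
  have hμi : Integrable (fun o => μ (x o)) (p 0) := hμ2.integrable one_le_two
  have hMi : Integrable M (p 0) := hM2.integrable one_le_two
  set c := ε⁻¹ * ε⁻¹ * ε⁻¹ with hc
  have hc0 : 0 < c := by positivity
  have hsq3 : ∀ n, Integrable (fun o => (μ (x o) - m n (x o)) ^ 2) (p 0) := fun n => by
    refine integrable_of_abs_le hμ2.integrable_sq
      ((hmx.sub ((hmm n).comp hx)).pow_const 2).aestronglyMeasurable fun o => ?_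
    rw [abs_of_nonneg (sq_nonneg _)]
    exact sq_le_sq.2 (abs_sub_clamp_le (Nat.cast_nonneg n) _)
  have hsq4 : ∀ n, Integrable (fun o => (M o - N n o) ^ 2) (p 0) := fun n => by
    refine integrable_of_abs_le hM2.integrable_sq
      ((hM.sub (hNm n)).pow_const 2).aestronglyMeasurable fun o => ?_
    rw [abs_of_nonneg (sq_nonneg _)]
    exact sq_le_sq.2 (abs_sub_clamp_le (Nat.cast_nonneg n) _)
  have hALi : ∀ v : O → ℝ, Integrable v (p 0) → Integrable (fun o => A o * L o * v o) (p 0) :=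
    fun v hv => integrable_mul_of_bounded (hA.mul hL) hAL1 hv
  -- Without truncation this integral would be zero, as y − μ(x) is centred under `p 0`. What
  -- remains is an O(t) factor times the truncation error of μ.
  have hrem1 : ∀ n t, t ≠ 0 → ∀ κ > 0, ∫ o, (e 0 (x o) / e t (x o) - 1) ^ 2 ∂p 0 ≤ C₁ * t ^ 2 →
      |∫ o, φ₁ t (x o) * Z₁ n o ∂p 0| ≤ |t| * (c * (κ * C₁ + δ n / (4 * κ))) := by
    intro n t ht κ hκ hle
    set ξ : 𝒰 → ℝ := fun u => φ₁ t u * (e 0 u * r 0 u)⁻¹ with hξ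
    have hξm : Measurable ξ := (hφ₁m t).mul ((hem 0).mul (hrm 0)).inv
    have hξle : ∀ u, |ξ u| ≤ c * |e 0 u / e t u - 1| := fun u => by
      rw [hξ]; simp only; rw [abs_mul, mul_comm]
      refine (mul_le_mul (hW0 u) (hφ₁le t u) (abs_nonneg _) (by positivity)).trans (le_of_eq ?_)
      rw [hc]; ring
    have hξC : ∀ u, |ξ u| ≤ c * (1 / ε) := fun u => (hξle u).trans
      (mul_le_mul_of_nonneg_left (abs_div_sub_one_le hε ((hw 0).e_mem u) ((hw t).e_mem u)) hc0.le)
    have e1 : ∫ o, φ₁ t (x o) * Z₁ n o ∂p 0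
        = ∫ o, ξ (x o) * (A o * L o * (μ (x o) - m n (x o))) ∂p 0 := by
      have hmi : Integrable (fun o => m n (x o)) (p 0) := integrable_of_abs_le
        (integrable_const (n : ℝ)) ((hmm n).comp hx).aestronglyMeasurable fun o => hmn n _
      have i1 : Integrable (fun o => ξ (x o) * (A o * L o * (y o - μ (x o)))) (p 0) :=
        integrable_mul_of_bounded (hξm.comp hx) (fun o => hξC _) (hALi _ ((hy1 0).sub hμi))
      have i2 : Integrable (fun o => ξ (x o) * (A o * L o * (μ (x o) - m n (x o)))) (p 0) :=
        integrable_mul_of_bounded (hξm.comp hx) (fun o => hξC _) (hALi _ (hμi.sub hmi))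
      have i12 := integral_add i1 i2
      rw [hμ0 ξ hξm ⟨_, hξC⟩, zero_add] at i12
      rw [← i12]
      refine integral_congr_ae (ae_of_all _ fun o => ?_)
      simp only [hξ, hZ₁, hWdef, div_eq_mul_inv]
      ring
    rw [e1]
    refine abs_integral_le_of_abs_le_mul hc0.le hκ ht (hsq1 t) (hsq3 n) (fun o => ?_) hle le_rfl
    have : |ξ (x o) * (A o * L o * (μ (x o) - m n (x o)))|
        = |ξ (x o)| * |A o * L o * (μ (x o) - m n (x o))| := abs_mul _ _
    rw [this, ← mul_assoc]
    refine mul_le_mul (hξle _) ?_ (abs_nonneg _) (by positivity)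
    rw [abs_mul]
    exact mul_le_of_le_one_left (abs_nonneg _) (hAL1 o)
  -- Likewise for the residual y − M, with the truncation error of M.
  have hrem2 : ∀ n t, t ≠ 0 → ∀ κ > 0, ∫ o, φ₂ t o ^ 2 ∂p 0 ≤ C₂ * t ^ 2 →
      |∫ o, φ₂ t o * Z₂ n o ∂p 0| ≤ |t| * (c * (κ * C₂ + δ' n / (4 * κ))) := by
    intro n t ht κ hκ hle
    set ξ : 𝒰 → ℝ := fun u => (r 0 u / r t u - 1) * (e 0 u * r 0 u)⁻¹ with hξ
    have hξm : Measurable ξ := (((hrm 0).div (hrm t)).sub_const 1).mul ((hem 0).mul (hrm 0)).inv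
    have hξle : ∀ u, |ξ u| ≤ c * |r 0 u / r t u - 1| := fun u => by
      rw [hξ]; simp only; rw [abs_mul, mul_comm]
      refine mul_le_mul_of_nonneg_right ((hW0 u).trans ?_) (abs_nonneg _)
      rw [hc]
      exact le_mul_of_one_le_right (by positivity) hinv1
    have hξC : ∀ u, |ξ u| ≤ c * (1 / ε) := fun u => (hξle u).trans
      (mul_le_mul_of_nonneg_left (abs_div_sub_one_le hε ((hw 0).r_mem u) ((hw t).r_mem u)) hc0.le)
    have hAA : ∀ o, A o * A o = A o := fun o => by rcases hA01 o with h | h <;> simp [h]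
    have e1 : ∫ o, φ₂ t o * Z₂ n o ∂p 0
        = ∫ o, ξ (x o) * (A o * L o * (M o - N n o)) ∂p 0 := by
      have hNi : Integrable (fun o => N n o) (p 0) := integrable_of_abs_le
        (integrable_const (n : ℝ)) (hNm n).aestronglyMeasurable fun o => hNn n _
      have i1 : Integrable (fun o => ξ (x o) * (A o * L o * (y o - M o))) (p 0) :=
        integrable_mul_of_bounded (hξm.comp hx) (fun o => hξC _) (hALi _ ((hy1 0).sub hMi))
      have i2 : Integrable (fun o => ξ (x o) * (A o * L o * (M o - N n o))) (p 0) :=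
        integrable_mul_of_bounded (hξm.comp hx) (fun o => hξC _) (hALi _ (hMi.sub hNi))
      have i12 := integral_add i1 i2
      rw [hM0 ξ hξm ⟨_, hξC⟩, zero_add] at i12
      rw [← i12]
      refine integral_congr_ae (ae_of_all _ fun o => ?_)
      simp only [hξ, hφ₂, hZ₂, hWdef, div_eq_mul_inv]
      linear_combination (L o * (r 0 (x o) * (r t (x o))⁻¹ - 1) * (e 0 (x o) * r 0 (x o))⁻¹
        * (y o - N n o)) * hAA o
    rw [e1]
    refine abs_integral_le_of_abs_le_mul hc0.le hκ ht (hsq2 t) (hsq4 n) (fun o => ?_) hle le_rfl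
    have : |ξ (x o) * (A o * L o * (M o - N n o))|
        = |ξ (x o)| * |A o| * (|L o| * |M o - N n o|) := by simp only [abs_mul]; ring
    have h2 : |φ₂ t o| = |r 0 (x o) / r t (x o) - 1| * |A o| := by
      rw [hφ₂]; simp only [abs_mul]; rw [mul_comm]
    rw [this, h2]
    refine le_trans ?_ (le_of_eq (show c * |r 0 (x o) / r t (x o) - 1| * |A o| * |M o - N n o| = _
      by ring))
    exact mul_le_mul (mul_le_mul_of_nonneg_right (hξle (x o)) (abs_nonneg (A o)))
      (mul_le_of_le_one_left (abs_nonneg _) (hL1 o)) (by positivity) (by positivity)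
  -- convergence of the approximate derivatives
  have hlim3 : Tendsto (fun n => ∫ o, f n o * g o ∂p 0) atTop
      (𝓝 (∫ o, armInfluence x A L M y (e 0) (r 0) μ o * g o ∂p 0)) := by
    set dom : O → ℝ := fun o => |μ (x o)| + ε⁻¹ * (|M o| + |μ (x o)|)
      + ε⁻¹ * ε⁻¹ * (|y o| + |M o|) with hdom
    have hdom2 : MemLp dom 2 (p 0) := by
      refine (hμ2.abs.add ((hM2.abs.add hμ2.abs).const_mul _)).add ?_
      exact (hy2.abs.add hM2.abs).const_mul (ε⁻¹ * ε⁻¹)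
    refine tendsto_integral_of_dominated_convergence (fun o => dom o * |g o|)
      (fun n => (hfm n).aestronglyMeasurable.mul h.1.1) (hdom2.integrable_mul h.1.abs)
      (fun n => ae_of_all _ fun o => ?_) (ae_of_all _ fun o => ?_)
    · rw [Real.norm_eq_abs, abs_mul]
      refine mul_le_mul_of_nonneg_right ?_ (abs_nonneg _)
      rw [hfeq]
      have a1 : |m n (x o)| ≤ |μ (x o)| := abs_clamp_le_abs (Nat.cast_nonneg n) _
      have a2 : |N n o| ≤ |M o| := abs_clamp_le_abs (Nat.cast_nonneg n) _
      refine (abs_add_three _ _ _).trans (add_le_add (add_le_add a1 ?_) ?_)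
      · rw [abs_mul]
        exact mul_le_mul (hAe o) ((abs_sub _ _).trans (add_le_add a2 a1)) (abs_nonneg _) hε'.le
      · rw [hZ₂]; simp only; rw [abs_mul]
        exact mul_le_mul (hWC o) ((abs_sub _ _).trans (add_le_add le_rfl a2)) (abs_nonneg _)
          (by positivity)
    · have t1 : Tendsto (fun n => m n (x o)) atTop (𝓝 (μ (x o))) := tendsto_clamp _
      have t2 : Tendsto (fun n => N n o) atTop (𝓝 (M o)) := tendsto_clamp _
      exact ((t1.add ((t2.sub t1).const_mul _)).add ((t2.const_sub _).const_mul _)).mul_const _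
  rw [hasDerivAt_iff_tendsto_slope_zero, Metric.tendsto_nhds]
  intro η hη
  -- With this `κ` the terms with C₁ and C₂ contribute at most η/8; then `n` bounds the truncation
  -- errors, divided by 4κ, by η/8. The other three errors are each below η/4.
  set κ := η / (8 * c * (C₁ + C₂ + 1)) with hκ
  have hκ0 : 0 < κ := by positivity
  have hδlim : Tendsto (fun n => c * (δ n / (4 * κ)) + c * (δ' n / (4 * κ))) atTop (𝓝 0) := by
    have := ((hδ0.div_const (4 * κ)).const_mul c).add ((hδ'0.div_const (4 * κ)).const_mul c)
    simpa using this
  obtain ⟨n, hn1, hn2⟩ := ((hδlim.eventually (gt_mem_nhds (show 0 < η / 8 by positivity))).and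
    ((Metric.tendsto_nhds.1 hlim3) (η / 4) (by positivity))).exists
  filter_upwards [(Metric.tendsto_nhds.1 (hlim1 n)) (η / 4) (by positivity),
    (Metric.tendsto_nhds.1 (hlim2 n)) (η / 4) (by positivity), hC₁, hC₂, self_mem_nhdsWithin]
    with t ht1 ht2 ht3 ht4 ht0
  have ht0 : t ≠ 0 := ht0
  have htpos : 0 < |t| := abs_pos.2 ht0
  rw [Real.dist_eq] at hn2 ht1 ht2 ⊢
  rw [sub_zero] at ht2
  have hR0 : |Rem n t 0 / t| ≤ η / 4 := by
    rw [abs_div, div_le_iff₀ htpos, hRem]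
    simp only
    rw [integral_add (hφZ₁ n t 0) (hφZ₂ n t 0)]
    refine (abs_add_le _ _).trans
      ((add_le_add (hrem1 n t ht0 κ hκ0 ht3) (hrem2 n t ht0 κ hκ0 ht4)).trans ?_)
    have hκc : c * (κ * (C₁ + C₂)) ≤ η / 8 := by
      have : c * (κ * (C₁ + C₂)) = η / 8 * ((C₁ + C₂) / (C₁ + C₂ + 1)) := by
        rw [hκ]; field_simp
      rw [this]
      have h1 : (C₁ + C₂) / (C₁ + C₂ + 1) ≤ 1 := by
        rw [div_le_one (by positivity)]; linarith
      nlinarith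
    nlinarith
  have hslope : t⁻¹ • (θ (0 + t) - θ 0)
      = (∫ o, f n o ∂p t - ∫ o, f n o ∂p 0) / t + (Rem n t t - Rem n t 0) / t + Rem n t 0 / t := by
    rw [zero_add, hdecomp n t, hdecomp0 n, smul_eq_mul]
    ring
  rw [hslope]
  rw [abs_lt] at *
  rw [abs_le] at hR0
  constructor <;> linarith [hn2.1, hn2.2, ht1.1, ht1.2, ht2.1, ht2.2, hR0.1, hR0.2]

end Pathwise

/-! ### Regression functions under a conditional law -/

section Regression

variable {F 𝒰 : Type*} [MeasurableSpace F] [MeasurableSpace 𝒰] {Q : Measure F} {Z : F → ℝ}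
  {A : Set F} {U : F → 𝒰} {m : 𝒰 → ℝ}

theorem integral_cond_eq (f : F → ℝ) : ∫ w, f w ∂Q[|A] = (Q A)⁻¹.toReal * ∫ w in A, f w ∂Q := by
  rw [ProbabilityTheory.cond, integral_smul_measure, smul_eq_mul]

theorem ae_cond_iff [IsFiniteMeasure Q] {P : F → Prop} :
    (∀ᵐ w ∂Q[|A], P w) ↔ ∀ᵐ w ∂Q.restrict A, P w := by
  rw [ProbabilityTheory.cond]
  simp only [ae_iff, Measure.smul_apply, smul_eq_mul, mul_eq_zero,
    ENNReal.inv_ne_zero.2 (measure_ne_top Q A), false_or]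

theorem integrable_cond_of_restrict {f : F → ℝ} (hf : Integrable f (Q.restrict A)) :
    Integrable f Q[|A] := by
  by_cases h : Q A = 0
  · have : Q[|A] = 0 := cond_eq_zero_of_meas_eq_zero h
    rw [this]; exact integrable_zero_measure
  · exact hf.smul_measure (ENNReal.inv_ne_top.2 h)

theorem integrable_restrict_of_cond [IsFiniteMeasure Q] {f : F → ℝ} (hf : Integrable f Q[|A]) :
    Integrable f (Q.restrict A) := by
  by_cases h : Q A = 0
  · rw [Measure.restrict_eq_zero.2 h]; exact integrable_zero_measure
  · exact (integrable_smul_measure (ENNReal.inv_ne_zero.2 (measure_ne_top Q A))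
      (ENNReal.inv_ne_top.2 h)).1 hf

theorem setIntegral_eq_of_integral_cond_eq [IsFiniteMeasure Q] {f h : F → ℝ}
    (heq : ∫ w, f w ∂Q[|A] = ∫ w, h w ∂Q[|A]) : ∫ w in A, f w ∂Q = ∫ w in A, h w ∂Q := by
  by_cases hA : Q A = 0
  · simp [Measure.restrict_eq_zero.2 hA]
  · rw [integral_cond_eq, integral_cond_eq] at heq
    refine mul_left_cancel₀ ?_ heq
    exact ENNReal.toReal_ne_zero.2 ⟨ENNReal.inv_ne_zero.2 (measure_ne_top Q A),
      ENNReal.inv_ne_top.2 hA⟩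

theorem IsRegression.integrable [IsFiniteMeasure Q] (h : IsRegression Q Z A U m) :
    Integrable (fun w => m (U w)) (Q.restrict A) :=
  integrable_restrict_of_cond (integrable_condExp.congr h.2)

theorem IsRegression.integral_mul [IsFiniteMeasure Q] (h : IsRegression Q Z A U m)
    (hU : Measurable U) (hZ : Integrable Z (Q.restrict A)) {φ : 𝒰 → ℝ}
    (hφ : Measurable φ) (hφC : ∃ C, ∀ u, |φ u| ≤ C) :
    ∫ w in A, φ (U w) * Z w ∂Q = ∫ w in A, φ (U w) * m (U w) ∂Q := by
  obtain ⟨C, hC⟩ := hφC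
  refine setIntegral_eq_of_integral_cond_eq ?_
  have hm : MeasurableSpace.comap U inferInstance ≤ (inferInstance : MeasurableSpace F) :=
    hU.comap_le
  have h1 : StronglyMeasurable[MeasurableSpace.comap U inferInstance] fun w => φ (U w) :=
    (hφ.comp (comap_measurable U)).stronglyMeasurable
  have h2 := condExp_stronglyMeasurable_mul_of_bound hm h1 (integrable_cond_of_restrict hZ) C
    (ae_of_all _ fun w => hC (U w))
  calc ∫ w, φ (U w) * Z w ∂Q[|A] = ∫ w, ((Q[|A])[(fun w => φ (U w)) * Z |
        MeasurableSpace.comap U inferInstance]) w ∂Q[|A] := (integral_condExp hm).symm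
    _ = _ := by
      refine integral_congr_ae ?_
      filter_upwards [h2, h.2] with w hw1 hw2
      rw [hw1, Pi.mul_apply, hw2]

theorem IsRegression.integral_mul_sub_eq_zero [IsFiniteMeasure Q] (h : IsRegression Q Z A U m)
    (hU : Measurable U) (hZ : Integrable Z (Q.restrict A)) {φ : 𝒰 → ℝ}
    (hφ : Measurable φ) (hφC : ∃ C, ∀ u, |φ u| ≤ C) :
    ∫ w in A, φ (U w) * (Z w - m (U w)) ∂Q = 0 := by
  have h1 := h.integral_mul hU hZ hφ hφC
  obtain ⟨C, hC⟩ := hφC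
  simp only [mul_sub]
  have i1 : Integrable (fun w => φ (U w) * Z w) (Q.restrict A) :=
    integrable_mul_of_bounded (hφ.comp hU) (fun w => hC (U w)) hZ
  have i2 : Integrable (fun w => φ (U w) * m (U w)) (Q.restrict A) :=
    integrable_mul_of_bounded (hφ.comp hU) (fun w => hC (U w)) h.integrable
  rw [integral_sub i1 i2, h1, sub_self]

theorem isRegression_of_setIntegral_eq [IsFiniteMeasure Q]
    (hU : Measurable U) (hm : Measurable m) (hZ : Integrable Z (Q.restrict A))
    (hmi : Integrable (fun w => m (U w)) (Q.restrict A))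
    (h : ∀ B, MeasurableSet B → ∫ w in A ∩ U ⁻¹' B, Z w ∂Q = ∫ w in A ∩ U ⁻¹' B, m (U w) ∂Q) :
    IsRegression Q Z A U m := by
  refine ⟨hm, (ae_eq_condExp_of_forall_setIntegral_eq hU.comap_le (integrable_cond_of_restrict hZ)
    (fun s _ _ => (integrable_cond_of_restrict hmi).integrableOn) ?_ ?_).symm⟩
  · rintro s ⟨B, hB, rfl⟩ -
    have e : ∀ f : F → ℝ, ∫ w in U ⁻¹' B, f w ∂Q[|A]
        = (Q A)⁻¹.toReal * ∫ w in A ∩ U ⁻¹' B, f w ∂Q := by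
      intro f
      rw [ProbabilityTheory.cond, Measure.restrict_smul, integral_smul_measure, smul_eq_mul,
        Measure.restrict_restrict (hU hB), Set.inter_comm]
    rw [e, e, h B hB]
  · exact (hm.comp (comap_measurable U)).stronglyMeasurable.aestronglyMeasurable

theorem IsRegression.setIntegral_eq [IsFiniteMeasure Q] (h : IsRegression Q Z A U m)
    (hU : Measurable U) (hZ : Integrable Z (Q.restrict A)) {B : Set 𝒰} (hB : MeasurableSet B) :
    ∫ w in A ∩ U ⁻¹' B, Z w ∂Q = ∫ w in A ∩ U ⁻¹' B, m (U w) ∂Q := by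
  have h1 := h.integral_mul hU hZ (φ := B.indicator 1) (measurable_one.indicator hB)
    ⟨1, fun u => by by_cases hu : u ∈ B <;> simp [hu]⟩
  have e : ∀ f : F → ℝ, ∫ w in A, B.indicator 1 (U w) * f w ∂Q = ∫ w in A ∩ U ⁻¹' B, f w ∂Q := by
    intro f
    rw [Set.inter_comm, ← Measure.restrict_restrict (hU hB), ← integral_indicator (hU hB)]
    refine integral_congr_ae (ae_of_all _ fun w => ?_)
    by_cases hw : U w ∈ B <;> simp [hw, Set.indicator]
  rwa [e, e] at h1

/-- The σ-algebras generated by `U` and `U'` may differ, but their traces on `A` coincide, and the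
conditional law lives on `A`. This exchanges the observed surrogate S for S(a) on the arm T = a. -/
theorem IsRegression.congr_eqOn [IsFiniteMeasure Q] (h : IsRegression Q Z A U m)
    (hA : MeasurableSet A) (hU : Measurable U) {U' : F → 𝒰} (hU' : Measurable U')
    (hZ : Integrable Z (Q.restrict A)) (heq : ∀ w ∈ A, U w = U' w) : IsRegression Q Z A U' m := by
  have hset : ∀ B : Set 𝒰, A ∩ U' ⁻¹' B = A ∩ U ⁻¹' B := by
    intro B
    ext w
    simp only [Set.mem_inter_iff, Set.mem_preimage]
    exact and_congr_right fun hw => by rw [heq w hw]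
  refine isRegression_of_setIntegral_eq hU' h.1 hZ ?_ fun B hB => ?_
  · refine h.integrable.congr ?_
    filter_upwards [ae_restrict_mem hA] with w hw
    rw [heq w hw]
  · rw [hset, h.setIntegral_eq hU hZ hB]
    refine setIntegral_congr_fun (hA.inter (hU hB)) fun w hw => ?_
    simp only [heq w hw.1]

theorem IsRegression.ae_eq [IsFiniteMeasure Q] {m' : 𝒰 → ℝ} (h : IsRegression Q Z A U m)
    (h' : IsRegression Q Z A U m') : ∀ᵐ w ∂Q.restrict A, m (U w) = m' (U w) := by
  rw [← ae_cond_iff]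
  filter_upwards [h.2, h'.2] with w h1 h2
  rw [← h1, ← h2]

theorem exists_isRegression (Q : Measure F) (Z : F → ℝ) (A : Set F) (U : F → 𝒰) :
    ∃ m, IsRegression Q Z A U m := by
  obtain ⟨m, hm, he⟩ := Measurable.exists_eq_measurable_comp (f := U)
    (stronglyMeasurable_condExp (μ := Q[|A]) (f := Z)
      (m := MeasurableSpace.comap U inferInstance)).measurable
  exact ⟨m, hm, ae_of_all _ fun w => congrFun he w⟩

end Regression

/-! ### Conditional independence of a binary variable as a density statement -/

section ConditionalIndependence

variable {Ω α β : Type*} {mΩ : MeasurableSpace Ω} [MeasurableSpace α]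
  [MeasurableSpace β] {μ : Measure Ω} {f : Ω → α} {g : Ω → β} {h : Ω → Bool}

theorem measurableSet_eq_bool (hh : Measurable h) (b : Bool) : MeasurableSet {w | h w = b} :=
  hh (measurableSet_singleton b)

/-- Conditional independence says that the probability of h = b given f and g is already the one
given f. In this form it can be integrated against arbitrary functions of f and g. -/
theorem map_restrict_eq_withDensity [StandardBorelSpace Ω] [IsFiniteMeasure μ] (hf : Measurable f)
    (hg : Measurable g) (hh : Measurable h)
    (hci : CondIndepFun (MeasurableSpace.comap f inferInstance) hf.comap_le g h μ)
    {b : Bool} {π : α → ℝ} (hπ : Measurable π) (hπ0 : ∀ u, 0 ≤ π u) {C : ℝ} (hπC : ∀ u, π u ≤ C)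
    (hπh : μ[{w | h w = b}.indicator fun _ => (1 : ℝ) | MeasurableSpace.comap f inferInstance]
      =ᵐ[μ] fun w => π (f w)) :
    (μ.restrict {w | h w = b}).map (fun w => (f w, g w))
      = (μ.map fun w => (f w, g w)).withDensity fun z => ENNReal.ofReal (π z.1) := by
  have hfg : Measurable fun w => (f w, g w) := hf.prodMk hg
  have hDm : Measurable fun z : α × β => ENNReal.ofReal (π z.1) :=
      (hπ.comp measurable_fst).ennreal_ofReal
  have hH := measurableSet_eq_bool hh b
  have hπi : Integrable (fun w => π (f w)) μ := integrable_of_abs_le (integrable_const C)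
    (hπ.comp hf).aestronglyMeasurable fun w => by rw [abs_of_nonneg (hπ0 _)]; exact hπC _
  have hfin : IsFiniteMeasure ((μ.map fun w => (f w, g w)).withDensity
      fun z => ENNReal.ofReal (π z.1)) := by
    refine isFiniteMeasure_withDensity (ne_of_lt ?_)
    rw [lintegral_map hDm hfg]
    exact hπi.lintegral_lt_top
  -- Finite measures on a product agree if they agree on rectangles. There the product formula for
  -- conditional expectations applies.
  refine Measure.ext_prod fun {B C'} hB hC => ?_
  rw [Measure.map_apply hfg (hB.prod hC), Measure.restrict_apply (hfg (hB.prod hC)),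
    withDensity_apply _ (hB.prod hC), setLIntegral_map (hB.prod hC) hDm hfg]
  have hm : MeasurableSpace.comap f inferInstance ≤ mΩ := hf.comap_le
  have hfB : MeasurableSet[MeasurableSpace.comap f inferInstance] (f ⁻¹' B) := ⟨B, hB, rfl⟩
  have hset : (fun w => (f w, g w)) ⁻¹' (B ×ˢ C') = f ⁻¹' B ∩ g ⁻¹' C' := rfl
  rw [hset]
  have h1 := (condIndepFun_iff_condExp_inter_preimage_eq_mul hg hh).1 hci C' {b} hC
    (measurableSet_singleton b)
  have hS : MeasurableSet (g ⁻¹' C' ∩ {w | h w = b}) := (hg hC).inter hH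
  have hind : ∀ {s : Set Ω}, MeasurableSet s → Integrable (s.indicator fun _ => (1 : ℝ)) μ :=
    fun hs => (integrable_const 1).indicator hs
  have hpull : μ[(fun w => π (f w)) * (g ⁻¹' C').indicator (fun _ => (1 : ℝ))
      | MeasurableSpace.comap f inferInstance]
      =ᵐ[μ] (fun w => π (f w)) * μ[(g ⁻¹' C').indicator (fun _ => (1 : ℝ))
          | MeasurableSpace.comap f inferInstance] :=
    condExp_stronglyMeasurable_mul_of_bound hm
      (hπ.comp (comap_measurable f)).stronglyMeasurable (hind (hg hC)) C
      (ae_of_all _ fun w => by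
        rw [Real.norm_eq_abs, abs_of_nonneg (hπ0 _)]; exact hπC _)
  have hint : Integrable ((fun w => π (f w)) * (g ⁻¹' C').indicator (fun _ => (1 : ℝ))) μ :=
    integrable_mul_of_bounded (hπ.comp hf) (fun w =>
      (abs_of_nonneg (hπ0 (f w))).trans_le (hπC _)) (hind (hg hC))
  have key : ∫ w in f ⁻¹' B, (g ⁻¹' C' ∩ {w | h w = b}).indicator (fun _ => (1 : ℝ)) w ∂μ
      = ∫ w in f ⁻¹' B, π (f w) * (g ⁻¹' C').indicator (fun _ => (1 : ℝ)) w ∂μ := by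
    rw [← setIntegral_condExp hm (hind hS) hfB]
    refine Eq.trans ?_ (setIntegral_condExp hm hint hfB)
    refine setIntegral_congr_ae (hm _ hfB) ?_
    filter_upwards [h1, hpull, hπh] with w w1 w2 w3 _
    refine (w1.trans ?_).trans w2.symm
    rw [Pi.mul_apply, mul_comm]
    exact congrArg (· * _) w3
  have e1 : μ.real (f ⁻¹' B ∩ g ⁻¹' C' ∩ {w | h w = b})
      = ∫ w in f ⁻¹' B ∩ g ⁻¹' C', π (f w) ∂μ := by
    rw [integral_indicator hS, Measure.restrict_restrict hS, setIntegral_const, smul_eq_mul,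
      mul_one] at key
    rw [show f ⁻¹' B ∩ g ⁻¹' C' ∩ {w | h w = b} = g ⁻¹' C' ∩ {w | h w = b} ∩ f ⁻¹' B by
      ext; simp only [Set.mem_inter_iff]; tauto, key, Set.inter_comm (f ⁻¹' B),
      ← Measure.restrict_restrict (hg hC), ← integral_indicator (hg hC)]
    refine integral_congr_ae (ae_of_all _ fun w => ?_)
    by_cases hw : w ∈ g ⁻¹' C' <;> simp [hw]
  rw [← ofReal_integral_eq_lintegral_ofReal hπi.integrableOn (ae_of_all _ fun w => hπ0 _), ← e1,
    Measure.real, ENNReal.ofReal_toReal (measure_ne_top _ _)]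

theorem setIntegral_eq_integral_of_map_restrict {V : Ω → α} (hV : Measurable V) {E : Set Ω}
    {π : α → ℝ} (hπ : Measurable π) (hπ0 : ∀ u, 0 ≤ π u)
    (h : (μ.restrict E).map V = (μ.map V).withDensity fun z => ENNReal.ofReal (π z))
    {φ : α → ℝ} (hφ : Measurable φ) :
    ∫ w in E, φ (V w) ∂μ = ∫ w, π (V w) * φ (V w) ∂μ := by
  rw [← integral_map hV.aemeasurable hφ.aestronglyMeasurable, h,
    integral_withDensity_eq_integral_toReal_smul hπ.ennreal_ofReal
      (ae_of_all _ fun _ => ENNReal.ofReal_lt_top),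
    integral_map hV.aemeasurable (by fun_prop)]
  simp only [ENNReal.toReal_ofReal (hπ0 _), smul_eq_mul]

/-- Conversely, if the conditional probability of `h = true` given `f` and `g` is a function of `f`,
then `g` and `h` are conditionally independent given `f`. -/
theorem condIndepFun_of_setIntegral_eq [StandardBorelSpace Ω] [IsFiniteMeasure μ]
    (hf : Measurable f) (hg : Measurable g) (hh : Measurable h)
    {π : α → ℝ} (hπ : Measurable π) {C : ℝ} (hπC : ∀ u, |π u| ≤ C)
    (heq : ∀ B C', MeasurableSet B → MeasurableSet C' →
      μ.real (f ⁻¹' B ∩ g ⁻¹' C' ∩ {w | h w = true}) = ∫ w in f ⁻¹' B ∩ g ⁻¹' C', π (f w) ∂μ) :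
    CondIndepFun (MeasurableSpace.comap f inferInstance) hf.comap_le g h μ := by
  have hm : MeasurableSpace.comap f inferInstance ≤ mΩ := hf.comap_le
  have hind : ∀ {s : Set Ω}, MeasurableSet s → Integrable (s.indicator fun _ => (1 : ℝ)) μ :=
    fun hs => (integrable_const 1).indicator hs
  have hH := measurableSet_eq_bool hh true
  have hπi : Integrable (fun w => π (f w)) μ := integrable_of_abs_le (integrable_const C)
    (hπ.comp hf).aestronglyMeasurable fun w => hπC _
  -- The set integrals of the hypothesis determine the conditional probability of a joint event with
  -- h = true. The case `Set.univ` identifies π(f) as the conditional probability of h = true, and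
  -- complements give h = false.
  have hjoint : ∀ C', MeasurableSet C' →
      μ[(g ⁻¹' C' ∩ {w | h w = true}).indicator (fun _ => (1 : ℝ))
          | MeasurableSpace.comap f inferInstance]
        =ᵐ[μ] (fun w => π (f w)) * μ[(g ⁻¹' C').indicator (fun _ => (1 : ℝ))
            | MeasurableSpace.comap f inferInstance] := by
    intro C' hC
    have hpull : μ[(fun w => π (f w)) * (g ⁻¹' C').indicator (fun _ => (1 : ℝ))
        | MeasurableSpace.comap f inferInstance]
        =ᵐ[μ] (fun w => π (f w)) * μ[(g ⁻¹' C').indicator (fun _ => (1 : ℝ))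
            | MeasurableSpace.comap f inferInstance] :=
      condExp_stronglyMeasurable_mul_of_bound hm
        (hπ.comp (comap_measurable f)).stronglyMeasurable (hind (hg hC)) C
        (ae_of_all _ fun w => hπC _)
    have hint : Integrable ((fun w => π (f w)) * (g ⁻¹' C').indicator (fun _ => (1 : ℝ))) μ :=
      integrable_mul_of_bounded (hπ.comp hf) (fun w => hπC _) (hind (hg hC))
    refine EventuallyEq.trans ?_ hpull
    refine (ae_eq_condExp_of_forall_setIntegral_eq hm (hind ((hg hC).inter hH))
      (fun s _ _ => integrable_condExp.integrableOn) ?_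
      stronglyMeasurable_condExp.aestronglyMeasurable).symm
    intro s hs _
    rw [setIntegral_condExp hm hint hs]
    obtain ⟨B, hB, rfl⟩ := hs
    have hS : MeasurableSet (g ⁻¹' C' ∩ {w | h w = true}) := (hg hC).inter hH
    rw [integral_indicator hS, Measure.restrict_restrict hS, setIntegral_const, smul_eq_mul,
      mul_one, show g ⁻¹' C' ∩ {w | h w = true} ∩ f ⁻¹' B = f ⁻¹' B ∩ g ⁻¹' C' ∩ {w | h w = true} by
        ext; simp only [Set.mem_inter_iff]; tauto, heq B C' hB hC, Set.inter_comm (f ⁻¹' B),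
      ← Measure.restrict_restrict (hg hC), ← integral_indicator (hg hC)]
    refine integral_congr_ae (ae_of_all _ fun w => ?_)
    by_cases hw : w ∈ g ⁻¹' C' <;> simp [hw]
  have hone : μ[fun _ => (1 : ℝ) | MeasurableSpace.comap f inferInstance] = fun _ => 1 :=
    condExp_const hm 1
  have htrue : μ[{w | h w = true}.indicator (fun _ => (1 : ℝ))
      | MeasurableSpace.comap f inferInstance] =ᵐ[μ] fun w => π (f w) := by
    have := hjoint Set.univ MeasurableSet.univ
    simp only [Set.preimage_univ, Set.univ_inter, Set.indicator_univ, hone] at this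
    filter_upwards [this] with w hw
    rw [hw, Pi.mul_apply, mul_one]
  have hfalse : ∀ {s : Set Ω}, MeasurableSet s →
      μ[(s ∩ {w | h w = false}).indicator (fun _ => (1 : ℝ))
          | MeasurableSpace.comap f inferInstance]
        =ᵐ[μ] μ[s.indicator (fun _ => (1 : ℝ)) | MeasurableSpace.comap f inferInstance]
          - μ[(s ∩ {w | h w = true}).indicator (fun _ => (1 : ℝ))
              | MeasurableSpace.comap f inferInstance] := by
    intro s hs
    refine EventuallyEq.trans (Eq.eventuallyEq ?_)
      (condExp_sub (hind hs) (hind (hs.inter hH)) _)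
    congr 1
    ext w
    by_cases hw : w ∈ s <;> cases hb : h w <;> simp [Set.indicator, hw, hb]
  rw [condIndepFun_iff_condExp_inter_preimage_eq_mul hg hh]
  intro C' t hC ht
  have hcases : h ⁻¹' t = ∅ ∨ h ⁻¹' t = Set.univ ∨ h ⁻¹' t = {w | h w = true}
      ∨ h ⁻¹' t = {w | h w = false} := by
    by_cases h1 : true ∈ t <;> by_cases h2 : false ∈ t
    · right; left; ext w; cases hb : h w <;> simp [hb, h1, h2]
    · right; right; left; ext w; cases hb : h w <;> simp [hb, h1, h2]
    · right; right; right; ext w; cases hb : h w <;> simp [hb, h1, h2]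
    · left; ext w; cases hb : h w <;> simp [hb, h1, h2]
  rcases hcases with h0 | h0 | h0 | h0
  · rw [h0, Set.inter_empty]
    simp only [Set.indicator_empty]
    have : μ[fun _ => (0 : ℝ) | MeasurableSpace.comap f inferInstance] = fun _ => 0 :=
        condExp_const hm 0
    rw [this]
    exact ae_of_all _ fun w => by simp
  · rw [h0, Set.inter_univ]
    simp only [Set.indicator_univ, hone]
    exact ae_of_all _ fun w => by simp
  · rw [h0]
    filter_upwards [hjoint C' hC, htrue] with w w1 w2
    rw [w1, Pi.mul_apply, w2, mul_comm]
  · rw [h0]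
    have h3 := hfalse MeasurableSet.univ
    simp only [Set.univ_inter, Set.indicator_univ, hone] at h3
    filter_upwards [hjoint C' hC, htrue, hfalse (hg hC), h3] with w w1 w2 w3 w4
    rw [w3, Pi.sub_apply, w1, Pi.mul_apply, w4, Pi.sub_apply, w2]
    ring

end ConditionalIndependence

/-! ### What the assumptions say about the law of one arm -/

section ArmLaw

variable {𝒳 𝒮 : Type*}

/-- The propensity score of arm `a`, truncated to its admissible range. -/
noncomputable def treatProb (ε : ℝ) (e : 𝒳 → ℝ) (a : Bool) (x : 𝒳) : ℝ :=
  if a then clamp ε (1 - ε) (e x) else 1 - clamp ε (1 - ε) (e x)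

/-- The labelling propensity score of arm `a`, truncated to its admissible range. -/
noncomputable def labelProb (ε : ℝ) (r : Bool → 𝒳 → ℝ) (a : Bool) (x : 𝒳) : ℝ :=
  clamp ε 1 (r a x)

theorem treatProb_mem {ε : ℝ} (hε₁ : ε < 1 / 2) (e : 𝒳 → ℝ) (a : Bool)
    (x : 𝒳) : treatProb ε e a x ∈ Set.Icc ε (1 - ε) := by
  have h := clamp_mem (show ε ≤ 1 - ε by linarith) (e x)
  cases a
  · simp only [treatProb, Bool.false_eq_true, if_false]
    constructor <;> linarith [h.1, h.2]
  · simpa only [treatProb, if_true] using h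

theorem treatProb_mem_one {ε : ℝ} (hε₀ : 0 < ε) (hε₁ : ε < 1 / 2) (e : 𝒳 → ℝ) (a : Bool)
    (x : 𝒳) : treatProb ε e a x ∈ Set.Icc ε 1 := by
  have h := treatProb_mem hε₁ e a x
  exact ⟨h.1, by linarith [h.2]⟩

theorem labelProb_mem {ε : ℝ} (hε₁ : ε < 1 / 2) (r : Bool → 𝒳 → ℝ) (a : Bool) (x : 𝒳) :
    labelProb ε r a x ∈ Set.Icc ε 1 :=
  clamp_mem (by linarith) _

theorem sum_treatProb (ε : ℝ) (e : 𝒳 → ℝ) (x : 𝒳) :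
    treatProb ε e true x + treatProb ε e false x = 1 := by
  simp [treatProb]

theorem ind_nonneg (b : Bool) : 0 ≤ ind b := by cases b <;> simp [ind]

theorem ind_le_one (b : Bool) : ind b ≤ 1 := by cases b <;> simp [ind]

theorem ind_eq_zero_or_one (b : Bool) : ind b = 0 ∨ ind b = 1 := by cases b <;> simp [ind]

variable [MeasurableSpace 𝒳] [MeasurableSpace 𝒮]

theorem measurable_treatProb {ε : ℝ} {e : 𝒳 → ℝ} (he : Measurable e) (a : Bool) :
    Measurable (treatProb ε e a) := by
  have h := (measurable_clamp ε (1 - ε)).comp he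
  cases a
  · exact measurable_const.sub h
  · exact h

theorem measurable_labelProb {ε : ℝ} {r : Bool → 𝒳 → ℝ} {a : Bool} (hr : Measurable (r a)) :
    Measurable (labelProb ε r a) :=
  (measurable_clamp ε 1).comp hr

theorem measurable_Ypot (a : Bool) : Measurable (Ypot a : FullData 𝒳 𝒮 → ℝ) := by
  unfold Ypot; fun_prop

theorem measurable_R : Measurable (R : FullData 𝒳 𝒮 → Bool) := by
  unfold R; fun_prop

theorem measurable_ind : Measurable ind := measurable_of_finite _

theorem measurable_arm (a : Bool) :
    Measurable (fun w : FullData 𝒳 𝒮 => (X w, Spot a w, Ypot a w)) :=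
  measurable_X.prodMk ((measurable_Spot a).prodMk (measurable_Ypot a))

theorem measurable_S : Measurable (S : FullData 𝒳 𝒮 → 𝒮) := by
  have : (S : FullData 𝒳 𝒮 → 𝒮) = fun w => if T w = true then Spot true w else Spot false w := by
    ext w; simp only [S]; cases T w <;> simp
  rw [this]
  exact Measurable.ite (measurableSet_eq_bool measurable_T true) (measurable_Spot true)
    (measurable_Spot false)

theorem measurable_Y : Measurable (Y : FullData 𝒳 𝒮 → ℝ) := by
  have : (Y : FullData 𝒳 𝒮 → ℝ) = fun w => if T w = true then Ypot true w else Ypot false w := by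
    ext w; simp only [Y]; cases T w <;> simp
  rw [this]
  exact Measurable.ite (measurableSet_eq_bool measurable_T true) (measurable_Ypot true)
    (measurable_Ypot false)

/-- Under `Q`, `ea` is the conditional probability of treatment `a` given the covariates and the
potential variables of arm `a`, and `ra` is the conditional probability of being labelled given
treatment `a` and these variables. -/
structure IsArmLaw (ε : ℝ) (Q : Measure (FullData 𝒳 𝒮)) (a : Bool) (ea ra : 𝒳 → ℝ) : Prop where
  measurable_e : Measurable ea
  measurable_r : Measurable ra
  e_mem : ∀ x, ea x ∈ Set.Icc ε 1
  r_mem : ∀ x, ra x ∈ Set.Icc ε 1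
  treat : ∀ φ : 𝒳 × 𝒮 × ℝ → ℝ, Measurable φ →
    ∫ w in {w | T w = a}, φ (X w, Spot a w, Ypot a w) ∂Q
      = ∫ w, ea (X w) * φ (X w, Spot a w, Ypot a w) ∂Q
  label : ∀ φ : 𝒳 × 𝒮 × ℝ → ℝ, Measurable φ →
    ∫ w in {w | T w = a ∧ R w = true}, φ (X w, Spot a w, Ypot a w) ∂Q
      = ∫ w in {w | T w = a}, ra (X w) * φ (X w, Spot a w, Ypot a w) ∂Q

variable [StandardBorelSpace 𝒳] [StandardBorelSpace 𝒮] {ε : ℝ}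
  {Q : ProbabilityMeasure (FullData 𝒳 𝒮)} {e : 𝒳 → ℝ} {r : Bool → 𝒳 → ℝ}

theorem Assumptions.ae_treatment_mem (hQ : Assumptions ε Q)
    (he : IsTreatmentPropensity (Q : Measure (FullData 𝒳 𝒮)) e) :
    ∀ᵐ w ∂(Q : Measure (FullData 𝒳 𝒮)), e (X w) ∈ Set.Icc ε (1 - ε) := by
  obtain ⟨e', he', hbound⟩ := hQ.overlap_treatment
  have h := IsRegression.ae_eq he he'
  rw [Measure.restrict_univ] at h
  filter_upwards [h, hbound] with w h1 h2
  rw [h1]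
  exact h2

theorem Assumptions.ae_treatProb_true_eq (hQ : Assumptions ε Q)
    (he : IsTreatmentPropensity (Q : Measure (FullData 𝒳 𝒮)) e) :
    ∀ᵐ w ∂(Q : Measure (FullData 𝒳 𝒮)), treatProb ε e true (X w) = e (X w) := by
  filter_upwards [hQ.ae_treatment_mem he] with w hw
  simp only [treatProb, if_true]
  exact clamp_eq_self hw

theorem integrable_ind {F : Type*} [MeasurableSpace F] {μ : Measure F} [IsFiniteMeasure μ]
    {h : F → Bool} (hh : Measurable h) : Integrable (fun w => ind (h w)) μ :=
  integrable_of_abs_le (integrable_const 1) (measurable_ind.comp hh).aestronglyMeasurable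
    fun w => by cases h w <;> simp [ind]

/-- Unconfoundedness of treatment, in integrated form. The truncated score is a version of the
propensity score by overlap, and it has the required bounds at every point rather than almost
everywhere. -/
theorem Assumptions.setIntegral_treat (hQ : Assumptions ε Q) (hε₀ : 0 < ε) (hε₁ : ε < 1 / 2)
    (he : IsTreatmentPropensity (Q : Measure (FullData 𝒳 𝒮)) e) (a : Bool)
    {φ : 𝒳 × 𝒮 × ℝ → ℝ} (hφ : Measurable φ) :
    ∫ w in {w | T w = a}, φ (X w, Spot a w, Ypot a w) ∂(Q : Measure (FullData 𝒳 𝒮))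
      = ∫ w, treatProb ε e a (X w) * φ (X w, Spot a w, Ypot a w)
        ∂(Q : Measure (FullData 𝒳 𝒮)) := by
  set m : Measure (FullData 𝒳 𝒮) := (Q : Measure (FullData 𝒳 𝒮))
  have hae := hQ.ae_treatProb_true_eq he
  have htrue : m[fun w => ind (T w) | MeasurableSpace.comap X inferInstance]
      =ᵐ[m] fun w => treatProb ε e true (X w) := by
    have h1 := he.2
    rw [cond_univ] at h1
    filter_upwards [h1, hae] with w w1 w2
    rw [w1, w2]
  have hπh : m[{w | T w = a}.indicator fun _ => (1 : ℝ) | MeasurableSpace.comap X inferInstance]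
      =ᵐ[m] fun w => treatProb ε e a (X w) := by
    cases a
    · have e1 : ({w : FullData 𝒳 𝒮 | T w = false}.indicator fun _ => (1 : ℝ))
          = (fun _ => (1 : ℝ)) - fun w => ind (T w) := by
        ext w; cases hw : T w <;> simp [Set.indicator, hw, ind]
      rw [e1]
      have h2 := condExp_sub (μ := m) (integrable_const (1 : ℝ)) (integrable_ind measurable_T)
        (MeasurableSpace.comap X inferInstance)
      rw [condExp_const measurable_X.comap_le] at h2
      filter_upwards [h2, htrue] with w w2 w3
      rw [w2, Pi.sub_apply, w3]
      simp [treatProb]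
    · have e1 : ({w : FullData 𝒳 𝒮 | T w = true}.indicator fun _ => (1 : ℝ))
          = fun w => ind (T w) := by
        ext w; cases hw : T w <;> simp [Set.indicator, hw, ind]
      rw [e1]
      exact htrue
  have hg : Measurable fun w : FullData 𝒳 𝒮 => (Ypot a w, Spot a w) :=
    (measurable_Ypot a).prodMk (measurable_Spot a)
  have hmeq := map_restrict_eq_withDensity (μ := m) measurable_X hg measurable_T
    (hQ.unconfounded_treatment a) (measurable_treatProb he.1 a)
    (fun u => hε₀.le.trans (treatProb_mem hε₁ e a u).1) (fun u => (treatProb_mem hε₁ e a u).2) hπh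
  exact setIntegral_eq_integral_of_map_restrict (measurable_X.prodMk hg)
    (π := fun z => treatProb ε e a z.1) ((measurable_treatProb he.1 a).comp measurable_fst)
    (fun u => hε₀.le.trans (treatProb_mem hε₁ e a _).1) hmeq
    (φ := fun z : 𝒳 × ℝ × 𝒮 => φ (z.1, z.2.2, z.2.1)) (by fun_prop)

/-- The slice at T = a of the conditional probability of R given (T, X) works as a regression
function both on X and on (X, S(a)); the second is where R ⊥ S(a) | T, X enters. A single function
serves both, so the two labelling scores can be compared. -/
theorem Assumptions.exists_labelProb (hQ : Assumptions ε Q) (a : Bool) :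
    ∃ r' : 𝒳 → ℝ, IsRegression (Q : Measure (FullData 𝒳 𝒮)) (fun w => ind (R w))
      {w | T w = a} X r' ∧
      IsRegression (Q : Measure (FullData 𝒳 𝒮)) (fun w => ind (R w)) {w | T w = a}
        (fun w => (X w, Spot a w)) fun z => r' z.1 := by
  set m : Measure (FullData 𝒳 𝒮) := (Q : Measure (FullData 𝒳 𝒮))
  obtain ⟨π₀, hπ₀, hπ₀'⟩ := exists_isRegression m (fun w => ind (R w)) Set.univ
    (fun w => (T w, X w))
  rw [cond_univ] at hπ₀'
  set π : Bool × 𝒳 → ℝ := fun z => clamp 0 1 (π₀ z) with hπ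
  have hπm : Measurable π := (measurable_clamp 0 1).comp hπ₀
  have hπ01 : ∀ z, π z ∈ Set.Icc (0 : ℝ) 1 := fun z => clamp_mem zero_le_one _
  have hnonneg : ∀ᵐ w ∂m, 0 ≤ (m[fun w => ind (R w) |
      MeasurableSpace.comap (fun w => (T w, X w)) inferInstance]) w :=
    condExp_nonneg (ae_of_all _ fun w => ind_nonneg (R w))
  have hle : ∀ᵐ w ∂m, (m[fun w => ind (R w) |
      MeasurableSpace.comap (fun w => (T w, X w)) inferInstance]) w ≤ 1 := by
    have h1 := condExp_mono (μ := m) (m := MeasurableSpace.comap (fun w => (T w, X w))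
        inferInstance)
      (integrable_ind measurable_R) (integrable_const (1 : ℝ))
      (ae_of_all _ fun w => ind_le_one (R w))
    rw [condExp_const measurable_TX.comap_le] at h1
    exact h1
  have hπh : m[{w | R w = true}.indicator fun _ => (1 : ℝ) |
      MeasurableSpace.comap (fun w => (T w, X w)) inferInstance]
      =ᵐ[m] fun w => π (T w, X w) := by
    have e1 : ({w : FullData 𝒳 𝒮 | R w = true}.indicator fun _ => (1 : ℝ))
        = fun w => ind (R w) := by
      ext w; cases hw : R w <;> simp [Set.indicator, hw, ind]
    rw [e1]
    filter_upwards [hπ₀', hnonneg, hle] with w w1 w2 w3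
    rw [w1] at w2 w3
    rw [w1, hπ]
    exact (clamp_eq_self ⟨w2, w3⟩).symm
  have hmeq := map_restrict_eq_withDensity (μ := m) measurable_TX (measurable_Spot a) measurable_R
    (hQ.label_surrogate a).symm hπm (fun u => (hπ01 u).1) (fun u => (hπ01 u).2) hπh
  have hint := fun (φ : (Bool × 𝒳) × 𝒮 → ℝ) (hφ : Measurable φ) =>
    setIntegral_eq_integral_of_map_restrict (measurable_TX.prodMk (measurable_Spot a))
    (π := fun z => π z.1) (hπm.comp measurable_fst) (fun u => (hπ01 _).1) hmeq hφ
  have hTa := measurableSet_eq_bool (measurable_T (𝒳 := 𝒳) (𝒮 := 𝒮)) a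
  have hπa : Measurable fun x => π (a, x) := hπm.comp measurable_prodMk_left
  -- Restricting the integrated form of conditional independence to T = a turns conditioning on (T,
  -- X) into conditioning on X within the arm.
  have hreg : ∀ B : Set (𝒳 × 𝒮), MeasurableSet B →
      ∫ w in {w | T w = a} ∩ (fun w => (X w, Spot a w)) ⁻¹' B, ind (R w) ∂m
        = ∫ w in {w | T w = a} ∩ (fun w => (X w, Spot a w)) ⁻¹' B, π (a, X w) ∂m := by
    intro B hB
    have hBm : MeasurableSet ({w : FullData 𝒳 𝒮 | T w = a} ∩ (fun w => (X w, Spot a w)) ⁻¹' B) :=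
      hTa.inter (measurable_XSpot a hB)
    have hC : MeasurableSet {z : (Bool × 𝒳) × 𝒮 | z.1.1 = a ∧ (z.1.2, z.2) ∈ B} := by
      refine MeasurableSet.inter ?_ ?_
      · exact (measurable_fst.comp measurable_fst) (measurableSet_singleton a)
      · exact (by fun_prop : Measurable fun z : (Bool × 𝒳) × 𝒮 => (z.1.2, z.2)) hB
    have h1 := hint ({z : (Bool × 𝒳) × 𝒮 | z.1.1 = a ∧ (z.1.2, z.2) ∈ B}.indicator 1)
      (measurable_one.indicator hC)
    rw [← integral_indicator hBm, ← integral_indicator hBm]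
    rw [← integral_indicator (measurableSet_eq_bool measurable_R true)] at h1
    refine Eq.trans ?_ (h1.trans ?_)
    · refine integral_congr_ae (ae_of_all _ fun w => ?_)
      cases hR : R w <;> by_cases hT : T w = a <;> by_cases hw : (X w, Spot a w) ∈ B <;>
        simp [Set.indicator, hR, hT, hw, ind]
    · refine integral_congr_ae (ae_of_all _ fun w => ?_)
      by_cases hT : T w = a <;> by_cases hw : (X w, Spot a w) ∈ B <;>
        simp [Set.indicator, hT, hw]
  have hπai : ∀ μ' : Measure (FullData 𝒳 𝒮), IsFiniteMeasure μ' →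
      Integrable (fun w => π (a, X w)) μ' := fun μ' _ =>
    integrable_of_abs_le (integrable_const 1) (hπa.comp measurable_X).aestronglyMeasurable
      fun w => abs_le.2 ⟨by linarith [(hπ01 (a, X w)).1], (hπ01 _).2⟩
  refine ⟨fun x => π (a, x), ?_, ?_⟩
  · refine isRegression_of_setIntegral_eq measurable_X hπa (integrable_ind measurable_R)
      (hπai _ inferInstance) fun B hB => ?_
    have := hreg (B ×ˢ Set.univ) (hB.prod MeasurableSet.univ)
    have e1 : (fun w : FullData 𝒳 𝒮 => (X w, Spot a w)) ⁻¹' (B ×ˢ Set.univ) = X ⁻¹' B := by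
      ext w; simp
    rwa [e1] at this
  · exact isRegression_of_setIntegral_eq (measurable_XSpot a) (hπa.comp measurable_fst)
      (integrable_ind measurable_R) (hπai _ inferInstance) hreg

/-- Since `R` and `S` are conditionally independent, the labelling propensity score given the
surrogate does not depend on the surrogate. -/
theorem Assumptions.ae_label_eq (hQ : Assumptions ε Q)
    (hr : IsLabelPropensity (Q : Measure (FullData 𝒳 𝒮)) r) {rS : Bool → 𝒳 × 𝒮 → ℝ}
    (hrS : IsLabelPropensityS (Q : Measure (FullData 𝒳 𝒮)) rS) (a : Bool) :
    ∀ᵐ w ∂(Q : Measure (FullData 𝒳 𝒮)).restrict {w | T w = a},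
      rS a (X w, Spot a w) = r a (X w) := by
  obtain ⟨r', h1, h2⟩ := hQ.exists_labelProb a
  have hTa := measurableSet_eq_bool (measurable_T (𝒳 := 𝒳) (𝒮 := 𝒮)) a
  have h3 := (hrS a).congr_eqOn hTa (measurable_X.prodMk measurable_S) (measurable_XSpot a)
    (integrable_ind measurable_R) fun w hw => by
      have : T w = a := hw
      simp only [S, this]
  filter_upwards [h3.ae_eq h2, (hr a).ae_eq h1] with w w1 w2
  rw [w1, w2]

theorem Assumptions.ae_restrict_label_mem (hQ : Assumptions ε Q)
    (hr : IsLabelPropensity (Q : Measure (FullData 𝒳 𝒮)) r) (a : Bool) :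
    ∀ᵐ w ∂(Q : Measure (FullData 𝒳 𝒮)).restrict {w | T w = a}, r a (X w) ∈ Set.Icc ε 1 := by
  obtain ⟨rS, hrS, hb⟩ := hQ.overlap_label
  filter_upwards [hQ.ae_label_eq hr hrS a, ae_restrict_of_ae (hb a)] with w w1 w2
  rw [← w1]
  exact w2

/-- The two labelling scores are compared only on the arm T = a. But the event that r(a, X) leaves
its range depends on X alone, and given X arm a is assigned with probability at least ε, so an event
of X that is null on the arm is null. -/
theorem Assumptions.ae_label_mem (hQ : Assumptions ε Q) (hε₀ : 0 < ε) (hε₁ : ε < 1 / 2)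
    (hr : IsLabelPropensity (Q : Measure (FullData 𝒳 𝒮)) r) (a : Bool) :
    ∀ᵐ w ∂(Q : Measure (FullData 𝒳 𝒮)), r a (X w) ∈ Set.Icc ε 1 := by
  obtain ⟨e, he, -⟩ := hQ.overlap_treatment
  have hBm : MeasurableSet {x | r a x ∉ Set.Icc ε 1} := ((hr a).1 measurableSet_Icc).compl
  have h1 := hQ.setIntegral_treat hε₀ hε₁ he a (φ := fun z =>
      {x | r a x ∉ Set.Icc ε 1}.indicator 1 z.1)
    ((measurable_one.indicator hBm).comp measurable_fst)
  have h2 : ∫ w in {w | T w = a}, {x | r a x ∉ Set.Icc ε 1}.indicator (1 : 𝒳 → ℝ) (X w)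
      ∂(Q : Measure (FullData 𝒳 𝒮)) = 0 := by
    refine (integral_congr_ae ?_).trans (integral_zero _ _)
    filter_upwards [hQ.ae_restrict_label_mem hr a] with w hw
    simp only [Set.indicator, Set.mem_ofPred_eq, hw, not_true, if_false]
  rw [h2] at h1
  have hm : Measurable fun w : FullData 𝒳 𝒮 => treatProb ε e a (X w)
      * {x | r a x ∉ Set.Icc ε 1}.indicator (1 : 𝒳 → ℝ) (X w) :=
    ((measurable_treatProb he.1 a).comp measurable_X).mul
      ((measurable_one.indicator hBm).comp measurable_X)
  have hpos : ∀ x, 0 < treatProb ε e a x := fun x => hε₀.trans_le (treatProb_mem hε₁ e a x).1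
  have hi : Integrable (fun w : FullData 𝒳 𝒮 => treatProb ε e a (X w)
      * {x | r a x ∉ Set.Icc ε 1}.indicator (1 : 𝒳 → ℝ) (X w)) (Q : Measure (FullData 𝒳 𝒮)) := by
    refine integrable_of_abs_le (integrable_const 1) hm.aestronglyMeasurable fun w => ?_
    rw [abs_mul, abs_of_pos (hpos _)]
    refine mul_le_one₀ (treatProb_mem_one hε₀ hε₁ e a _).2 (abs_nonneg _) ?_
    by_cases hw : X w ∈ {x | r a x ∉ Set.Icc ε 1} <;> simp only [Set.indicator, hw] <;> simp
  have h3 := (integral_eq_zero_iff_of_nonneg (fun w => mul_nonneg (hpos _).le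
    (Set.indicator_nonneg (fun _ _ => zero_le_one) _)) hi).1 h1.symm
  filter_upwards [h3] with w hw
  by_contra hcon
  have hcon' : X w ∈ {x | r a x ∉ Set.Icc ε 1} := hcon
  simp only [Set.indicator_of_mem hcon', mul_one, Pi.zero_apply] at hw
  exact (hpos _).ne' hw

theorem Assumptions.ae_labelProb_eq (hQ : Assumptions ε Q) (hε₀ : 0 < ε) (hε₁ : ε < 1 / 2)
    (hr : IsLabelPropensity (Q : Measure (FullData 𝒳 𝒮)) r) (a : Bool) :
    ∀ᵐ w ∂(Q : Measure (FullData 𝒳 𝒮)), labelProb ε r a (X w) = r a (X w) :=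
  (hQ.ae_label_mem hε₀ hε₁ hr a).mono fun _ hw => clamp_eq_self hw

/-- Unconfoundedness of labelling gives a density that depends on (X, S(a)); by
`Assumptions.exists_labelProb` it depends on X only. -/
theorem Assumptions.setIntegral_label (hQ : Assumptions ε Q) (hε₀ : 0 < ε) (hε₁ : ε < 1 / 2)
    (hr : IsLabelPropensity (Q : Measure (FullData 𝒳 𝒮)) r) (a : Bool)
    {φ : 𝒳 × 𝒮 × ℝ → ℝ} (hφ : Measurable φ) :
    ∫ w in {w | T w = a ∧ R w = true}, φ (X w, Spot a w, Ypot a w) ∂(Q : Measure (FullData 𝒳 𝒮))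
      = ∫ w in {w | T w = a}, labelProb ε r a (X w) * φ (X w, Spot a w, Ypot a w)
        ∂(Q : Measure (FullData 𝒳 𝒮)) := by
  set m : Measure (FullData 𝒳 𝒮) := (Q : Measure (FullData 𝒳 𝒮))
  have hTa := measurableSet_eq_bool (measurable_T (𝒳 := 𝒳) (𝒮 := 𝒮)) a
  have hRt := measurableSet_eq_bool (measurable_R (𝒳 := 𝒳) (𝒮 := 𝒮)) true
  obtain ⟨r', h1, h2⟩ := hQ.exists_labelProb a
  have hπ : ∀ᵐ w ∂m[|{w | T w = a}], labelProb ε r a (X w) = r' (X w) := by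
    rw [ae_cond_iff]
    filter_upwards [(hr a).ae_eq h1, ae_restrict_of_ae (hQ.ae_labelProb_eq hε₀ hε₁ hr a)]
      with w w1 w2
    rw [w2, w1]
  have hπh : (m[|{w | T w = a}])[{w | R w = true}.indicator fun _ => (1 : ℝ) |
      MeasurableSpace.comap (fun w => (X w, Spot a w)) inferInstance]
      =ᵐ[m[|{w | T w = a}]] fun w => labelProb ε r a (X w) := by
    have e1 : ({w : FullData 𝒳 𝒮 | R w = true}.indicator fun _ => (1 : ℝ))
        = fun w => ind (R w) := by
      ext w; cases hw : R w <;> simp [Set.indicator, hw, ind]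
    rw [e1]
    filter_upwards [h2.2, hπ] with w w1 w2
    rw [w1, w2]
  have hmeq := map_restrict_eq_withDensity (measurable_XSpot a) (measurable_Ypot a) measurable_R
    (hQ.unconfounded_label a).symm (π := fun z : 𝒳 × 𝒮 => labelProb ε r a z.1)
    ((measurable_labelProb (hr a).1).comp measurable_fst)
    (fun u => hε₀.le.trans (labelProb_mem hε₁ r a _).1) (fun u => (labelProb_mem hε₁ r a _).2) hπh
  have hint := setIntegral_eq_integral_of_map_restrict
    ((measurable_XSpot a).prodMk (measurable_Ypot a))
    (π := fun z => labelProb ε r a z.1.1)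
    (((measurable_labelProb (hr a).1).comp measurable_fst).comp measurable_fst)
    (fun u => hε₀.le.trans (labelProb_mem hε₁ r a _).1) hmeq
    (φ := fun z : (𝒳 × 𝒮) × ℝ => φ (z.1.1, z.1.2, z.2)) (by fun_prop)
  rw [← integral_indicator hRt] at hint
  have h3 := setIntegral_eq_of_integral_cond_eq hint
  rw [← h3, integral_indicator hRt, Measure.restrict_restrict hRt]
  congr 2
  ext w
  simp [and_comm]

theorem Assumptions.isArmLaw (hQ : Assumptions ε Q) (hε₀ : 0 < ε) (hε₁ : ε < 1 / 2)
    (he : IsTreatmentPropensity (Q : Measure (FullData 𝒳 𝒮)) e)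
    (hr : IsLabelPropensity (Q : Measure (FullData 𝒳 𝒮)) r) (a : Bool) :
    IsArmLaw ε (Q : Measure (FullData 𝒳 𝒮)) a (treatProb ε e a) (labelProb ε r a) where
  measurable_e := measurable_treatProb he.1 a
  measurable_r := measurable_labelProb (hr a).1
  e_mem := treatProb_mem_one hε₀ hε₁ e a
  r_mem := labelProb_mem hε₁ r a
  treat _ hφ := hQ.setIntegral_treat hε₀ hε₁ he a hφ
  label _ hφ := hQ.setIntegral_label hε₀ hε₁ hr a hφ

theorem Assumptions.exists_isArmLaw (hQ : Assumptions ε Q) (hε₀ : 0 < ε) (hε₁ : ε < 1 / 2) :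
    ∃ ea ra : Bool → 𝒳 → ℝ, ∀ a, IsArmLaw ε (Q : Measure (FullData 𝒳 𝒮)) a (ea a) (ra a) := by
  obtain ⟨e, he, -⟩ := hQ.overlap_treatment
  choose r hr using fun t => exists_isRegression (Q : Measure (FullData 𝒳 𝒮))
    (fun w => ind (R w)) {w | T w = t} X
  exact ⟨_, _, fun a => hQ.isArmLaw hε₀ hε₁ he hr a⟩

end ArmLaw

/-! ### Regressions of a potential outcome from the labelled units of its arm -/

section ArmMean

variable {𝒳 𝒮 𝒰 : Type*} [MeasurableSpace 𝒳] [MeasurableSpace 𝒮] [MeasurableSpace 𝒰]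

/-- Under `Q`, `m` is a version of the regression function of `Y(a)` on `U (X, S(a))`. -/
structure IsArmMean (Q : Measure (FullData 𝒳 𝒮)) (a : Bool) (U : 𝒳 × 𝒮 → 𝒰) (m : 𝒰 → ℝ) :
    Prop where
  measurable_mean : Measurable m
  memLp : MemLp (fun w => m (U (X w, Spot a w))) 2 Q
  integral_eq_zero : ∀ φ : 𝒰 → ℝ, Measurable φ → (∃ C, ∀ u, |φ u| ≤ C) →
    ∫ w, φ (U (X w, Spot a w)) * (Ypot a w - m (U (X w, Spot a w))) ∂Q = 0

variable {ε : ℝ} {Q : Measure (FullData 𝒳 𝒮)} {a : Bool} {ea ra : 𝒳 → ℝ}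

theorem measurableSet_arm (a : Bool) : MeasurableSet {w : FullData 𝒳 𝒮 | T w = a} :=
  measurableSet_eq_bool measurable_T a

theorem measurableSet_armLabelled (a : Bool) :
    MeasurableSet {w : FullData 𝒳 𝒮 | T w = a ∧ R w = true} :=
  (measurableSet_arm a).inter (measurableSet_eq_bool measurable_R true)

/-- Dividing by `ra` undoes the selection by labelling and dividing by `ea` undoes the selection by
treatment. -/
theorem IsArmLaw.integral_eq (h : IsArmLaw ε Q a ea ra) (hε : 0 < ε) {φ : 𝒳 × 𝒮 × ℝ → ℝ}
    (hφ : Measurable φ) :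
    ∫ w, φ (X w, Spot a w, Ypot a w) ∂Q
      = ∫ w in {w | T w = a ∧ R w = true},
          φ (X w, Spot a w, Ypot a w) / (ea (X w) * ra (X w)) ∂Q := by
  have he := h.measurable_e
  have hr := h.measurable_r
  rw [h.label (fun z => φ z / (ea z.1 * ra z.1)) (by fun_prop),
    h.treat (fun z => ra z.1 * (φ z / (ea z.1 * ra z.1))) (by fun_prop)]
  refine integral_congr_ae (ae_of_all _ fun w => ?_)
  have h1 := (hε.trans_le (h.e_mem (X w)).1).ne'
  have h2 := (hε.trans_le (h.r_mem (X w)).1).ne'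
  simp only
  field_simp

/-- Inverse weighting of indicators shows that the law of the arm variables is at most 1/ε² times
their law on the labelled units of the arm. -/
theorem IsArmLaw.integrable_of_restrict [IsFiniteMeasure Q] (h : IsArmLaw ε Q a ea ra) (hε : 0 < ε)
    {φ : 𝒳 × 𝒮 × ℝ → ℝ} (hφ : Measurable φ)
    (hi : Integrable (fun w => φ (X w, Spot a w, Ypot a w))
      (Q.restrict {w | T w = a ∧ R w = true})) :
    Integrable (fun w => φ (X w, Spot a w, Ypot a w)) Q := by
  have hV := measurable_arm (𝒳 := 𝒳) (𝒮 := 𝒮) a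
  have hle : Q.map (fun w => (X w, Spot a w, Ypot a w)) ≤
      ENNReal.ofReal ((ε * ε)⁻¹) • (Q.restrict {w | T w = a ∧ R w = true}).map
        (fun w => (X w, Spot a w, Ypot a w)) := by
    refine Measure.le_intro fun B hB _ => ?_
    rw [Measure.smul_apply, Measure.map_apply hV hB, Measure.map_apply hV hB, smul_eq_mul]
    have h1 := h.integral_eq hε (φ := B.indicator 1) (measurable_one.indicator hB)
    have e1 : ∫ w, B.indicator (1 : 𝒳 × 𝒮 × ℝ → ℝ) (X w, Spot a w, Ypot a w) ∂Q
        = Q.real ((fun w => (X w, Spot a w, Ypot a w)) ⁻¹' B) := by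
      rw [← integral_indicator_one (hV hB)]; rfl
    have h2 : ∫ w in {w | T w = a ∧ R w = true},
        B.indicator (1 : 𝒳 × 𝒮 × ℝ → ℝ) (X w, Spot a w, Ypot a w) / (ea (X w) * ra (X w)) ∂Q
        ≤ ∫ w in {w | T w = a ∧ R w = true},
          (ε * ε)⁻¹ * ((fun w => (X w, Spot a w, Ypot a w)) ⁻¹' B).indicator 1 w ∂Q := by
      refine integral_mono_of_nonneg (ae_of_all _ fun w => ?_)
        (((integrable_const (1 : ℝ)).indicator (hV hB)).const_mul _) (ae_of_all _ fun w => ?_)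
      · exact div_nonneg (Set.indicator_nonneg (fun _ _ => zero_le_one) _)
          (mul_nonneg (hε.le.trans (h.e_mem _).1) (hε.le.trans (h.r_mem _).1))
      · have hle : ε * ε ≤ ea (X w) * ra (X w) :=
          mul_le_mul (h.e_mem _).1 (h.r_mem _).1 hε.le (hε.le.trans (h.e_mem _).1)
        change B.indicator (1 : 𝒳 × 𝒮 × ℝ → ℝ) (X w, Spot a w, Ypot a w) / _
          ≤ (ε * ε)⁻¹ * B.indicator (1 : 𝒳 × 𝒮 × ℝ → ℝ) (X w, Spot a w, Ypot a w)
        rw [div_eq_mul_inv, mul_comm]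
        exact mul_le_mul_of_nonneg_right (inv_anti₀ (by positivity) hle)
          (Set.indicator_nonneg (fun _ _ => zero_le_one) _)
    rw [integral_const_mul, integral_indicator_one (hV hB), ← h1, e1] at h2
    rw [← ENNReal.ofReal_toReal (measure_ne_top Q _),
      ← ENNReal.ofReal_toReal (measure_ne_top (Q.restrict _) _),
          ← ENNReal.ofReal_mul (by positivity)]
    exact ENNReal.ofReal_le_ofReal h2
  have hi' : Integrable φ ((Q.restrict {w | T w = a ∧ R w = true}).map
      (fun w => (X w, Spot a w, Ypot a w))) :=
    (integrable_map_measure hφ.aestronglyMeasurable hV.aemeasurable).2 hi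
  exact (integrable_map_measure hφ.aestronglyMeasurable hV.aemeasurable).1
    ((hi'.smul_measure ENNReal.ofReal_ne_top).mono_measure hle)

/-- The map `p` recovers x from the regressor, so the inverse weights are bounded functions of the
regressor. They may be absorbed in the test function, and orthogonality of the residual passes from
the labelled units of the arm to the whole population. -/
theorem IsArmLaw.isArmMean [IsFiniteMeasure Q] (h : IsArmLaw ε Q a ea ra) (hε : 0 < ε)
    (hY : MemLp (Ypot a) 2 Q) {U : 𝒳 × 𝒮 → 𝒰} (hU : Measurable U) {p : 𝒰 → 𝒳}
    (hp : Measurable p) (hpU : ∀ z, p (U z) = z.1) {m : 𝒰 → ℝ}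
    (hm : IsRegression Q Y {w | T w = a ∧ R w = true} (fun w => U (X w, S w)) m) :
    IsArmMean Q a U m := by
  have hA := measurableSet_armLabelled (𝒳 := 𝒳) (𝒮 := 𝒮) a
  have hYS : ∀ w : FullData 𝒳 𝒮, w ∈ {w : FullData 𝒳 𝒮 | T w = a ∧ R w = true} →
      Y w = Ypot a w ∧ S w = Spot a w := by
    rintro w ⟨h1, -⟩
    simp only [Y, S, h1, and_self]
  have hUm : Measurable fun w : FullData 𝒳 𝒮 => U (X w, S w) :=
    hU.comp (measurable_X.prodMk measurable_S)
  have hYr : MemLp Y 2 (Q.restrict {w | T w = a ∧ R w = true}) := by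
    refine (hY.restrict _).ae_eq ?_
    filter_upwards [ae_restrict_mem hA] with w hw
    rw [(hYS w hw).1]
  have hmm := hm.1
  have hL2 : MemLp (fun w => m (U (X w, Spot a w))) 2 Q := by
    refine (memLp_two_iff_integrable_sq
      (hmm.comp (hU.comp (measurable_XSpot a))).aestronglyMeasurable).2 ?_
    refine h.integrable_of_restrict hε (φ := fun z => m (U (z.1, z.2.1)) ^ 2) (by fun_prop) ?_
    have h1 : MemLp Y 2 Q[|{w | T w = a ∧ R w = true}] :=
      (memLp_two_iff_integrable_sq measurable_Y.aestronglyMeasurable).2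
        (integrable_cond_of_restrict hYr.integrable_sq)
    have h2 : MemLp (fun w => m (U (X w, S w))) 2 Q[|{w | T w = a ∧ R w = true}] :=
      (h1.condExp one_le_two).ae_eq hm.2
    refine (integrable_restrict_of_cond h2.integrable_sq).congr ?_
    filter_upwards [ae_restrict_mem hA] with w hw
    rw [(hYS w hw).2]
  refine ⟨hmm, hL2, ?_⟩
  rintro φ hφ ⟨C, hC⟩
  have he := h.measurable_e
  have hr := h.measurable_r
  rw [h.integral_eq hε (φ := fun z => φ (U (z.1, z.2.1)) * (z.2.2 - m (U (z.1, z.2.1))))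
    (by fun_prop)]
  have h3 := hm.integral_mul_sub_eq_zero hUm (hYr.integrable one_le_two)
    (φ := fun u => φ u / (ea (p u) * ra (p u))) (by fun_prop) ⟨C * (ε * ε)⁻¹, fun u => by
      have hle : ε * ε ≤ ea (p u) * ra (p u) :=
        mul_le_mul (h.e_mem _).1 (h.r_mem _).1 hε.le (hε.le.trans (h.e_mem _).1)
      have hpos : 0 < ea (p u) * ra (p u) := (mul_pos hε hε).trans_le hle
      rw [div_eq_mul_inv, abs_mul, abs_of_pos (inv_pos.2 hpos)]
      exact mul_le_mul (hC u) (inv_anti₀ (mul_pos hε hε) hle) (inv_pos.2 hpos).le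
        ((abs_nonneg _).trans (hC u))⟩
  rw [← h3]
  refine setIntegral_congr_fun hA fun w hw => ?_
  simp only [hpU, (hYS w hw).1, (hYS w hw).2]
  ring

end ArmMean

/-! ### A common description of the four observation settings -/

section Scheme

variable {𝒳 𝒮 𝒰 O : Type*}

theorem ind_arm_mul_eq {a : Bool} (w : FullData 𝒳 𝒮) (f : 𝒮 → ℝ → ℝ) :
    ind (T w == a) * f (S w) (Y w) = ind (T w == a) * f (Spot a w) (Ypot a w) := by
  by_cases h : T w = a
  · simp [S, Y, h]
  · have : (T w == a) = false := by simpa using h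
    simp [this, ind]

variable [MeasurableSpace 𝒳] [MeasurableSpace 𝒮] [MeasurableSpace 𝒰]
  [MeasurableSpace O]

/-- A description of the observed data. If `full` is false, the outcome is observed on the labelled
units only, and on the unlabelled units the observed data are the treatment and `U (X, S)`; if
`full` is true, then the outcome is observed on all units. -/
structure Scheme (obs : FullData 𝒳 𝒮 → O) (full : Bool) (U : 𝒳 × 𝒮 → 𝒰) where
  code : 𝒳 × Bool × 𝒮 × ℝ × Bool → O
  measurable_code : Measurable code
  obs_eq : ∀ w, obs w = code (X w, T w, S w, Y w, R w)
  proj : 𝒰 → 𝒳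
  measurable_proj : Measurable proj
  proj_eq : ∀ z, proj (U z) = z.1
  measurable_U : Measurable U
  unlabelled : full = false → ∃ v : Bool → 𝒰 → O, (∀ a, Measurable (v a)) ∧
    ∀ x a s y, code (x, a, s, y, false) = v a (U (x, s))
  treat : O → Bool
  measurable_treat : Measurable treat
  treat_eq : ∀ w, treat (obs w) = T w
  label : O → Bool
  measurable_label : Measurable label
  label_eq : ∀ w, label (obs w) = (R w || full)
  outcome : O → ℝ
  measurable_outcome : Measurable outcome
  outcome_eq : ∀ w, outcome (obs w) = ind (R w || full) * Y w
  reg : O → 𝒰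
  measurable_reg : Measurable reg
  reg_eq : ∀ w, reg (obs w) = U (X w, S w)

/-- The labelling propensity score for the outcomes that are observed. -/
noncomputable def schemeProb (full : Bool) (ra : 𝒳 → ℝ) (x : 𝒳) : ℝ := if full then 1 else ra x

/-- The uncentered influence function of the mean of arm `a`. -/
noncomputable def armPsi (full : Bool) (U : 𝒳 × 𝒮 → 𝒰) (a : Bool) (ea ra μ : 𝒳 → ℝ) (M : 𝒰 → ℝ) :
    FullData 𝒳 𝒮 → ℝ :=
  armInfluence X (fun w => ind (T w == a)) (fun w => ind (R w || full))
    (fun w => ind (T w == a) * M (U (X w, S w))) Y ea (schemeProb full ra) μ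

variable {obs : FullData 𝒳 𝒮 → O} {full : Bool} {U : 𝒳 × 𝒮 → 𝒰} {ε : ℝ}
  {Q : Measure (FullData 𝒳 𝒮)} {a : Bool} {ea ra : 𝒳 → ℝ}

theorem Scheme.measurable_obs (s : Scheme obs full U) : Measurable obs := by
  have : obs = fun w => s.code (X w, T w, S w, Y w, R w) := funext s.obs_eq
  rw [this]
  exact s.measurable_code.comp (measurable_X.prodMk (measurable_T.prodMk
    (measurable_S.prodMk (measurable_Y.prodMk measurable_R))))

theorem measurable_ind_eq (a : Bool) : Measurable fun b : Bool => ind (b == a) :=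
  measurable_of_finite _

theorem setIntegral_arm_eq (f : FullData 𝒳 𝒮 → ℝ) :
    ∫ w in {w | T w = a}, f w ∂Q = ∫ w, ind (T w == a) * f w ∂Q := by
  rw [← integral_indicator (measurableSet_arm a)]
  refine integral_congr_ae (ae_of_all _ fun w => ?_)
  by_cases h : T w = a <;> simp [Set.indicator, h, ind]

theorem setIntegral_armLabelled_eq (f : FullData 𝒳 𝒮 → ℝ) :
    ∫ w in {w | T w = a ∧ R w = true}, f w ∂Q
      = ∫ w, ind (T w == a) * ind (R w) * f w ∂Q := by
  rw [← integral_indicator (measurableSet_armLabelled a)]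
  refine integral_congr_ae (ae_of_all _ fun w => ?_)
  by_cases h : T w = a <;> cases hR : R w <;> simp [Set.indicator, h, hR, ind]

theorem IsArmLaw.schemeProb_mem (h : IsArmLaw ε Q a ea ra) (x : 𝒳) :
    schemeProb full ra x ∈ Set.Icc ε 1 := by
  cases full
  · simpa [schemeProb] using h.r_mem x
  · simp only [schemeProb, if_true, Set.mem_Icc, le_refl, and_true]
    exact (h.r_mem x).1.trans (h.r_mem x).2

theorem IsArmLaw.measurable_schemeProb (h : IsArmLaw ε Q a ea ra) :
    Measurable (schemeProb full ra) := by
  cases full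
  · exact h.measurable_r
  · exact measurable_const

/-- The outcome is missing at random. -/
theorem IsArmLaw.integral_scheme_label (h : IsArmLaw ε Q a ea ra) {φ : 𝒳 × 𝒮 × ℝ → ℝ}
    (hφ : Measurable φ) :
    ∫ w, ind (T w == a) * ind (R w || full) * φ (X w, Spot a w, Ypot a w) ∂Q
      = ∫ w, ind (T w == a) * (schemeProb full ra (X w) * φ (X w, Spot a w, Ypot a w)) ∂Q := by
  cases full
  · simp only [Bool.or_false, schemeProb, Bool.false_eq_true, if_false]
    rw [← setIntegral_armLabelled_eq, ← setIntegral_arm_eq]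
    exact h.label φ hφ
  · simp [schemeProb, ind]

theorem IsArmLaw.integral_scheme (h : IsArmLaw ε Q a ea ra) {φ : 𝒳 × 𝒮 × ℝ → ℝ}
    (hφ : Measurable φ) :
    ∫ w, ind (T w == a) * ind (R w || full) * φ (X w, Spot a w, Ypot a w) ∂Q
      = ∫ w, ea (X w) * schemeProb full ra (X w) * φ (X w, Spot a w, Ypot a w) ∂Q := by
  have hr := h.measurable_schemeProb (full := full)
  rw [h.integral_scheme_label hφ, ← setIntegral_arm_eq,
    h.treat (fun z => schemeProb full ra z.1 * φ z) (by fun_prop)]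
  simp only [mul_assoc]

variable {μ : 𝒳 → ℝ} {M : 𝒰 → ℝ}

/-- The coordinate M is multiplied by the indicator of the arm because the regression is evaluated
at the observed S, which is S(a) only there. -/
theorem Scheme.isWeighting (s : Scheme obs full U) (h : IsArmLaw ε Q a ea ra) (hM : Measurable M) :
    IsWeighting ε (fun o => s.proj (s.reg o)) (fun o => ind (s.treat o == a))
      (fun o => ind (s.label o)) (fun o => ind (s.treat o == a) * M (s.reg o)) ea
      (schemeProb full ra) (Q.map obs) := by
  have m1 := s.measurable_treat
  have m2 := s.measurable_label
  have m3 := s.measurable_reg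
  have m4 := s.measurable_proj
  have m5 : Measurable fun o => ind (s.treat o == a) := (measurable_ind_eq a).comp m1
  have m6 : Measurable fun o => ind (s.label o) := measurable_ind.comp m2
  have m7 := h.measurable_e
  have m8 := h.measurable_schemeProb (full := full)
  have hU := s.measurable_U
  have hobs := s.measurable_obs
  have m34 : Measurable fun o => s.proj (s.reg o) := m4.comp m3
  refine ⟨h.measurable_e, m8, h.e_mem, h.schemeProb_mem, ?_, ?_⟩
  · intro φ hφ _
    have k1 : Measurable fun o => φ (s.proj (s.reg o)) * ind (s.treat o == a) :=
      (hφ.comp m34).mul m5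
    have k2 : Measurable fun o => φ (s.proj (s.reg o)) * ea (s.proj (s.reg o)) :=
      (hφ.comp m34).mul (m7.comp m34)
    rw [integral_map hobs.aemeasurable k1.aestronglyMeasurable,
      integral_map hobs.aemeasurable k2.aestronglyMeasurable]
    simp only [s.treat_eq, s.reg_eq, s.proj_eq]
    have := h.treat (fun z => φ z.1) (by fun_prop)
    rw [setIntegral_arm_eq] at this
    simpa only [mul_comm] using this
  · intro φ β hφ _ hβ _
    have m9 : Measurable fun o => β (ind (s.treat o == a) * M (s.reg o)) :=
      hβ.comp (m5.mul (hM.comp m3))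
    have k1 : Measurable fun o => φ (s.proj (s.reg o)) * β (ind (s.treat o == a) * M (s.reg o))
        * (ind (s.treat o == a) * ind (s.label o)) := ((hφ.comp m34).mul m9).mul (m5.mul m6)
    have k2 : Measurable fun o => φ (s.proj (s.reg o)) * β (ind (s.treat o == a) * M (s.reg o))
        * (ind (s.treat o == a) * schemeProb full ra (s.proj (s.reg o))) :=
      ((hφ.comp m34).mul m9).mul (m5.mul (m8.comp m34))
    rw [integral_map hobs.aemeasurable k1.aestronglyMeasurable,
      integral_map hobs.aemeasurable k2.aestronglyMeasurable]
    simp only [s.treat_eq, s.label_eq, s.reg_eq, s.proj_eq]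
    have := h.integral_scheme_label (full := full) (φ := fun z => φ z.1 * β (M (U (z.1, z.2.1))))
      (by fun_prop)
    refine Eq.trans ?_ (this.trans ?_)
    · refine integral_congr_ae (ae_of_all _ fun w => ?_)
      by_cases hT : T w = a
      · simp only [hT, beq_self_eq_true, ind, if_true, one_mul, S]
        ring
      · have : (T w == a) = false := by simpa using hT
        simp [this, ind]
    · refine integral_congr_ae (ae_of_all _ fun w => ?_)
      by_cases hT : T w = a
      · simp only [hT, beq_self_eq_true, ind, if_true, one_mul, S]
        ring
      · have : (T w == a) = false := by simpa using hT
        simp [this, ind]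

/-- The scores are determined by the law where they matter. This allows the scores at parameter 0 to
be those attached to P, although the submodel shares only its observed law with P. -/
theorem IsWeighting.integral_eq_of_isWeighting {q : Measure O} [IsProbabilityMeasure q]
    {x : O → 𝒳} {A L N y : O → ℝ} (hε : 0 < ε) (hx : Measurable x) (hA : Measurable A)
    (hA01 : ∀ o, A o = 0 ∨ A o = 1)
    {e r e' r' : 𝒳 → ℝ} (h : IsWeighting ε x A L N e r q) (h' : IsWeighting ε x A L N e' r' q) :
    ∫ o, A o * L o * y o / (e (x o) * r (x o)) ∂q
      = ∫ o, A o * L o * y o / (e' (x o) * r' (x o)) ∂q := by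
  have me := h.measurable_e
  have me' := h'.measurable_e
  have mr := h.measurable_r
  have mr' := h'.measurable_r
  have hb : ∀ {f f' : 𝒳 → ℝ}, (∀ u, f u ∈ Set.Icc ε 1) → (∀ u, f' u ∈ Set.Icc ε 1) →
      ∀ u, |f u - f' u| ≤ 1 := by
    intro f f' hf hf' u
    rw [abs_le]
    constructor <;> linarith [(hf u).1, (hf u).2, (hf' u).1, (hf' u).2]
  have hb1 : ∀ {f : 𝒳 → ℝ}, (∀ u, f u ∈ Set.Icc ε 1) → ∀ u, |f u| ≤ 1 := by
    intro f hf u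
    rw [abs_le]
    constructor <;> linarith [(hf u).1, (hf u).2]
  have hA1 : ∀ o, |A o| ≤ 1 := fun o => by rcases hA01 o with h | h <;> simp [h]
  have he : ∀ᵐ o ∂q, e (x o) = e' (x o) := by
    -- Testing with e − e' itself shows that its square has integral zero.
    have h1 := h.integral_treat (fun u => e u - e' u) (me.sub me') ⟨1, hb h.e_mem h'.e_mem⟩
    rw [h'.integral_treat (fun u => e u - e' u) (me.sub me') ⟨1, hb h.e_mem h'.e_mem⟩] at h1
    have i1 : ∀ {f : 𝒳 → ℝ}, Measurable f → (∀ u, f u ∈ Set.Icc ε 1) →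
        Integrable (fun o => (e (x o) - e' (x o)) * f (x o)) q := fun hf hf' =>
      integrable_mul_of_bounded ((me.sub me').comp hx) (fun o => hb h.e_mem h'.e_mem _)
        (integrable_of_abs_le (integrable_const 1) (hf.comp hx).aestronglyMeasurable
          fun o => hb1 hf' _)
    have h2 : ∫ o, (e (x o) - e' (x o)) ^ 2 ∂q = 0 := by
      have : ∀ o, (e (x o) - e' (x o)) ^ 2
          = (e (x o) - e' (x o)) * e (x o) - (e (x o) - e' (x o)) * e' (x o) := fun o => by ring
      simp only [this]
      rw [integral_sub (i1 me h.e_mem) (i1 me' h'.e_mem), h1, sub_self]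
    have i2 : Integrable (fun o => (e (x o) - e' (x o)) ^ 2) q :=
      integrable_of_abs_le (integrable_const 1)
        (((me.sub me').comp hx).pow_const 2).aestronglyMeasurable fun o => by
          rw [abs_of_nonneg (sq_nonneg _), ← sq_abs]
          exact pow_le_one₀ (abs_nonneg _) (hb h.e_mem h'.e_mem _)
    filter_upwards [(integral_eq_zero_iff_of_nonneg (fun o => sq_nonneg _) i2).1 h2] with o ho
    simp only [Pi.zero_apply, ne_eq, OfNat.ofNat_ne_zero, not_false_eq_true, pow_eq_zero_iff] at ho
    linarith
  have hr : ∀ᵐ o ∂q, A o * (r (x o) - r' (x o)) = 0 := by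
    have h1 := h.integral_label (fun u => r u - r' u) (fun _ => 1) (mr.sub mr')
      ⟨1, hb h.r_mem h'.r_mem⟩ measurable_const ⟨1, by simp⟩
    rw [h'.integral_label (fun u => r u - r' u) (fun _ => 1) (mr.sub mr')
      ⟨1, hb h.r_mem h'.r_mem⟩ measurable_const ⟨1, by simp⟩] at h1
    simp only [mul_one] at h1
    have i1 : ∀ {f : 𝒳 → ℝ}, Measurable f → (∀ u, f u ∈ Set.Icc ε 1) →
        Integrable (fun o => (r (x o) - r' (x o)) * (A o * f (x o))) q := fun hf hf' =>
      integrable_mul_of_bounded ((mr.sub mr').comp hx) (fun o => hb h.r_mem h'.r_mem _)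
        (integrable_mul_of_bounded hA hA1 (integrable_of_abs_le (integrable_const 1)
          (hf.comp hx).aestronglyMeasurable fun o => hb1 hf' _))
    have h2 : ∫ o, (A o * (r (x o) - r' (x o))) ^ 2 ∂q = 0 := by
      have : ∀ o, (A o * (r (x o) - r' (x o))) ^ 2
          = (r (x o) - r' (x o)) * (A o * r (x o)) - (r (x o) - r' (x o)) * (A o * r' (x o)) := by
        intro o
        rcases hA01 o with h | h
        · simp [h]
        · rw [h]; ring
      simp only [this]
      rw [integral_sub (i1 mr h.r_mem) (i1 mr' h'.r_mem), h1, sub_self]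
    have i2 : Integrable (fun o => (A o * (r (x o) - r' (x o))) ^ 2) q :=
      integrable_of_abs_le (integrable_const 1)
        ((hA.mul ((mr.sub mr').comp hx)).pow_const 2).aestronglyMeasurable fun o => by
          rw [abs_of_nonneg (sq_nonneg _), ← sq_abs, abs_mul]
          exact pow_le_one₀ (by positivity)
            (mul_le_one₀ (hA1 o) (abs_nonneg _) (hb h.r_mem h'.r_mem _))
    filter_upwards [(integral_eq_zero_iff_of_nonneg (fun o => sq_nonneg _) i2).1 h2] with o ho
    simpa only [Pi.zero_apply, ne_eq, OfNat.ofNat_ne_zero, not_false_eq_true, pow_eq_zero_iff]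
      using ho
  refine integral_congr_ae ?_
  filter_upwards [he, hr] with o h1 h2
  rcases hA01 o with h3 | h3
  · simp [h3]
  · rw [h3, one_mul, sub_eq_zero] at h2
    rw [h1, h2]

theorem memLp_armInfluence {q : Measure O} [IsFiniteMeasure q] {x : O → 𝒳} {A L N y : O → ℝ}
    {e r : 𝒳 → ℝ} (hε : 0 < ε) (hx : Measurable x) (hA : Measurable A) (hL : Measurable L)
    (hA1 : ∀ o, |A o| ≤ 1) (hL1 : ∀ o, |L o| ≤ 1)
    (he : Measurable e) (hr : Measurable r) (he_mem : ∀ u, e u ∈ Set.Icc ε 1)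
    (hr_mem : ∀ u, r u ∈ Set.Icc ε 1) (hμ2 : MemLp (fun o => μ (x o)) 2 q) (hN2 : MemLp N 2 q)
    (hy2 : MemLp y 2 q) : MemLp (armInfluence x A L N y e r μ) 2 q := by
  have hepos : ∀ u, 0 < e u := fun u => hε.trans_le (he_mem u).1
  have hrpos : ∀ u, 0 < r u := fun u => hε.trans_le (hr_mem u).1
  have b1 : ∀ o, ‖A o / e (x o)‖ ≤ ε⁻¹ := by
    intro o
    rw [Real.norm_eq_abs, div_eq_mul_inv, abs_mul, abs_of_pos (inv_pos.2 (hepos _))]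
    exact (mul_le_of_le_one_left (inv_pos.2 (hepos _)).le (hA1 o)).trans
      (inv_anti₀ hε (he_mem _).1)
  have b2 : ∀ o, ‖A o * L o / (e (x o) * r (x o))‖ ≤ (ε * ε)⁻¹ := by
    intro o
    have hpos : 0 < e (x o) * r (x o) := mul_pos (hepos _) (hrpos _)
    rw [Real.norm_eq_abs, div_eq_mul_inv, abs_mul, abs_of_pos (inv_pos.2 hpos)]
    refine (mul_le_of_le_one_left (inv_pos.2 hpos).le ?_).trans (inv_anti₀ (by positivity)
      (mul_le_mul (he_mem _).1 (hr_mem _).1 hε.le (hepos _).le))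
    rw [abs_mul]; exact mul_le_one₀ (hA1 o) (abs_nonneg _) (hL1 o)
  have m1 : AEStronglyMeasurable (fun o => A o / e (x o)) q :=
    (hA.div (he.comp hx)).aestronglyMeasurable
  have m2 : AEStronglyMeasurable (fun o => A o * L o / (e (x o) * r (x o))) q :=
    ((hA.mul hL).div ((he.comp hx).mul (hr.comp hx))).aestronglyMeasurable
  have l1 : MemLp (fun o => A o / e (x o) * (N o - μ (x o))) 2 q :=
    (hN2.sub hμ2).mul (memLp_top_of_bound m1 _ (ae_of_all _ b1))
  have l2 : MemLp (fun o => A o * L o / (e (x o) * r (x o)) * (y o - N o)) 2 q :=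
    (hy2.sub hN2).mul (memLp_top_of_bound m2 _ (ae_of_all _ b2))
  exact (hμ2.add l1).add l2

end Scheme

/-! ### The pathwise derivative of the average treatment effect -/

section PathwiseDerivative

variable {𝒳 𝒮 𝒰 O : Type*}

theorem ind_arm_mul_eq_of_surrogate {a : Bool} (w : FullData 𝒳 𝒮) (f : 𝒮 → ℝ) :
    ind (T w == a) * f (S w) = ind (T w == a) * f (Spot a w) :=
  ind_arm_mul_eq w fun s _ => f s

theorem sq_Y_le (w : FullData 𝒳 𝒮) : Y w ^ 2 ≤ Ypot true w ^ 2 + Ypot false w ^ 2 := by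
  simp only [Y]
  cases T w
  · linarith [sq_nonneg (Ypot true w)]
  · linarith [sq_nonneg (Ypot false w)]

variable [MeasurableSpace 𝒳] [MeasurableSpace 𝒮] [MeasurableSpace 𝒰]
  [MeasurableSpace O] {obs : FullData 𝒳 𝒮 → O} {full : Bool} {U : 𝒳 × 𝒮 → 𝒰} {ε : ℝ}
  {Q : Measure (FullData 𝒳 𝒮)} {a : Bool} {ea ra : 𝒳 → ℝ} {μ : 𝒳 → ℝ} {M : 𝒰 → ℝ}

/-- Identification: the mean of the potential outcome is a functional of the observed law. -/
theorem Scheme.integral_outcome (s : Scheme obs full U) (hε : 0 < ε) (h : IsArmLaw ε Q a ea ra) :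
    ∫ o, ind (s.treat o == a) * ind (s.label o) * s.outcome o
        / (ea (s.proj (s.reg o)) * schemeProb full ra (s.proj (s.reg o))) ∂Q.map obs
      = ∫ w, Ypot a w ∂Q := by
  have m1 : Measurable fun o => ind (s.treat o == a) :=
      (measurable_ind_eq a).comp s.measurable_treat
  have m2 : Measurable fun o => ind (s.label o) := measurable_ind.comp s.measurable_label
  have m3 : Measurable fun o => s.proj (s.reg o) := s.measurable_proj.comp s.measurable_reg
  have m4 := h.measurable_e
  have m5 := h.measurable_schemeProb (full := full)
  have m6 : Measurable fun o => ind (s.treat o == a) * ind (s.label o) * s.outcome o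
      / (ea (s.proj (s.reg o)) * schemeProb full ra (s.proj (s.reg o))) :=
    ((m1.mul m2).mul s.measurable_outcome).div ((m4.comp m3).mul (m5.comp m3))
  rw [integral_map s.measurable_obs.aemeasurable m6.aestronglyMeasurable]
  simp only [s.treat_eq, s.label_eq, s.outcome_eq, s.reg_eq, s.proj_eq]
  have h1 := h.integral_scheme (full := full)
    (φ := fun z => z.2.2 / (ea z.1 * schemeProb full ra z.1)) (by fun_prop)
  refine Eq.trans ?_ (h1.trans ?_)
  · refine integral_congr_ae (ae_of_all _ fun w => ?_)
    simp only [Y]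
    by_cases hT : T w = a
    · cases R w || full <;> simp [hT, ind]
    · have : (T w == a) = false := by simpa using hT
      simp [this, ind]
  · refine integral_congr_ae (ae_of_all _ fun w => ?_)
    have h1 := (hε.trans_le (h.e_mem (X w)).1).ne'
    have h2 := (hε.trans_le (h.schemeProb_mem (full := full) (X w)).1).ne'
    simp only
    field_simp

/-- Selection into the labelled arm has a conditional probability that is a function of x, hence of
the regressor. It only changes the bounded test function. -/
theorem IsArmMean.integral_labelled_eq_zero {𝒱 : Type*} [MeasurableSpace 𝒱] {V : 𝒳 × 𝒮 → 𝒱}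
    {p : 𝒱 → 𝒳} {m : 𝒱 → ℝ} (hm : IsArmMean Q a V m) (hV : Measurable V) (hp : Measurable p)
    (hpV : ∀ z, p (V z) = z.1) (h : IsArmLaw ε Q a ea ra) (hε : 0 < ε) {φ : 𝒱 → ℝ}
    (hφ : Measurable φ)
    (hC : ∃ C, ∀ u, |φ u| ≤ C) :
    ∫ w, ind (T w == a) * ind (R w || full)
      * (φ (V (X w, Spot a w)) * (Ypot a w - m (V (X w, Spot a w)))) ∂Q = 0 := by
  obtain ⟨C, hC⟩ := hC
  have m1 := h.measurable_e
  have m2 := h.measurable_schemeProb (full := full)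
  have m3 := hm.measurable_mean
  rw [h.integral_scheme (full := full)
    (φ := fun z => φ (V (z.1, z.2.1)) * (z.2.2 - m (V (z.1, z.2.1)))) (by fun_prop)]
  have h1 := hm.integral_eq_zero (fun u => ea (p u) * schemeProb full ra (p u) * φ u)
    (((m1.comp hp).mul (m2.comp hp)).mul hφ) ⟨C, fun u => by
      have b1 := h.e_mem (p u)
      have b2 := h.schemeProb_mem (full := full) (p u)
      have b3 : 0 ≤ ea (p u) * schemeProb full ra (p u) :=
        mul_nonneg (hε.le.trans b1.1) (hε.le.trans b2.1)
      rw [abs_mul, abs_of_nonneg b3]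
      exact (mul_le_of_le_one_left (abs_nonneg _)
        (mul_le_one₀ b1.2 (hε.le.trans b2.1) b2.2)).trans (hC u)⟩
  rw [← h1]
  refine integral_congr_ae (ae_of_all _ fun w => ?_)
  simp only [hpV]
  ring

theorem IsArmMean.memLp_arm {𝒱 : Type*} [MeasurableSpace 𝒱] {V : 𝒳 × 𝒮 → 𝒱} {m : 𝒱 → ℝ}
    (hm : IsArmMean Q a V m) (hV : Measurable V) :
    MemLp (fun w => ind (T w == a) * m (V (X w, S w))) 2 Q := by
  have m1 : Measurable fun w : FullData 𝒳 𝒮 => ind (T w == a) * m (V (X w, S w)) :=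
    ((measurable_ind_eq a).comp measurable_T).mul
      (hm.measurable_mean.comp (hV.comp (measurable_X.prodMk measurable_S)))
  refine hm.memLp.mono m1.aestronglyMeasurable (ae_of_all _ fun w => ?_)
  rw [ind_arm_mul_eq_of_surrogate w fun s => m (V (X w, s)), norm_mul]
  refine mul_le_of_le_one_left (norm_nonneg _) ?_
  rcases ind_eq_zero_or_one (T w == a) with h | h <;> simp [h]

theorem memLp_Y (h : ∀ a, MemLp (Ypot a) 2 Q) : MemLp Y 2 Q := by
  refine (memLp_two_iff_integrable_sq measurable_Y.aestronglyMeasurable).2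
    (integrable_of_abs_le ((h true).integrable_sq.add (h false).integrable_sq)
      (measurable_Y.pow_const 2).aestronglyMeasurable fun w => ?_)
  rw [abs_of_nonneg (sq_nonneg _)]
  exact sq_Y_le w

theorem memLp_armPsi [IsFiniteMeasure Q] (hε : 0 < ε) (h : IsArmLaw ε Q a ea ra)
    (hY : ∀ a, MemLp (Ypot a) 2 Q) (hU : Measurable U) (hμ : IsArmMean Q a Prod.fst μ)
    (hM : IsArmMean Q a U M) : MemLp (armPsi full U a ea ra μ M) 2 Q := by
  have hb : ∀ b, |ind b| ≤ 1 := fun b => by cases b <;> simp [ind]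
  exact memLp_armInfluence hε measurable_X ((measurable_ind_eq a).comp measurable_T)
    (measurable_ind.comp ((measurable_of_finite fun b => (b || full)).comp measurable_R))
    (fun _ => hb _) (fun _ => hb _) h.measurable_e h.measurable_schemeProb h.e_mem
    h.schemeProb_mem hμ.memLp (hM.memLp_arm hU) (memLp_Y hY)

/-- The efficient influence function of the average treatment effect for an observation scheme. -/
noncomputable def schemePsi (full : Bool) (U : 𝒳 × 𝒮 → 𝒰) (e r μ : Bool → 𝒳 → ℝ)
    (M : Bool → 𝒰 → ℝ) (δ : ℝ) (w : FullData 𝒳 𝒮) : ℝ :=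
  armPsi full U true (e true) (r true) (μ true) (M true) w
    - armPsi full U false (e false) (r false) (μ false) (M false) w - δ

theorem memLp_schemePsi {e r μ : Bool → 𝒳 → ℝ} {M : Bool → 𝒰 → ℝ} [IsFiniteMeasure Q] (hε : 0 < ε)
    (h : ∀ a, IsArmLaw ε Q a (e a) (r a)) (hY : ∀ a, MemLp (Ypot a) 2 Q) (hU : Measurable U)
    (hμ : ∀ a, IsArmMean Q a Prod.fst (μ a)) (hM : ∀ a, IsArmMean Q a U (M a)) (δ : ℝ) :
    MemLp (schemePsi full U e r μ M δ) 2 Q :=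
  ((memLp_armPsi hε (h true) hY hU (hμ true) (hM true)).sub
    (memLp_armPsi hε (h false) hY hU (hμ false) (hM false))).sub (memLp_const δ)

variable [StandardBorelSpace 𝒳] [StandardBorelSpace 𝒮] {P : ProbabilityMeasure (FullData 𝒳 𝒮)}
  {𝓜 : Set (ProbabilityMeasure (FullData 𝒳 𝒮))} {D : ℝ → ProbabilityMeasure (FullData 𝒳 𝒮)}
  {g : O → ℝ}

/-- Every law of the submodel satisfies the assumptions, so each has its own scores and inverse
weighting identifies its arm mean. This reduces the claim to `IsQMD.hasDerivAt_of_isWeighting` for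
the observed laws. -/
theorem IsRegularSubmodel.hasDerivAt_arm (hD : IsRegularSubmodel 𝓜 obs P D g)
    (h𝓜 : ∀ Q ∈ 𝓜, Assumptions ε Q) (hε₀ : 0 < ε) (hε₁ : ε < 1 / 2) (s : Scheme obs full U)
    (h : IsArmLaw ε (P : Measure (FullData 𝒳 𝒮)) a ea ra)
    (hμ : IsArmMean (P : Measure (FullData 𝒳 𝒮)) a Prod.fst μ)
    (hM : IsArmMean (P : Measure (FullData 𝒳 𝒮)) a U M) :
    HasDerivAt (fun t => ∫ w, Ypot a w ∂(D t : Measure (FullData 𝒳 𝒮)))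
      (∫ w, armPsi full U a ea ra μ M w * g (obs w) ∂(P : Measure (FullData 𝒳 𝒮))) 0 := by
  choose e r her using fun t => (h𝓜 _ (hD.mem t)).exists_isArmLaw hε₀ hε₁
  have hobs := s.measurable_obs
  have hD0 := hD.obs_zero
  let x : O → 𝒳 := fun o => s.proj (s.reg o)
  let A : O → ℝ := fun o => ind (s.treat o == a)
  let L : O → ℝ := fun o => ind (s.label o)
  let N : O → ℝ := fun o => ind (s.treat o == a) * M (s.reg o)
  -- At parameter 0 the full law need not be P, so the scores chosen for it are replaced by those of
  -- P. Both describe the same observed law.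
  let e' : ℝ → 𝒳 → ℝ := fun t => if t = 0 then ea else e t a
  let r' : ℝ → 𝒳 → ℝ := fun t => schemeProb full (if t = 0 then ra else r t a)
  have mA : Measurable A := (measurable_ind_eq a).comp s.measurable_treat
  have mL : Measurable L := measurable_ind.comp s.measurable_label
  have mx : Measurable x := s.measurable_proj.comp s.measurable_reg
  have mN : Measurable N := mA.mul (hM.measurable_mean.comp s.measurable_reg)
  have mμ := hμ.measurable_mean
  have hA01 : ∀ o, A o = 0 ∨ A o = 1 := fun o => ind_eq_zero_or_one _
  have hL01 : ∀ o, L o = 0 ∨ L o = 1 := fun o => ind_eq_zero_or_one _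
  have hpt : ∀ t, IsProbabilityMeasure ((D t : Measure (FullData 𝒳 𝒮)).map obs) := fun t =>
    Measure.isProbabilityMeasure_map hobs.aemeasurable
  have hw : ∀ t, IsWeighting ε x A L N (e' t) (r' t) ((D t : Measure (FullData 𝒳 𝒮)).map obs) := by
    intro t
    by_cases ht : t = 0
    · subst ht
      simp only [e', r', if_true, hD0]
      exact s.isWeighting h hM.measurable_mean
    · simp only [e', r', ht, if_false]
      exact s.isWeighting (her t a) hM.measurable_mean
  have hθ : ∀ t, ∫ w, Ypot a w ∂(D t : Measure (FullData 𝒳 𝒮))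
      = ∫ o, A o * L o * s.outcome o / (e' t (x o) * r' t (x o))
        ∂(D t : Measure (FullData 𝒳 𝒮)).map obs := by
    intro t
    rw [← s.integral_outcome hε₀ (her t a)]
    exact IsWeighting.integral_eq_of_isWeighting hε₀ mx mA hA01
      (s.isWeighting (her t a) hM.measurable_mean) (hw t)
  have hyY : ∀ w, s.outcome (obs w) ^ 2 ≤ Ypot true w ^ 2 + Ypot false w ^ 2 := by
    intro w
    refine le_trans ?_ (sq_Y_le w)
    rw [s.outcome_eq]
    rcases ind_eq_zero_or_one (R w || full) with h | h <;> simp [h, sq_nonneg]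
  have hsum : ∀ t, Integrable (fun w => Ypot true w ^ 2 + Ypot false w ^ 2)
      (D t : Measure (FullData 𝒳 𝒮)) := fun t =>
    ((h𝓜 _ (hD.mem t)).memLp true).integrable_sq.add ((h𝓜 _ (hD.mem t)).memLp false).integrable_sq
  have my2 : Measurable fun o => s.outcome o ^ 2 := s.measurable_outcome.pow_const 2
  have hyi' : ∀ t, Integrable (fun w => s.outcome (obs w) ^ 2) (D t : Measure (FullData 𝒳 𝒮)) :=
    fun t => integrable_of_abs_le (hsum t) (my2.comp hobs).aestronglyMeasurable fun w => by
      rw [abs_of_nonneg (sq_nonneg _)]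
      exact hyY w
  have hyi : ∀ t, Integrable (fun o => s.outcome o ^ 2) ((D t : Measure (FullData 𝒳 𝒮)).map obs) :=
    fun t => (integrable_map_measure my2.aestronglyMeasurable hobs.aemeasurable).2 (hyi' t)
  obtain ⟨C, hC⟩ := hD.moment
  have hyK : ∀ t, ∫ o, s.outcome o ^ 2 ∂(D t : Measure (FullData 𝒳 𝒮)).map obs ≤ C + C := by
    intro t
    rw [integral_map hobs.aemeasurable my2.aestronglyMeasurable]
    refine (integral_mono (hyi' t) (hsum t) hyY).trans ?_
    rw [integral_add ((h𝓜 _ (hD.mem t)).memLp true).integrable_sq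
      ((h𝓜 _ (hD.mem t)).memLp false).integrable_sq]
    exact add_le_add (hC t true) (hC t false)
  have hμ2 : MemLp (fun o => μ (x o)) 2 ((D 0 : Measure (FullData 𝒳 𝒮)).map obs) := by
    have m1 : Measurable fun o => μ (x o) := mμ.comp mx
    rw [hD0, memLp_map_measure_iff m1.aestronglyMeasurable hobs.aemeasurable]
    refine hμ.memLp.ae_eq (ae_of_all _ fun w => ?_)
    simp [x, s.reg_eq, s.proj_eq]
  have hN2 : MemLp N 2 ((D 0 : Measure (FullData 𝒳 𝒮)).map obs) := by
    rw [hD0, memLp_map_measure_iff mN.aestronglyMeasurable hobs.aemeasurable]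
    refine (hM.memLp_arm s.measurable_U).ae_eq (ae_of_all _ fun w => ?_)
    simp [N, s.reg_eq, s.treat_eq]
  have hμ0 : ∀ φ : 𝒳 → ℝ, Measurable φ → (∃ C, ∀ u, |φ u| ≤ C) →
      ∫ o, φ (x o) * (A o * L o * (s.outcome o - μ (x o)))
        ∂(D 0 : Measure (FullData 𝒳 𝒮)).map obs = 0 := by
    intro φ hφ hφC
    have m1 : Measurable fun o => φ (x o) * (A o * L o * (s.outcome o - μ (x o))) :=
      (hφ.comp mx).mul ((mA.mul mL).mul (s.measurable_outcome.sub (mμ.comp mx)))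
    rw [hD0, integral_map hobs.aemeasurable m1.aestronglyMeasurable,
      ← hμ.integral_labelled_eq_zero (full := full) measurable_fst measurable_id (fun _ => rfl) h
        hε₀ hφ hφC]
    refine integral_congr_ae (ae_of_all _ fun w => ?_)
    simp only [A, L, x, s.treat_eq, s.label_eq, s.reg_eq, s.proj_eq, s.outcome_eq, Y]
    by_cases hT : T w = a
    · cases R w || full <;> simp [hT, ind]
    · have : (T w == a) = false := by simpa using hT
      simp [this, ind]
  have hN0 : ∀ φ : 𝒳 → ℝ, Measurable φ → (∃ C, ∀ u, |φ u| ≤ C) →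
      ∫ o, φ (x o) * (A o * L o * (s.outcome o - N o))
        ∂(D 0 : Measure (FullData 𝒳 𝒮)).map obs = 0 := by
    rintro φ hφ ⟨C, hφC⟩
    have m1 : Measurable fun o => φ (x o) * (A o * L o * (s.outcome o - N o)) :=
      (hφ.comp mx).mul ((mA.mul mL).mul (s.measurable_outcome.sub mN))
    rw [hD0, integral_map hobs.aemeasurable m1.aestronglyMeasurable,
      ← hM.integral_labelled_eq_zero (full := full) s.measurable_U s.measurable_proj s.proj_eq h
        hε₀ (hφ.comp s.measurable_proj) ⟨C, fun u => hφC _⟩]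
    refine integral_congr_ae (ae_of_all _ fun w => ?_)
    simp only [A, L, x, N, s.treat_eq, s.label_eq, s.reg_eq, s.proj_eq, s.outcome_eq, Y, S,
      Function.comp]
    by_cases hT : T w = a
    · cases R w || full <;> simp [hT, ind]
    · have : (T w == a) = false := by simpa using hT
      simp [this, ind]
  have key := IsQMD.hasDerivAt_of_isWeighting hD.qmd hε₀ mx mA mL mN s.measurable_outcome hA01 hL01
    hw hθ hyi hyK mμ hμ2 hN2 hμ0 hN0
  have m1 : Measurable (e' 0) := (hw 0).measurable_e
  have m2 : Measurable (r' 0) := (hw 0).measurable_r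
  have m3 : Measurable (armInfluence x A L N s.outcome (e' 0) (r' 0) μ) := by
    have mo := s.measurable_outcome
    unfold armInfluence
    fun_prop
  have hgm : AEStronglyMeasurable g ((P : Measure (FullData 𝒳 𝒮)).map obs) := by
    rw [← hD0]
    exact hD.qmd.1.1
  convert key using 1
  have m4 : AEStronglyMeasurable
      (fun o => armInfluence x A L N s.outcome (e' 0) (r' 0) μ o * g o)
      ((P : Measure (FullData 𝒳 𝒮)).map obs) := m3.aestronglyMeasurable.mul hgm
  rw [hD0, integral_map hobs.aemeasurable m4]
  refine integral_congr_ae (ae_of_all _ fun w => ?_)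
  simp only [armPsi, armInfluence, x, A, L, N, e', r', if_true, s.treat_eq,
    s.label_eq, s.reg_eq, s.proj_eq, s.outcome_eq]
  rcases ind_eq_zero_or_one (R w || full) with h0 | h0 <;> simp [h0]

/-- The centring constant δ is immaterial because scores have mean zero. -/
theorem IsRegularSubmodel.hasDerivAt_ate (hD : IsRegularSubmodel 𝓜 obs P D g)
    (h𝓜 : ∀ Q ∈ 𝓜, Assumptions ε Q) (hε₀ : 0 < ε) (hε₁ : ε < 1 / 2) (s : Scheme obs full U)
    (hP : ∀ a, MemLp (Ypot a) 2 (P : Measure (FullData 𝒳 𝒮))) {e r μ : Bool → 𝒳 → ℝ}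
    {M : Bool → 𝒰 → ℝ} (h : ∀ a, IsArmLaw ε (P : Measure (FullData 𝒳 𝒮)) a (e a) (r a))
    (hμ : ∀ a, IsArmMean (P : Measure (FullData 𝒳 𝒮)) a Prod.fst (μ a))
    (hM : ∀ a, IsArmMean (P : Measure (FullData 𝒳 𝒮)) a U (M a)) (δ : ℝ) :
    HasDerivAt (fun t => ate (D t))
      (∫ w, schemePsi full U e r μ M δ w * g (obs w) ∂(P : Measure (FullData 𝒳 𝒮))) 0 := by
  have hobs := s.measurable_obs
  have hpt : ∀ t, IsProbabilityMeasure ((D t : Measure (FullData 𝒳 𝒮)).map obs) := fun t =>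
    Measure.isProbabilityMeasure_map hobs.aemeasurable
  have hg : MemLp g 2 ((P : Measure (FullData 𝒳 𝒮)).map obs) := hD.obs_zero ▸ hD.qmd.1
  have hg2 : MemLp (fun w => g (obs w)) 2 (P : Measure (FullData 𝒳 𝒮)) :=
    (memLp_map_measure_iff hg.1 hobs.aemeasurable).1 hg
  have hg0 : ∫ w, g (obs w) ∂(P : Measure (FullData 𝒳 𝒮)) = 0 := by
    rw [← integral_map hobs.aemeasurable hg.1, ← hD.obs_zero]
    exact IsQMD.integral_score_eq_zero hD.qmd
  have hi : ∀ a, Integrable (fun w => armPsi full U a (e a) (r a) (μ a) (M a) w * g (obs w))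
      (P : Measure (FullData 𝒳 𝒮)) := fun a =>
    (memLp_armPsi hε₀ (h a) hP s.measurable_U (hμ a) (hM a)).integrable_mul hg2
  have hd := (hD.hasDerivAt_arm h𝓜 hε₀ hε₁ s (h true) (hμ true) (hM true)).sub
    (hD.hasDerivAt_arm h𝓜 hε₀ hε₁ s (h false) (hμ false) (hM false))
  refine hd.congr_deriv ?_
  have hi3 : Integrable (fun w => armPsi full U true (e true) (r true) (μ true) (M true) w
      * g (obs w) - armPsi full U false (e false) (r false) (μ false) (M false) w * g (obs w))
      (P : Measure (FullData 𝒳 𝒮)) := (hi true).sub (hi false)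
  have he : ∀ w, schemePsi full U e r μ M δ w * g (obs w)
      = armPsi full U true (e true) (r true) (μ true) (M true) w * g (obs w)
        - armPsi full U false (e false) (r false) (μ false) (M false) w * g (obs w)
        - δ * g (obs w) := fun w => by simp only [schemePsi]; ring
  simp only [he]
  rw [integral_sub hi3 ((hg2.integrable one_le_two).const_mul δ), integral_sub (hi true) (hi false),
    integral_const_mul, hg0, mul_zero, sub_zero]

end PathwiseDerivative

/-! ### From a gradient in the closure of the scores to efficiency -/

section Efficiency

theorem inner_toLp_toLp {F : Type*} [MeasurableSpace F] {m : Measure F} {f g : F → ℝ}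
    (hf : MemLp f 2 m) (hg : MemLp g 2 m) :
    inner ℝ (hf.toLp f) (hg.toLp g) = ∫ w, f w * g w ∂m := by
  rw [L2.inner_def]
  refine integral_congr_ae ?_
  filter_upwards [hf.coeFn_toLp, hg.coeFn_toLp] with w h1 h2
  rw [h1, h2]
  simp [mul_comm]

theorem norm_toLp_sq {F : Type*} [MeasurableSpace F] {m : Measure F} {f : F → ℝ}
    (hf : MemLp f 2 m) : ‖hf.toLp f‖ ^ 2 = ∫ w, f w ^ 2 ∂m := by
  rw [← real_inner_self_eq_norm_sq, inner_toLp_toLp]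
  simp only [sq]

variable {𝒳 𝒮 O : Type*} [MeasurableSpace 𝒳] [MeasurableSpace 𝒮] [MeasurableSpace O]
  {𝓜 : Set (ProbabilityMeasure (FullData 𝒳 𝒮))} {obs : FullData 𝒳 𝒮 → O}
  {θ : ProbabilityMeasure (FullData 𝒳 𝒮) → ℝ} {P : ProbabilityMeasure (FullData 𝒳 𝒮)}
  {D : ℝ → ProbabilityMeasure (FullData 𝒳 𝒮)} {g : O → ℝ} {ψ ψ' : FullData 𝒳 𝒮 → ℝ}

theorem IsRegularSubmodel.memLp_score (h : IsRegularSubmodel 𝓜 obs P D g) (hobs : Measurable obs) :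
    MemLp (fun w => g (obs w)) 2 (P : Measure (FullData 𝒳 𝒮)) := by
  have hg : MemLp g 2 ((P : Measure (FullData 𝒳 𝒮)).map obs) := h.obs_zero ▸ h.qmd.1
  exact (memLp_map_measure_iff hg.1 hobs.aemeasurable).1 hg

/-- An influence function that is a limit of scores is efficient. -/
theorem isEfficient_of_tendsto (hobs : Measurable obs)
    (hψ : MemLp ψ 2 (P : Measure (FullData 𝒳 𝒮)))
    (hder : ∀ D g, IsRegularSubmodel 𝓜 obs P D g → HasDerivAt (fun t => θ (D t))
      (∫ w, ψ w * g (obs w) ∂(P : Measure (FullData 𝒳 𝒮))) 0)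
    {D : ℕ → ℝ → ProbabilityMeasure (FullData 𝒳 𝒮)} {g : ℕ → O → ℝ}
    (hD : ∀ n, IsRegularSubmodel 𝓜 obs P (D n) (g n))
    (hlim : Tendsto (fun n => ∫ w, (ψ w - g n (obs w)) ^ 2 ∂(P : Measure (FullData 𝒳 𝒮))) atTop
      (𝓝 0)) :
    IsEfficient 𝓜 obs θ P ψ := by
  have hg := fun n => (hD n).memLp_score hobs
  have hconv : Tendsto (fun n => (hg n).toLp _) atTop (𝓝 (hψ.toLp ψ)) := by
    rw [tendsto_iff_norm_sub_tendsto_zero]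
    have h1 : ∀ n, ‖(hg n).toLp _ - hψ.toLp ψ‖
        = √(∫ w, (ψ w - g n (obs w)) ^ 2 ∂(P : Measure (FullData 𝒳 𝒮))) := by
      intro n
      rw [norm_sub_rev, ← MemLp.toLp_sub, ← Real.sqrt_sq (norm_nonneg _), norm_toLp_sq]
      rfl
    simp only [h1]
    simpa using hlim.sqrt
  refine ⟨⟨hder, hψ, ?_⟩, le_antisymm (sSup_le ?_) ?_⟩
  · refine mem_closure_of_tendsto hconv (Eventually.of_forall fun n => Submodule.subset_span ?_)
    exact ⟨D n, g n, hD n, (hg n).coeFn_toLp⟩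
  -- Each Cramér–Rao bound is ⟨ψ, g⟩² / ‖g‖², at most ‖ψ‖² by Cauchy–Schwarz.
  · rintro c ⟨D', g', d, hD', hd, rfl⟩
    have hg' := hD'.memLp_score hobs
    rw [hd.unique (hder D' g' hD'), ← inner_toLp_toLp hψ hg', ← norm_toLp_sq hψ,
      ← norm_toLp_sq hg']
    refine ENNReal.div_le_of_le_mul ?_
    rw [← ENNReal.ofReal_mul (sq_nonneg _), ← mul_pow, ← sq_abs (inner ℝ _ _)]
    exact ENNReal.ofReal_le_ofReal (pow_le_pow_left₀ (abs_nonneg _) (abs_real_inner_le_norm _ _) 2)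
  -- Along the approximating submodels the Cramér–Rao bounds tend to ‖ψ‖⁴ / ‖ψ‖²; the case ψ = 0 is
  -- trivial.
  · rw [← norm_toLp_sq hψ]
    by_cases h0 : ‖hψ.toLp ψ‖ = 0
    · simp [h0]
    have hpos : 0 < ‖hψ.toLp ψ‖ ^ 2 := by positivity
    have hpos' : ENNReal.ofReal (‖hψ.toLp ψ‖ ^ 2) ≠ 0 := (ENNReal.ofReal_pos.2 hpos).ne'
    have h1 : Tendsto (fun n => ENNReal.ofReal (inner ℝ (hψ.toLp ψ) ((hg n).toLp _) ^ 2)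
        / ENNReal.ofReal (‖(hg n).toLp _‖ ^ 2)) atTop
        (𝓝 (ENNReal.ofReal (inner ℝ (hψ.toLp ψ) (hψ.toLp ψ) ^ 2)
          / ENNReal.ofReal (‖hψ.toLp ψ‖ ^ 2))) :=
      ENNReal.Tendsto.div (ENNReal.tendsto_ofReal ((tendsto_const_nhds.inner hconv).pow 2))
        (Or.inr hpos') (ENNReal.tendsto_ofReal (hconv.norm.pow 2))
        (Or.inr ENNReal.ofReal_ne_top)
    rw [real_inner_self_eq_norm_sq, sq (‖hψ.toLp ψ‖ ^ 2), ENNReal.ofReal_mul hpos.le,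
      ENNReal.mul_div_cancel_right hpos' ENNReal.ofReal_ne_top] at h1
    refine le_of_tendsto h1 (Eventually.of_forall fun n => le_sSup ?_)
    refine ⟨D n, g n, _, hD n, hder _ _ (hD n), ?_⟩
    rw [inner_toLp_toLp, norm_toLp_sq]

theorem IsEfficient.congr (h : IsEfficient 𝓜 obs θ P ψ)
    (he : ψ =ᵐ[(P : Measure (FullData 𝒳 𝒮))] ψ') : IsEfficient 𝓜 obs θ P ψ' := by
  obtain ⟨⟨h1, h2, h3⟩, h4⟩ := h
  refine ⟨⟨fun D g hD => ?_, h2.ae_eq he, ?_⟩, h4.trans ?_⟩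
  · rw [← integral_congr_ae (he.mono fun w hw => by simp only [hw] :
      (fun w => ψ w * g (obs w)) =ᵐ[(P : Measure (FullData 𝒳 𝒮))] fun w => ψ' w * g (obs w))]
    exact h1 D g hD
  · rwa [MemLp.toLp_congr (h2.ae_eq he) h2 he.symm]
  · rw [integral_congr_ae (he.mono fun w hw => by simp only [hw] :
      (fun w => ψ w ^ 2) =ᵐ[(P : Measure (FullData 𝒳 𝒮))] fun w => ψ' w ^ 2)]

end Efficiency

/-! ### Bounded changes of density are differentiable in quadratic mean -/

section BoundedTilt

variable {O : Type*} [MeasurableSpace O]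

/-- With s = √(1 + x) the left side is (s − 1)²/2, while x² = (s − 1)²(s + 1)² and s + 1 ≥ 1. -/
theorem abs_sqrt_one_add_sub_le {x : ℝ} (hx : -1 ≤ x) : |√(1 + x) - 1 - x / 2| ≤ x ^ 2 / 2 := by
  set s := √(1 + x) with hs
  have h0 : 0 ≤ s := Real.sqrt_nonneg _
  have h1 : s ^ 2 = 1 + x := Real.sq_sqrt (by linarith)
  have hx' : x = s ^ 2 - 1 := by linarith
  rw [hx', abs_le]
  constructor <;> nlinarith [sq_nonneg (s - 1), mul_nonneg h0 (sq_nonneg (s - 1)),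
      sq_nonneg (s + 1)]

/-- The law `q` with density `1 + τ g`, where `τ = t` for small `t`, is differentiable in quadratic
mean with score `g`. -/
theorem isQMD_of_withDensity {p : ℝ → Measure O} {q : Measure O} [IsProbabilityMeasure q] {g : O →
    ℝ}
    (hg : Measurable g) {C : ℝ} (hC : ∀ o, |g o| ≤ C) {τ : ℝ → ℝ} (hτ : ∀ t, |τ t| * C ≤ 1)
    (hτ0 : τ 0 = 0) (hτt : ∀ᶠ t in 𝓝 0, τ t = t)
    (hp : ∀ t, p t = q.withDensity fun o => ENNReal.ofReal (1 + τ t * g o)) : IsQMD p g := by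
  have hp0 : p 0 = q := by simp [hp, hτ0]
  refine ⟨?_, q, inferInstance, fun t => ?_, ?_⟩
  · rw [hp0]
    exact MemLp.of_bound hg.aestronglyMeasurable C (ae_of_all _ hC)
  · rw [hp]; exact withDensity_absolutelyContinuous _ _
  have hge : ∀ t o, -1 ≤ τ t * g o := fun t o => by
    have : |τ t * g o| ≤ 1 := by
      rw [abs_mul]
      exact (mul_le_mul_of_nonneg_left (hC o) (abs_nonneg _)).trans (hτ t)
    exact (abs_le.1 this).1
  have hd : ∀ t, (fun o => ((p t).rnDeriv q o).toReal) =ᵐ[q] fun o => 1 + τ t * g o := by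
    intro t
    have hm : Measurable fun o => ENNReal.ofReal (1 + τ t * g o) := by fun_prop
    rw [hp]
    filter_upwards [Measure.rnDeriv_withDensity q hm] with o ho
    rw [ho, ENNReal.toReal_ofReal (by linarith [hge t o])]
  have hlim : Tendsto (fun t : ℝ => ENNReal.ofReal (t ^ 2 * (C ^ 2 / 2) ^ 2)) (𝓝[≠] 0) (𝓝 0) := by
    have : Tendsto (fun t : ℝ => t ^ 2 * (C ^ 2 / 2) ^ 2) (𝓝[≠] 0) (𝓝 0) := by
      have h : Continuous fun t : ℝ => t ^ 2 * (C ^ 2 / 2) ^ 2 := by fun_prop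
      simpa using (h.tendsto 0).mono_left nhdsWithin_le_nhds
    simpa using ENNReal.tendsto_ofReal this
  refine tendsto_of_tendsto_of_tendsto_of_le_of_le' tendsto_const_nhds hlim
    (Eventually.of_forall fun _ => zero_le) ?_
  filter_upwards [hτt.filter_mono nhdsWithin_le_nhds, self_mem_nhdsWithin] with t ht htne
  have hle : ∀ᵐ o ∂q, ENNReal.ofReal (((√((p t).rnDeriv q o).toReal - √((p 0).rnDeriv q o).toReal)
      / t
      - 1 / 2 * g o * √((p 0).rnDeriv q o).toReal) ^ 2) ≤ ENNReal.ofReal (t ^ 2 * (C ^ 2 / 2) ^ 2)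
          := by
    filter_upwards [hd t, hd 0] with o h1 h2
    rw [h1, h2, hτ0, zero_mul, add_zero, Real.sqrt_one, mul_one, ht]
    refine ENNReal.ofReal_le_ofReal ?_
    have htne' : t ≠ 0 := htne
    have h3 := abs_sqrt_one_add_sub_le (ht ▸ hge t o)
    have h4 : (√(1 + t * g o) - 1) / t - 1 / 2 * g o = (√(1 + t * g o) - 1 - t * g o / 2) / t := by
      field_simp
    have h5 : g o ^ 2 ≤ C ^ 2 := by
      rw [← sq_abs]; exact pow_le_pow_left₀ (abs_nonneg _) (hC o) 2
    rw [h4, ← sq_abs, abs_div, ← sq_abs t, ← mul_pow]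
    refine pow_le_pow_left₀ (by positivity) ?_ 2
    rw [div_le_iff₀ (abs_pos.2 htne')]
    refine h3.trans ?_
    rw [mul_pow, ← sq_abs t]
    nlinarith [mul_le_mul_of_nonneg_left h5 (sq_nonneg |t|)]
  calc _ ≤ ∫⁻ _, ENNReal.ofReal (t ^ 2 * (C ^ 2 / 2) ^ 2) ∂q := lintegral_mono_ae hle
    _ = _ := by simp

end BoundedTilt

/-! ### Laws with jointly randomized treatment and labelling -/

section Randomized

variable {𝒳 𝒮 : Type*} [MeasurableSpace 𝒳] [MeasurableSpace 𝒮]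

/-- The covariates and all potential variables. -/
def core (w : FullData 𝒳 𝒮) : 𝒳 × (Bool → 𝒮) × (Bool → ℝ) := (X w, w.2.2.1, w.2.2.2.1)

theorem measurable_core : Measurable (core : FullData 𝒳 𝒮 → _) := by
  unfold core X; fun_prop

/-- Given the covariates and all potential variables, treatment `a` has probability `e a (X)`, and
given these and treatment `a`, labelling has probability `r a (X)`. -/
structure IsRandomized (ε : ℝ) (Q : Measure (FullData 𝒳 𝒮)) (e r : Bool → 𝒳 → ℝ) : Prop where
  measurable_e : ∀ a, Measurable (e a)
  measurable_r : ∀ a, Measurable (r a)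
  e_mem : ∀ a x, e a x ∈ Set.Icc ε (1 - ε)
  r_mem : ∀ a x, r a x ∈ Set.Icc ε 1
  treat : ∀ a (φ : 𝒳 × (Bool → 𝒮) × (Bool → ℝ) → ℝ≥0∞), Measurable φ →
    ∫⁻ w in {w | T w = a}, φ (core w) ∂Q = ∫⁻ w, ENNReal.ofReal (e a (X w)) * φ (core w) ∂Q
  label : ∀ a (φ : 𝒳 × (Bool → 𝒮) × (Bool → ℝ) → ℝ≥0∞), Measurable φ →
    ∫⁻ w in {w | T w = a ∧ R w = true}, φ (core w) ∂Q
      = ∫⁻ w in {w | T w = a}, ENNReal.ofReal (r a (X w)) * φ (core w) ∂Q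

variable {ε : ℝ} {Q : Measure (FullData 𝒳 𝒮)} {e r : Bool → 𝒳 → ℝ}

/-- A density that depends on the covariates and potential variables alone can be absorbed in the
test function. Both scores are therefore unchanged, and submodels built this way stay in the model
with known scores. -/
theorem IsRandomized.withDensity (h : IsRandomized ε Q e r)
    {f : 𝒳 × (Bool → 𝒮) × (Bool → ℝ) → ℝ≥0∞} (hf : Measurable f) :
    IsRandomized ε (Q.withDensity fun w => f (core w)) e r := by
  have hfc : Measurable fun w : FullData 𝒳 𝒮 => f (core w) := hf.comp measurable_core
  have hX : Measurable (X : FullData 𝒳 𝒮 → 𝒳) := measurable_X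
  have hc : Measurable (core : FullData 𝒳 𝒮 → _) := measurable_core
  refine ⟨h.measurable_e, h.measurable_r, h.e_mem, h.r_mem, fun a φ hφ => ?_, fun a φ hφ => ?_⟩
  · have he := h.measurable_e a
    have hφc : Measurable fun w : FullData 𝒳 𝒮 => φ (core w) := hφ.comp hc
    rw [setLIntegral_withDensity_eq_setLIntegral_mul _ hfc hφc (measurableSet_arm a),
      lintegral_withDensity_eq_lintegral_mul _ hfc (by fun_prop)]
    refine (h.treat a (fun z => f z * φ z) (hf.mul hφ)).trans ?_
    refine lintegral_congr fun w => ?_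
    simp only [Pi.mul_apply]
    ring
  · have hr := h.measurable_r a
    have hφc : Measurable fun w : FullData 𝒳 𝒮 => φ (core w) := hφ.comp hc
    rw [setLIntegral_withDensity_eq_setLIntegral_mul _ hfc hφc
      (measurableSet_armLabelled a),
      setLIntegral_withDensity_eq_setLIntegral_mul _ hfc (by fun_prop) (measurableSet_arm a)]
    refine (h.label a (fun z => f z * φ z) (hf.mul hφ)).trans ?_
    refine lintegral_congr fun w => ?_
    simp only [Pi.mul_apply]
    ring

theorem IsRandomized.real_treat (h : IsRandomized ε Q e r) (hε : 0 < ε) (a : Bool)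
    {A : Set (𝒳 × (Bool → 𝒮) × (Bool → ℝ))} (hA : MeasurableSet A) :
    Q.real (core ⁻¹' A ∩ {w | T w = a}) = ∫ w in core ⁻¹' A, e a (X w) ∂Q := by
  have hX : Measurable (X : FullData 𝒳 𝒮 → 𝒳) := measurable_X
  have he := h.measurable_e a
  have h1 := h.treat a (A.indicator 1) (measurable_one.indicator hA)
  have e1 : ∫⁻ w in {w | T w = a}, A.indicator 1 (core w) ∂Q = Q (core ⁻¹' A ∩ {w | T w = a}) := by
    rw [← Measure.restrict_apply (measurable_core hA),
        ← lintegral_indicator_one (measurable_core hA)]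
    rfl
  have e2 : ∫⁻ w, ENNReal.ofReal (e a (X w)) * A.indicator 1 (core w) ∂Q
      = ∫⁻ w in core ⁻¹' A, ENNReal.ofReal (e a (X w)) ∂Q := by
    rw [← lintegral_indicator (measurable_core hA)]
    refine lintegral_congr fun w => ?_
    by_cases hw : core w ∈ A <;> simp [hw]
  rw [integral_eq_lintegral_of_nonneg_ae (ae_of_all _ fun w => hε.le.trans (h.e_mem a _).1)
    (he.comp hX).aestronglyMeasurable, ← e2, ← h1, e1, Measure.real]

theorem IsRandomized.real_label (h : IsRandomized ε Q e r) (hε : 0 < ε) (a : Bool)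
    {A : Set (𝒳 × (Bool → 𝒮) × (Bool → ℝ))} (hA : MeasurableSet A) :
    Q.real (core ⁻¹' A ∩ {w | T w = a} ∩ {w | R w = true})
      = ∫ w in core ⁻¹' A ∩ {w | T w = a}, r a (X w) ∂Q := by
  have hX : Measurable (X : FullData 𝒳 𝒮 → 𝒳) := measurable_X
  have hr := h.measurable_r a
  have h1 := h.label a (A.indicator 1) (measurable_one.indicator hA)
  have e1 : ∫⁻ w in {w | T w = a ∧ R w = true}, A.indicator 1 (core w) ∂Q
      = Q (core ⁻¹' A ∩ {w | T w = a} ∩ {w | R w = true}) := by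
    rw [Set.inter_assoc]
    change _ = Q (core ⁻¹' A ∩ {w | T w = a ∧ R w = true})
    rw [← Measure.restrict_apply (measurable_core hA),
        ← lintegral_indicator_one (measurable_core hA)]
    rfl
  have e2 : ∫⁻ w in {w | T w = a}, ENNReal.ofReal (r a (X w)) * A.indicator 1 (core w) ∂Q
      = ∫⁻ w in core ⁻¹' A ∩ {w | T w = a}, ENNReal.ofReal (r a (X w)) ∂Q := by
    rw [← Measure.restrict_restrict (measurable_core hA),
        ← lintegral_indicator (measurable_core hA)]
    refine lintegral_congr fun w => ?_
    by_cases hw : core w ∈ A <;> simp [hw]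
  rw [integral_eq_lintegral_of_nonneg_ae (ae_of_all _ fun w => hε.le.trans (h.r_mem a _).1)
    (hr.comp hX).aestronglyMeasurable, ← e2, ← h1, e1, Measure.real]

theorem IsRandomized.condIndepFun_label [StandardBorelSpace 𝒳] [StandardBorelSpace 𝒮]
    (h : IsRandomized ε Q e r) (hε : 0 < ε) (a : Bool) :
    CondIndepFun (MeasurableSpace.comap (fun w => (X w, Spot a w)) inferInstance)
      (measurable_XSpot a).comap_le R (Ypot a) (Q[|{w | T w = a}]) := by
  refine CondIndepFun.symm ?_
  refine condIndepFun_of_setIntegral_eq (measurable_XSpot a)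
    (measurable_Ypot a) measurable_R (π := fun z => r a z.1)
    ((h.measurable_r a).comp measurable_fst) (C := 1) (fun u => ?_) fun B C hB hC => ?_
  · rw [abs_of_nonneg (hε.le.trans (h.r_mem _ _).1)]
    exact (h.r_mem a u.1).2
  · have m1 : Measurable fun z : 𝒳 × (Bool → 𝒮) × (Bool → ℝ) => (z.1, z.2.1 a) := by fun_prop
    have m2 : Measurable fun z : 𝒳 × (Bool → 𝒮) × (Bool → ℝ) => z.2.2 a := by fun_prop
    have hA : MeasurableSet ({z : 𝒳 × (Bool → 𝒮) × (Bool → ℝ) | (z.1, z.2.1 a) ∈ B}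
        ∩ {z | z.2.2 a ∈ C}) := (m1 hB).inter (m2 hC)
    have key := h.real_label hε a hA
    have hA' : MeasurableSet ((fun w : FullData 𝒳 𝒮 => (X w, Spot a w)) ⁻¹' B ∩ Ypot a ⁻¹' C) :=
      (measurable_XSpot a hB).inter (measurable_Ypot a hC)
    rw [Measure.real, cond_apply (measurableSet_arm a), ENNReal.toReal_mul, ProbabilityTheory.cond,
      Measure.restrict_smul, integral_smul_measure, smul_eq_mul, Measure.restrict_restrict hA',
      ← Set.inter_assoc, Set.inter_comm {w | T w = a}]
    exact congrArg _ key

variable [IsFiniteMeasure Q]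

theorem IsRandomized.integrable_label (h : IsRandomized ε Q e r) (hε : 0 < ε) (a : Bool) :
    Integrable (fun w => r a (X w)) Q :=
  integrable_of_abs_le (integrable_const 1) ((h.measurable_r a).comp measurable_X).aestronglyMeasurable
    fun w => by
      rw [abs_of_nonneg (hε.le.trans (h.r_mem a _).1)]
      exact (h.r_mem a _).2

theorem IsRandomized.integrable_treat (h : IsRandomized ε Q e r) (hε : 0 < ε) (a : Bool) :
    Integrable (fun w => e a (X w)) Q :=
  integrable_of_abs_le (integrable_const 1) ((h.measurable_e a).comp measurable_X).aestronglyMeasurable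
    fun w => by
      rw [abs_of_nonneg (hε.le.trans (h.e_mem a _).1)]
      linarith [(h.e_mem a (X w)).2]

theorem setIntegral_ind {F : Type*} [MeasurableSpace F] {m : Measure F} {h : F → Bool}
    (hh : Measurable h) (A : Set F) : ∫ w in A, ind (h w) ∂m = m.real (A ∩ {w | h w = true}) := by
  rw [Set.inter_comm, ← measureReal_restrict_apply (measurableSet_eq_bool hh true),
    ← integral_indicator_one (measurableSet_eq_bool hh true)]
  refine integral_congr_ae (ae_of_all _ fun w => ?_)
  cases hw : h w <;> simp [ind, hw, Set.indicator]

theorem IsRandomized.isTreatmentPropensity (h : IsRandomized ε Q e r) (hε : 0 < ε) :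
    IsTreatmentPropensity Q (e true) := by
  refine isRegression_of_setIntegral_eq measurable_X (h.measurable_e true)
    (integrable_ind measurable_T).integrableOn (h.integrable_treat hε true).integrableOn
    fun B hB => ?_
  rw [Set.univ_inter, setIntegral_ind measurable_T]
  exact h.real_treat hε true (A := {z | z.1 ∈ B}) (measurable_fst hB)

theorem IsRandomized.isLabelPropensity (h : IsRandomized ε Q e r) (hε : 0 < ε) :
    IsLabelPropensity Q r := by
  intro a
  refine isRegression_of_setIntegral_eq measurable_X (h.measurable_r a)
    (integrable_ind measurable_R).integrableOn (h.integrable_label hε a).integrableOn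
    fun B hB => ?_
  rw [setIntegral_ind measurable_R, Set.inter_comm {w | T w = a}]
  exact h.real_label hε a (A := {z | z.1 ∈ B}) (measurable_fst hB)

theorem IsRandomized.isLabelPropensityS (h : IsRandomized ε Q e r) (hε : 0 < ε) :
    IsLabelPropensityS Q fun a z => r a z.1 := by
  intro a
  refine IsRegression.congr_eqOn (U := fun w => (X w, Spot a w)) ?_ (measurableSet_arm a)
    (measurable_XSpot a) (measurable_X.prodMk measurable_S)
        (integrable_ind measurable_R).integrableOn
    fun w hw => by
      have : T w = a := hw
      simp only [S, this]
  refine isRegression_of_setIntegral_eq (measurable_XSpot a)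
      ((h.measurable_r a).comp measurable_fst)
    (integrable_ind measurable_R).integrableOn (h.integrable_label hε a).integrableOn
    fun B hB => ?_
  rw [setIntegral_ind measurable_R, Set.inter_comm {w | T w = a}]
  refine h.real_label hε a (A := {z | (z.1, z.2.1 a) ∈ B}) ?_
  have : Measurable fun z : 𝒳 × (Bool → 𝒮) × (Bool → ℝ) => (z.1, z.2.1 a) := by fun_prop
  exact this hB

variable [StandardBorelSpace 𝒳] [StandardBorelSpace 𝒮]

theorem IsRandomized.condIndepFun_treat (h : IsRandomized ε Q e r) (hε : 0 < ε) (a : Bool) :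
    CondIndepFun (MeasurableSpace.comap X inferInstance) measurable_X.comap_le
      (fun w => (Ypot a w, Spot a w)) T Q := by
  refine condIndepFun_of_setIntegral_eq measurable_X
    ((measurable_Ypot a).prodMk (measurable_Spot a)) measurable_T (h.measurable_e true) (C := 1)
    (fun u => ?_) fun B C hB hC => ?_
  · rw [abs_of_nonneg (hε.le.trans (h.e_mem _ _).1)]
    linarith [(h.e_mem true u).2]
  · refine h.real_treat hε true (A := {z | z.1 ∈ B} ∩ {z | (z.2.2 a, z.2.1 a) ∈ C}) ?_
    have : Measurable fun z : 𝒳 × (Bool → 𝒮) × (Bool → ℝ) => (z.2.2 a, z.2.1 a) := by fun_prop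
    exact (measurable_fst hB).inter (this hC)

/-- Conditioning here involves T, whereas labelling is randomized within each arm; the event is cut
along T and each piece is an event of `core` within its arm. -/
theorem IsRandomized.condIndepFun_surrogate (h : IsRandomized ε Q e r) (hε : 0 < ε) (a : Bool) :
    CondIndepFun (MeasurableSpace.comap (fun w => (T w, X w)) inferInstance)
      measurable_TX.comap_le R (Spot a) Q := by
  refine CondIndepFun.symm ?_
  refine condIndepFun_of_setIntegral_eq measurable_TX (measurable_Spot a) measurable_R
    (π := fun z => r z.1 z.2) (measurable_from_prod_countable_right h.measurable_r) (C := 1)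
    (fun u => ?_) fun B C hB hC => ?_
  · rw [abs_of_nonneg (hε.le.trans (h.r_mem _ _).1)]
    exact (h.r_mem u.1 u.2).2
  · have m1 : ∀ b : Bool, Measurable fun z : 𝒳 × (Bool → 𝒮) × (Bool → ℝ) => (b, z.1) := fun b =>
      measurable_const.prodMk measurable_fst
    have m2 : Measurable fun z : 𝒳 × (Bool → 𝒮) × (Bool → ℝ) => z.2.1 a := by fun_prop
    have hA : ∀ b, MeasurableSet ({z : 𝒳 × (Bool → 𝒮) × (Bool → ℝ) | (b, z.1) ∈ B}
        ∩ {z | z.2.1 a ∈ C}) := fun b => (m1 b hB).inter (m2 hC)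
    set D : Set (FullData 𝒳 𝒮) := (fun w => (T w, X w)) ⁻¹' B ∩ Spot a ⁻¹' C with hD
    have hDm : MeasurableSet D := (measurable_TX hB).inter (measurable_Spot a hC)
    have hR := measurableSet_eq_bool (measurable_R (𝒳 := 𝒳) (𝒮 := 𝒮)) true
    have hDb : ∀ b, D ∩ {w | T w = b} = core ⁻¹' ({z : 𝒳 × (Bool → 𝒮) × (Bool → ℝ) | (b, z.1) ∈ B}
        ∩ {z | z.2.1 a ∈ C}) ∩ {w | T w = b} := by
      intro b
      ext w
      simp only [hD, Set.mem_inter_iff, Set.mem_preimage]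
      constructor
      · rintro ⟨⟨h1, h2⟩, rfl⟩; exact ⟨⟨h1, h2⟩, rfl⟩
      · rintro ⟨⟨h1, h2⟩, rfl⟩; exact ⟨⟨h1, h2⟩, rfl⟩
    have hcompl : {w : FullData 𝒳 𝒮 | T w = true}ᶜ = {w | T w = false} := by
      ext w; simp
    have hmr : Measurable fun z : Bool × 𝒳 => r z.1 z.2 :=
      measurable_from_prod_countable_right h.measurable_r
    have hi : Integrable (fun w => r (T w) (X w)) Q := integrable_of_abs_le (integrable_const 1)
      (hmr.comp measurable_TX).aestronglyMeasurable fun w => by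
        rw [abs_of_nonneg (hε.le.trans (h.r_mem _ _).1)]
        exact (h.r_mem _ _).2
    have h1 : ∀ b, Q.real (D ∩ {w | R w = true} ∩ {w | T w = b})
        = ∫ w in D ∩ {w | T w = b}, r (T w) (X w) ∂Q := by
      intro b
      rw [Set.inter_right_comm, hDb, h.real_label hε b (hA b), ← hDb]
      refine setIntegral_congr_fun (hDm.inter (measurableSet_arm b)) fun w hw => ?_
      have : T w = b := hw.2
      simp only [this]
    rw [← measureReal_inter_add_sdiff (s := D ∩ {w | R w = true}) (measurableSet_arm true),
      ← integral_inter_add_sdiff (measurableSet_arm true) hi.integrableOn, Set.sdiff_eq,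
      Set.sdiff_eq, hcompl, h1, h1]

/-- A law with randomized treatment and labelling satisfies the assumptions. -/
theorem IsRandomized.assumptions {Q : ProbabilityMeasure (FullData 𝒳 𝒮)}
    (h : IsRandomized ε (Q : Measure (FullData 𝒳 𝒮)) e r) (hε : 0 < ε)
    (hY : ∀ a, MemLp (Ypot a) 2 (Q : Measure (FullData 𝒳 𝒮))) : Assumptions ε Q where
  memLp := hY
  unconfounded_treatment := h.condIndepFun_treat hε
  unconfounded_label := h.condIndepFun_label hε
  overlap_treatment := ⟨e true, h.isTreatmentPropensity hε, ae_of_all _ fun _ => h.e_mem _ _⟩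
  overlap_label := ⟨_, h.isLabelPropensityS hε, fun _ => ae_of_all _ fun _ => h.r_mem _ _⟩
  label_surrogate := h.condIndepFun_surrogate hε

end Randomized

/-! ### Passing from real integrals to lower integrals -/

section Lintegral

/-- The hypothesis for indicators identifies two image measures on 𝒱, and then all nonnegative
functions follow without integrability conditions. -/
theorem lintegral_comp_eq_of_integral_indicator {F 𝒱 : Type*} [MeasurableSpace F]
    [MeasurableSpace 𝒱] {m₁ m₂ : Measure F} [IsFiniteMeasure m₁] [IsFiniteMeasure m₂] {V : F → 𝒱}
    (hV : Measurable V) {c : F → ℝ} (hc : Measurable c) (hc0 : ∀ w, 0 ≤ c w) (hc1 : ∀ w, c w ≤ 1)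
    (h : ∀ B, MeasurableSet B → ∫ w, B.indicator 1 (V w) ∂m₁ = ∫ w, c w * B.indicator 1 (V w) ∂m₂)
    {φ : 𝒱 → ℝ≥0∞} (hφ : Measurable φ) :
    ∫⁻ w, φ (V w) ∂m₁ = ∫⁻ w, ENNReal.ofReal (c w) * φ (V w) ∂m₂ := by
  have heq : m₁.map V = (m₂.withDensity fun w => ENNReal.ofReal (c w)).map V := by
    ext B hB
    have h1 := h B hB
    have e1 : ∫ w, B.indicator (1 : 𝒱 → ℝ) (V w) ∂m₁ = m₁.real (V ⁻¹' B) := by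
      rw [← integral_indicator_one (hV hB)]; rfl
    have e2 : ∫ w, c w * B.indicator 1 (V w) ∂m₂ = ∫ w in V ⁻¹' B, c w ∂m₂ := by
      rw [← integral_indicator (hV hB)]
      refine integral_congr_ae (ae_of_all _ fun w => ?_)
      by_cases hw : V w ∈ B <;> simp [hw, Set.indicator]
    have hci : Integrable c m₂ := integrable_of_abs_le (integrable_const 1)
      hc.aestronglyMeasurable fun w => by rw [abs_of_nonneg (hc0 w)]; exact hc1 w
    rw [Measure.map_apply hV hB, Measure.map_apply hV hB, withDensity_apply _ (hV hB),
      ← ofReal_integral_eq_lintegral_ofReal hci.integrableOn (ae_of_all _ hc0), ← e2, ← h1, e1,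
      ofReal_measureReal]
  have hφV : Measurable fun w => φ (V w) := hφ.comp hV
  rw [← lintegral_map hφ hV, heq, lintegral_map hφ hV,
    lintegral_withDensity_eq_lintegral_mul _ hc.ennreal_ofReal hφV]
  rfl

variable {𝒳 𝒮 : Type*} [MeasurableSpace 𝒳] [MeasurableSpace 𝒮] {ε : ℝ}
  {Q : Measure (FullData 𝒳 𝒮)} {a : Bool} {ea ra : 𝒳 → ℝ}

/-- The covariates and the potential variables of arm `a`. -/
def arm (a : Bool) (w : FullData 𝒳 𝒮) : 𝒳 × 𝒮 × ℝ := (X w, Spot a w, Ypot a w)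

theorem IsArmLaw.lintegral_treat [IsFiniteMeasure Q] (h : IsArmLaw ε Q a ea ra) (hε : 0 < ε)
    {φ : 𝒳 × 𝒮 × ℝ → ℝ≥0∞} (hφ : Measurable φ) :
    ∫⁻ w in {w | T w = a}, φ (arm a w) ∂Q = ∫⁻ w, ENNReal.ofReal (ea (X w)) * φ (arm a w) ∂Q :=
  lintegral_comp_eq_of_integral_indicator (measurable_arm a) (h.measurable_e.comp measurable_X)
    (fun _ => hε.le.trans (h.e_mem _).1) (fun _ => (h.e_mem _).2)
    (fun _ hB => h.treat _ (measurable_one.indicator hB)) hφ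

theorem IsArmLaw.lintegral_label [IsFiniteMeasure Q] (h : IsArmLaw ε Q a ea ra) (hε : 0 < ε)
    {φ : 𝒳 × 𝒮 × ℝ → ℝ≥0∞} (hφ : Measurable φ) :
    ∫⁻ w in {w | T w = a ∧ R w = true}, φ (arm a w) ∂Q
      = ∫⁻ w in {w | T w = a}, ENNReal.ofReal (ra (X w)) * φ (arm a w) ∂Q :=
  lintegral_comp_eq_of_integral_indicator (measurable_arm a) (h.measurable_r.comp measurable_X)
    (fun _ => hε.le.trans (h.r_mem _).1) (fun _ => (h.r_mem _).2)
    (fun _ hB => h.label _ (measurable_one.indicator hB)) hφ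

end Lintegral

/-! ### Redrawing the unassigned arm -/

section Recouple

variable {𝒳 𝒮 : Type*}

/-- Replaces the potential variables of the arm that has not been assigned. -/
def replaceOther (p : FullData 𝒳 𝒮 × 𝒮 × ℝ) : FullData 𝒳 𝒮 :=
  (X p.1, T p.1, fun b => if b = T p.1 then Spot b p.1 else p.2.1,
    fun b => if b = T p.1 then Ypot b p.1 else p.2.2, R p.1)

/-- The variables of which the observed data are a function. -/
def coarse (w : FullData 𝒳 𝒮) : 𝒳 × Bool × 𝒮 × ℝ × Bool := (X w, T w, S w, Y w, R w)

/-- Combines the potential variables of arm `a` and of the other arm. -/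
def joinArms (a : Bool) (z : 𝒳 × 𝒮 × ℝ) (z' : 𝒮 × ℝ) : 𝒳 × (Bool → 𝒮) × (Bool → ℝ) :=
  (z.1, fun b => if b = a then z.2.1 else z'.1, fun b => if b = a then z.2.2 else z'.2)

theorem coarse_replaceOther (p : FullData 𝒳 𝒮 × 𝒮 × ℝ) : coarse (replaceOther p) = coarse p.1 := by
  simp [coarse, replaceOther, X, T, S, Y, R, Spot, Ypot]

theorem core_replaceOther {w : FullData 𝒳 𝒮} {a : Bool} (h : T w = a) (z : 𝒮 × ℝ) :
    core (replaceOther (w, z)) = joinArms a (arm a w) z := by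
  subst h
  simp only [core, replaceOther, joinArms, arm, X, Prod.mk.injEq, true_and]
  constructor <;> ext b <;> by_cases hb : b = T w <;> simp [hb]

theorem joinArms_false (x : 𝒳) (z z' : 𝒮 × ℝ) :
    joinArms false (x, z) z' = joinArms true (x, z') z := by
  simp only [joinArms, Prod.mk.injEq, true_and]
  constructor <;> ext b <;> cases b <;> simp

variable [MeasurableSpace 𝒳] [MeasurableSpace 𝒮]

/-- The kernel that draws the potential variables of the arm that has not been assigned. -/
noncomputable def otherArm (K : Bool → Kernel 𝒳 (𝒮 × ℝ)) : Kernel (FullData 𝒳 𝒮) (𝒮 × ℝ) :=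
  open Classical in
  Kernel.piecewise (measurableSet_arm true) ((K false).comap X measurable_X)
    ((K true).comap X measurable_X)

instance (K : Bool → Kernel 𝒳 (𝒮 × ℝ)) [∀ a, IsMarkovKernel (K a)] :
    IsMarkovKernel (otherArm K) := by
  unfold otherArm; infer_instance

theorem otherArm_apply (K : Bool → Kernel 𝒳 (𝒮 × ℝ)) (w : FullData 𝒳 𝒮) :
    otherArm K w = K (!T w) (X w) := by
  rw [otherArm, Kernel.piecewise_apply]
  by_cases h : T w = true
  · simp [h, Kernel.comap_apply]
  · simp [Bool.eq_false_iff.2 h, Kernel.comap_apply]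

/-- The law of the full data when the potential variables of the arm that has not been assigned are
redrawn. -/
noncomputable def recouple (P : Measure (FullData 𝒳 𝒮)) (K : Bool → Kernel 𝒳 (𝒮 × ℝ)) :
    Measure (FullData 𝒳 𝒮) :=
  (P ⊗ₘ otherArm K).map replaceOther

theorem measurable_coarse : Measurable (coarse : FullData 𝒳 𝒮 → _) :=
  measurable_X.prodMk (measurable_T.prodMk
    (measurable_S.prodMk (measurable_Y.prodMk measurable_R)))

theorem measurable_replaceOther :
    Measurable (replaceOther : FullData 𝒳 𝒮 × 𝒮 × ℝ → FullData 𝒳 𝒮) := by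
  have hT : ∀ b, MeasurableSet {p : FullData 𝒳 𝒮 × 𝒮 × ℝ | b = T p.1} := fun b => by
    have : Measurable fun p : FullData 𝒳 𝒮 × 𝒮 × ℝ => T p.1 := measurable_T.comp measurable_fst
    simpa only [eq_comm] using measurableSet_eq_bool this b
  refine (measurable_X.comp measurable_fst).prodMk ((measurable_T.comp measurable_fst).prodMk
    (Measurable.prodMk (measurable_pi_iff.2 fun b => ?_) (Measurable.prodMk
      (measurable_pi_iff.2 fun b => ?_) (measurable_R.comp measurable_fst))))
  · exact Measurable.ite (hT b) ((measurable_Spot b).comp measurable_fst)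
      (measurable_fst.comp measurable_snd)
  · exact Measurable.ite (hT b) ((measurable_Ypot b).comp measurable_fst)
      (measurable_snd.comp measurable_snd)

theorem measurable_joinArms (a : Bool) :
    Measurable fun p : (𝒳 × 𝒮 × ℝ) × 𝒮 × ℝ => joinArms a p.1 p.2 := by
  refine (measurable_fst.comp measurable_fst).prodMk (Measurable.prodMk
    (measurable_pi_iff.2 fun b => ?_) (measurable_pi_iff.2 fun b => ?_))
  · by_cases hb : b = a <;> simp only [hb, if_true, if_false] <;> fun_prop
  · by_cases hb : b = a <;> simp only [hb, if_true, if_false] <;> fun_prop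

variable {ε : ℝ} {P : Measure (FullData 𝒳 𝒮)} [IsProbabilityMeasure P]
  {K : Bool → Kernel 𝒳 (𝒮 × ℝ)} [∀ a, IsMarkovKernel (K a)] {e r : Bool → 𝒳 → ℝ}

instance : IsProbabilityMeasure (recouple P K) :=
  Measure.isProbabilityMeasure_map measurable_replaceOther.aemeasurable

/-- Redrawing changes only the unassigned arm, which no observed variable involves. -/
theorem map_coarse_recouple : (recouple P K).map coarse = P.map coarse := by
  rw [recouple, Measure.map_map measurable_coarse measurable_replaceOther]
  have : (coarse ∘ replaceOther : FullData 𝒳 𝒮 × 𝒮 × ℝ → _) = coarse ∘ Prod.fst :=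
    funext coarse_replaceOther
  rw [this, ← Measure.map_map measurable_coarse measurable_fst]
  congr 1
  exact Measure.fst_compProd P (otherArm K)

/-- The average over the potential variables of the other arm. -/
noncomputable def averageOther (K : Bool → Kernel 𝒳 (𝒮 × ℝ)) (a : Bool)
    (φ : 𝒳 × (Bool → 𝒮) × (Bool → ℝ) → ℝ≥0∞) (z : 𝒳 × 𝒮 × ℝ) : ℝ≥0∞ :=
  ∫⁻ z', φ (joinArms a z z') ∂K (!a) z.1

theorem measurable_averageOther (a : Bool) {φ : 𝒳 × (Bool → 𝒮) × (Bool → ℝ) → ℝ≥0∞}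
    (hφ : Measurable φ) : Measurable (averageOther K a φ) :=
  Measurable.lintegral_kernel_prod_right' (κ := (K (!a)).comap Prod.fst measurable_fst)
    (hφ.comp (measurable_joinArms a))

/-- The set `D` will be T = a, with or without R = 1. Such an event is not affected by redrawing,
and on it the new potential variables consist of the assigned arm and an independent draw given X.
-/
theorem setLIntegral_recouple {a : Bool} {D : Set (FullData 𝒳 𝒮)} (hD : MeasurableSet D)
    (hDT : ∀ w ∈ D, T w = a) (hDr : ∀ p : FullData 𝒳 𝒮 × 𝒮 × ℝ, replaceOther p ∈ D ↔ p.1 ∈ D)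
    {φ : 𝒳 × (Bool → 𝒮) × (Bool → ℝ) → ℝ≥0∞} (hφ : Measurable φ) :
    ∫⁻ w in D, φ (core w) ∂recouple P K = ∫⁻ w in D, averageOther K a φ (arm a w) ∂P := by
  have m1 : Measurable (D.indicator fun w => φ (core w)) :=
    (hφ.comp measurable_core).indicator hD
  have m2 : Measurable fun p : FullData 𝒳 𝒮 × 𝒮 × ℝ =>
      D.indicator (fun w => φ (core w)) (replaceOther p) := m1.comp measurable_replaceOther
  rw [← lintegral_indicator hD, ← lintegral_indicator hD, recouple,
    lintegral_map m1 measurable_replaceOther,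
    Measure.lintegral_compProd m2]
  refine lintegral_congr fun w => ?_
  by_cases hw : w ∈ D
  · have h1 : ∀ z, D.indicator (fun w => φ (core w)) (replaceOther (w, z))
        = φ (joinArms a (arm a w) z) := fun z => by
      rw [Set.indicator_of_mem ((hDr (w, z)).2 hw), core_replaceOther (hDT w hw)]
    simp only [h1, Set.indicator_of_mem hw, averageOther, otherArm_apply, hDT w hw]
    rfl
  · have h1 : ∀ z, D.indicator (fun w => φ (core w)) (replaceOther (w, z)) = 0 := fun z =>
      Set.indicator_of_notMem (fun h => hw ((hDr (w, z)).1 h)) _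
    simp [h1, Set.indicator_of_notMem hw]

/-- The average over independent draws of the potential variables of both arms. -/
noncomputable def averageArms (K : Bool → Kernel 𝒳 (𝒮 × ℝ))
    (φ : 𝒳 × (Bool → 𝒮) × (Bool → ℝ) → ℝ≥0∞) (x : 𝒳) : ℝ≥0∞ :=
  ∫⁻ z, ∫⁻ z', φ (joinArms true (x, z) z') ∂K false x ∂K true x

/-- Which arm is original and which is redrawn does not matter, by Tonelli's theorem. This symmetry
makes the redrawn law randomized. -/
theorem averageArms_eq (a : Bool) {φ : 𝒳 × (Bool → 𝒮) × (Bool → ℝ) → ℝ≥0∞}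
    (hφ : Measurable φ) (x : 𝒳) :
    ∫⁻ z, averageOther K a φ (x, z) ∂K a x = averageArms K φ x := by
  cases a
  · simp only [averageOther, joinArms_false, Bool.not_false]
    have m1 : Measurable fun p : (𝒮 × ℝ) × 𝒮 × ℝ => (((x, p.2), p.1) : (𝒳 × 𝒮 × ℝ) × 𝒮 × ℝ) := by
      fun_prop
    have m2 : Measurable fun p : (𝒮 × ℝ) × 𝒮 × ℝ => φ (joinArms true (x, p.2) p.1) :=
      hφ.comp ((measurable_joinArms true).comp m1)
    exact lintegral_lintegral_swap m2.aemeasurable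
  · rfl

theorem measurable_averageArms {φ : 𝒳 × (Bool → 𝒮) × (Bool → ℝ) → ℝ≥0∞}
    (hφ : Measurable φ) : Measurable (averageArms K φ) :=
  (measurable_averageOther true hφ).lintegral_kernel_prod_right'

theorem lintegral_arm {a : Bool} (hK : P.map X ⊗ₘ K a = P.map (arm a))
    {φ : 𝒳 × 𝒮 × ℝ → ℝ≥0∞} (hφ : Measurable φ) :
    ∫⁻ w, φ (arm a w) ∂P = ∫⁻ w, ∫⁻ z, φ (X w, z) ∂K a (X w) ∂P := by
  have hm : Measurable (arm a : FullData 𝒳 𝒮 → _) := measurable_arm a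
  rw [← lintegral_map hφ hm, ← hK, Measure.lintegral_compProd hφ,
    lintegral_map hφ.lintegral_kernel_prod_right' measurable_X]

/-- Unconfoundedness removes the restriction to the arm at the cost of the weight e(a, X); then the
assigned arm may also be integrated out by its conditional law given X. -/
theorem setLIntegral_arm_recouple (h : ∀ a, IsArmLaw ε P a (e a) (r a)) (hε : 0 < ε)
    (hK : ∀ a, P.map X ⊗ₘ K a = P.map (arm a)) (a : Bool)
    {φ : 𝒳 × (Bool → 𝒮) × (Bool → ℝ) → ℝ≥0∞} (hφ : Measurable φ) :
    ∫⁻ w in {w | T w = a}, φ (core w) ∂recouple P K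
      = ∫⁻ w, ENNReal.ofReal (e a (X w)) * averageArms K φ (X w) ∂P := by
  have ma := measurable_averageOther (K := K) a hφ
  have he := (h a).measurable_e
  have m1 : Measurable fun z : 𝒳 × 𝒮 × ℝ => ENNReal.ofReal (e a z.1) * averageOther K a φ z := by
    fun_prop
  rw [setLIntegral_recouple (measurableSet_arm a) (fun _ h => h) (fun _ => Iff.rfl) hφ,
    (h a).lintegral_treat hε ma]
  refine (lintegral_arm (hK a) m1).trans (lintegral_congr fun w => ?_)
  have m2 : Measurable fun z : 𝒮 × ℝ => averageOther K a φ (X w, z) :=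
    ma.comp measurable_prodMk_left
  simp only
  rw [lintegral_const_mul _ m2, averageArms_eq a hφ]

/-- The weights of the two arms add up to one, so under the new law the arms are conditionally
independent given X, each with its original conditional law. -/
theorem lintegral_core_recouple (h : ∀ a, IsArmLaw ε P a (e a) (r a)) (hε : 0 < ε)
    (hsum : ∀ x, e true x + e false x = 1)
    (hK : ∀ a, P.map X ⊗ₘ K a = P.map (arm a))
    {φ : 𝒳 × (Bool → 𝒮) × (Bool → ℝ) → ℝ≥0∞} (hφ : Measurable φ) :
    ∫⁻ w, φ (core w) ∂recouple P K = ∫⁻ w, averageArms K φ (X w) ∂P := by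
  have hcompl : {w : FullData 𝒳 𝒮 | T w = true}ᶜ = {w | T w = false} := by
    ext w; simp
  have m1 : Measurable fun w : FullData 𝒳 𝒮 =>
      ENNReal.ofReal (e true (X w)) * averageArms K φ (X w) :=
    ((h true).measurable_e.comp measurable_X).ennreal_ofReal.mul
      ((measurable_averageArms hφ).comp measurable_X)
  rw [← lintegral_add_compl _ (measurableSet_arm true), hcompl,
    setLIntegral_arm_recouple h hε hK true hφ, setLIntegral_arm_recouple h hε hK false hφ,
    ← lintegral_add_left m1]
  refine lintegral_congr fun w => ?_
  rw [← add_mul, ← ENNReal.ofReal_add (hε.le.trans ((h true).e_mem _).1)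
    (hε.le.trans ((h false).e_mem _).1), hsum, ENNReal.ofReal_one, one_mul]

/-- For treatment, both sides reduce to an average over X in which e(a, X) is a constant of the
inner integrals. For labelling, the property of the assigned arm is used before averaging over the
redrawn one. -/
theorem isRandomized_recouple (h : ∀ a, IsArmLaw ε P a (e a) (r a)) (hε : 0 < ε)
    (hsum : ∀ x, e true x + e false x = 1)
    (hK : ∀ a, P.map X ⊗ₘ K a = P.map (arm a)) : IsRandomized ε (recouple P K) e r where
  measurable_e a := (h a).measurable_e
  measurable_r a := (h a).measurable_r
  e_mem a x := ⟨((h a).e_mem x).1, by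
    have h1 := hsum x
    have h2 := ((h !a).e_mem x).1
    cases a <;> simp only [Bool.not_false, Bool.not_true] at h2 <;> linarith⟩
  r_mem a := (h a).r_mem
  treat a φ hφ := by
    have he := (h a).measurable_e
    have m1 : Measurable fun z : 𝒳 × (Bool → 𝒮) × (Bool → ℝ) => ENNReal.ofReal (e a z.1) * φ z := by
      fun_prop
    rw [setLIntegral_arm_recouple h hε hK a hφ]
    refine Eq.trans ?_ (lintegral_core_recouple h hε hsum hK m1).symm
    refine lintegral_congr fun w => ?_
    have m2 : Measurable fun z : 𝒮 × ℝ => averageOther K true φ (X w, z) :=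
      (measurable_averageOther true hφ).comp measurable_prodMk_left
    have h1 : ∀ z, ∫⁻ z', ENNReal.ofReal (e a (joinArms true (X w, z) z').1)
        * φ (joinArms true (X w, z) z') ∂K false (X w)
        = ENNReal.ofReal (e a (X w)) * averageOther K true φ (X w, z) := fun z => by
      have m3 : Measurable fun z' : 𝒮 × ℝ => φ (joinArms true (X w, z) z') :=
        hφ.comp ((measurable_joinArms true).comp measurable_prodMk_left)
      exact lintegral_const_mul (ENNReal.ofReal (e a (X w))) m3
    simp only [averageArms, h1]
    rw [lintegral_const_mul _ m2]
    rfl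
  label a φ hφ := by
    have hr := (h a).measurable_r
    have m1 : Measurable fun z : 𝒳 × (Bool → 𝒮) × (Bool → ℝ) => ENNReal.ofReal (r a z.1) * φ z := by
      fun_prop
    rw [setLIntegral_recouple (measurableSet_armLabelled a) (fun _ h => h.1) (fun _ => Iff.rfl) hφ,
      (h a).lintegral_label hε (measurable_averageOther a hφ)]
    refine Eq.trans ?_ (setLIntegral_recouple (measurableSet_arm a) (fun _ h => h)
      (fun _ => Iff.rfl) m1).symm
    refine lintegral_congr fun w => ?_
    simp only [averageOther, joinArms]
    rw [lintegral_const_mul]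
    · rfl
    · exact hφ.comp ((measurable_joinArms a).comp measurable_prodMk_left)

theorem map_arm_recouple (h : ∀ a, IsArmLaw ε P a (e a) (r a)) (hε : 0 < ε)
    (hsum : ∀ x, e true x + e false x = 1)
    (hK : ∀ a, P.map X ⊗ₘ K a = P.map (arm a)) (a : Bool) :
    (recouple P K).map (arm a) = P.map (arm a) := by
  have hm : Measurable (arm a : FullData 𝒳 𝒮 → _) := measurable_arm a
  have hmc : Measurable fun z : 𝒳 × (Bool → 𝒮) × (Bool → ℝ) => (z.1, z.2.1 a, z.2.2 a) := by
    fun_prop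
  refine Measure.ext_of_lintegral _ fun φ hφ => ?_
  rw [lintegral_map hφ hm, lintegral_map hφ hm, lintegral_arm (hK a) hφ]
  refine (lintegral_core_recouple h hε hsum hK (hφ.comp hmc)).trans (lintegral_congr fun w => ?_)
  rw [← averageArms_eq a (hφ.comp hmc)]
  simp [averageOther, joinArms]

/-- Under the recoupled law, the potential variables of the other arm are independent of the observed
variables given the covariates. -/
theorem setIntegral_other_arm_eq_zero (h : ∀ a, IsArmLaw ε P a (e a) (r a)) (hε : 0 < ε)
    (hsum : ∀ x, e true x + e false x = 1)
    (hK : ∀ a, P.map X ⊗ₘ K a = P.map (arm a)) (a : Bool) {b : 𝒳 × 𝒮 × ℝ → ℝ} (hb : Measurable b)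
    (hbi : Integrable (fun w => b (arm a w)) P)
    (hb0 : ∀ φ : 𝒳 → ℝ, Measurable φ → (∃ C, ∀ u, |φ u| ≤ C) → ∫ w, φ (X w) * b (arm a w) ∂P = 0)
    {G : 𝒳 × Bool × 𝒮 × ℝ × Bool → ℝ} (hG : Measurable G) {C : ℝ} (hGC : ∀ u, |G u| ≤ C) :
    ∫ w in {w | T w = !a}, G (coarse w) * b (arm a w) ∂recouple P K = 0 := by
  have hm : Measurable (arm a : FullData 𝒳 𝒮 → _) := measurable_arm a
  have hX : Measurable (X : FullData 𝒳 𝒮 → 𝒳) := measurable_X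
  have hbP : Integrable b (P.map X ⊗ₘ K a) := by
    rw [hK]; exact (integrable_map_measure hb.aestronglyMeasurable hm.aemeasurable).2 hbi
  have hB : StronglyMeasurable fun x => ∫ z, b (x, z) ∂K a x :=
    hb.stronglyMeasurable.integral_kernel_prod_right'
  have hBi : Integrable (fun x => ∫ z, b (x, z) ∂K a x) (P.map X) := by
    rw [Measure.compProd] at hbP
    simpa using hbP.integral_compProd
  -- Orthogonality to all bounded functions of X makes the conditional mean given X vanish; only
  -- this mean matters for a redrawn arm.
  have hB0 : ∀ᵐ x ∂P.map X, ∫ z, b (x, z) ∂K a x = 0 := by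
    refine hBi.ae_eq_zero_of_forall_setIntegral_eq_zero fun s hs _ => ?_
    have ms : Measurable (s.indicator (1 : 𝒳 → ℝ)) := measurable_one.indicator hs
    have m1 : Measurable fun z : 𝒳 × 𝒮 × ℝ => s.indicator (1 : 𝒳 → ℝ) z.1 * b z :=
      (ms.comp measurable_fst).mul hb
    have hs1 : ∀ u, |s.indicator (1 : 𝒳 → ℝ) u| ≤ 1 := fun u => by
      by_cases hu : u ∈ s <;> simp [hu]
    have h1 := hb0 (s.indicator 1) ms ⟨1, hs1⟩
    rw [← integral_indicator hs, ← h1]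
    have h2 : ∫ w, s.indicator 1 (X w) * b (arm a w) ∂P
        = ∫ z, s.indicator 1 z.1 * b z ∂P.map (arm a) :=
      (integral_map hm.aemeasurable m1.aestronglyMeasurable).symm
    have hi : Integrable (fun z : 𝒳 × 𝒮 × ℝ => s.indicator (1 : 𝒳 → ℝ) z.1 * b z)
        (P.map X ⊗ₘ K a) :=
      integrable_mul_of_bounded (ms.comp measurable_fst) (fun _ => hs1 _) hbP
    rw [h2, ← hK, Measure.integral_compProd hi]
    refine integral_congr_ae (ae_of_all _ fun x => ?_)
    simp only [integral_const_mul]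
    by_cases hx : x ∈ s <;> simp [hx]
  have hB0' : ∀ᵐ w ∂P, ∫ z, b (X w, z) ∂K a (X w) = 0 := ae_of_ae_map hX.aemeasurable hB0
  have hbQ : Integrable (fun w => b (arm a w)) (recouple P K) := by
    refine (integrable_map_measure hb.aestronglyMeasurable hm.aemeasurable).1 ?_
    rw [map_arm_recouple h hε hsum hK]
    exact (integrable_map_measure hb.aestronglyMeasurable hm.aemeasurable).2 hbi
  have m1 : Measurable ({w | T w = !a}.indicator fun w : FullData 𝒳 𝒮 => G (coarse w) * b (arm a w))
      :=
    ((hG.comp measurable_coarse).mul (hb.comp hm)).indicator (measurableSet_arm _)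
  have hi : Integrable (fun p => {w | T w = !a}.indicator
      (fun w : FullData 𝒳 𝒮 => G (coarse w) * b (arm a w)) (replaceOther p)) (P ⊗ₘ otherArm K) := by
    refine (integrable_map_measure m1.aestronglyMeasurable
      measurable_replaceOther.aemeasurable).1 ?_
    exact (integrable_mul_of_bounded (hG.comp measurable_coarse) (fun _ => hGC _) hbQ).indicator
      (measurableSet_arm _)
  rw [← integral_indicator (measurableSet_arm _), recouple,
    integral_map measurable_replaceOther.aemeasurable m1.aestronglyMeasurable,
    Measure.integral_compProd hi]
  refine (integral_congr_ae ?_).trans (integral_zero _ _)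
  filter_upwards [hB0'] with w hw
  by_cases hT : T w = !a
  · have h1 : ∀ z, {w | T w = !a}.indicator (fun w : FullData 𝒳 𝒮 => G (coarse w) * b (arm a w))
        (replaceOther (w, z)) = G (coarse w) * b (X w, z) := by
      intro z
      have hT' : T (replaceOther (w, z)) = !a := hT
      have e1 : arm a (replaceOther (w, z)) = (X w, z) := by
        have : a ≠ T w := by rw [hT]; cases a <;> simp
        simp [arm, replaceOther, Spot, Ypot, X, this]
      rw [Set.indicator_of_mem (show replaceOther (w, z) ∈ {w | T w = !a} from hT'), e1,
        coarse_replaceOther]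
    simp only [h1, integral_const_mul, otherArm_apply, hT, Bool.not_not, hw, mul_zero]
  · have h1 : ∀ z, {w | T w = !a}.indicator (fun w : FullData 𝒳 𝒮 => G (coarse w) * b (arm a w))
        (replaceOther (w, z)) = 0 := fun z =>
      Set.indicator_of_notMem (show replaceOther (w, z) ∉ {w | T w = !a} from hT) _
    simp [h1]

end Recouple

/-! ### Conditional means contract in L² -/

section ConditionalMean

/-- The hypothesis makes `u ∘ obs` a version of the conditional expectation of `f` given `obs`. -/
theorem integral_sq_comp_le {F O : Type*} [MeasurableSpace F] [MeasurableSpace O] {m : Measure F}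
    [IsFiniteMeasure m] {obs : F → O} (hobs : Measurable obs) {f : F → ℝ} (hf : MemLp f 2 m)
    {u : O → ℝ} (hu : Measurable u) (hui : Integrable (fun w => u (obs w)) m)
    (h : ∀ B, MeasurableSet B → ∫ w in obs ⁻¹' B, u (obs w) ∂m = ∫ w in obs ⁻¹' B, f w ∂m) :
    ∫ w, u (obs w) ^ 2 ∂m ≤ ∫ w, f w ^ 2 ∂m := by
  have h1 : (fun w => u (obs w)) =ᵐ[m] m[f | MeasurableSpace.comap obs inferInstance] := by
    refine ae_eq_condExp_of_forall_setIntegral_eq hobs.comap_le (hf.integrable one_le_two)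
      (fun _ _ _ => hui.integrableOn) ?_
      (hu.comp (comap_measurable obs)).stronglyMeasurable.aestronglyMeasurable
    rintro _ ⟨B, hB, rfl⟩ -
    exact h B hB
  have h2 : MemLp (fun w => u (obs w)) 2 m := (hf.condExp one_le_two).ae_eq h1.symm
  rw [← norm_toLp_sq hf, ← norm_toLp_sq h2]
  refine pow_le_pow_left₀ (norm_nonneg _) ?_ 2
  rw [Lp.norm_toLp, Lp.norm_toLp, eLpNorm_congr_ae h1]
  exact ENNReal.toReal_mono hf.eLpNorm_ne_top (eLpNorm_condExp_le_eLpNorm f one_le_two)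

end ConditionalMean

/-! ### The least favourable score and its projection on the observed data -/

section Score

variable {𝒳 𝒮 𝒰 O : Type*}

/-- The score of arm `a` in the direction in which the mean of its outcome is hardest to estimate. -/
noncomputable def armScore (full : Bool) (U : 𝒳 × 𝒮 → 𝒰) (ea ra μ : 𝒳 → ℝ) (M : 𝒰 → ℝ)
    (z : 𝒳 × 𝒮 × ℝ) : ℝ :=
  (M (U (z.1, z.2.1)) - μ z.1) / ea z.1
    + (z.2.2 - M (U (z.1, z.2.1))) / (ea z.1 * schemeProb full ra z.1)

variable [MeasurableSpace 𝒳] [MeasurableSpace 𝒮] [MeasurableSpace 𝒰]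
  [MeasurableSpace O] {obs : FullData 𝒳 𝒮 → O} {full : Bool} {U : 𝒳 × 𝒮 → 𝒰} {ε : ℝ}
  {P : Measure (FullData 𝒳 𝒮)} {a : Bool} {ea ra : 𝒳 → ℝ} {μ : 𝒳 → ℝ} {M : 𝒰 → ℝ}

theorem measurable_armScore (h : IsArmLaw ε P a ea ra) (hU : Measurable U) (hμ : Measurable μ)
    (hM : Measurable M) : Measurable (armScore full U ea ra μ M) := by
  have h1 := h.measurable_e
  have h2 := h.measurable_schemeProb (full := full)
  unfold armScore
  fun_prop

theorem IsArmLaw.abs_inv_le (h : IsArmLaw ε P a ea ra) (hε : 0 < ε) (x : 𝒳) : |(ea x)⁻¹| ≤ ε⁻¹ := by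
  have h1 := (h.e_mem x).1
  rw [abs_of_pos (inv_pos.2 (hε.trans_le h1))]
  exact inv_anti₀ hε h1

theorem IsArmLaw.abs_inv_mul_le (h : IsArmLaw ε P a ea ra) (hε : 0 < ε) (x : 𝒳) :
    |(ea x * schemeProb full ra x)⁻¹| ≤ ε⁻¹ * ε⁻¹ := by
  have h2 := (h.schemeProb_mem (full := full) x).1
  rw [mul_inv, abs_mul, abs_of_pos (inv_pos.2 (hε.trans_le h2))]
  exact mul_le_mul (h.abs_inv_le hε x) (inv_anti₀ hε h2) (inv_pos.2 (hε.trans_le h2)).le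
    (inv_pos.2 hε).le

theorem memLp_armScore (h : IsArmLaw ε P a ea ra) (hε : 0 < ε) (hY : MemLp (Ypot a) 2 P)
    (hμ : IsArmMean P a Prod.fst μ) (hM : IsArmMean P a U M) :
    MemLp (fun w => armScore full U ea ra μ M (arm a w)) 2 P := by
  have m1 : Measurable fun w : FullData 𝒳 𝒮 => (ea (X w))⁻¹ :=
    (h.measurable_e.comp measurable_X).inv
  have m2 : Measurable fun w : FullData 𝒳 𝒮 => (ea (X w) * schemeProb full ra (X w))⁻¹ :=
    ((h.measurable_e.comp measurable_X).mul (h.measurable_schemeProb.comp measurable_X)).inv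
  have l1 := (hM.memLp.sub hμ.memLp).mul
    (memLp_top_of_bound m1.aestronglyMeasurable _ (ae_of_all P fun w => h.abs_inv_le hε (X w)))
    (r := 2)
  have l2 := (hY.sub hM.memLp).mul
    (memLp_top_of_bound m2.aestronglyMeasurable _
      (ae_of_all P fun w => h.abs_inv_mul_le (full := full) hε (X w))) (r := 2)
  refine (l1.add l2).ae_eq (ae_of_all _ fun w => ?_)
  simp only [armScore, arm, Pi.add_apply, Pi.mul_apply, Pi.sub_apply]
  ring

/-- Writing M − μ as (Y(a) − μ) − (Y(a) − M) reduces everything to residuals, each orthogonal to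
bounded functions of X. -/
theorem integral_mul_armScore [IsFiniteMeasure P] (h : IsArmLaw ε P a ea ra) (hε : 0 < ε)
    (hY : MemLp (Ypot a) 2 P)
    (hμ : IsArmMean P a Prod.fst μ) (hM : IsArmMean P a U M) {p : 𝒰 → 𝒳}
    (hp : Measurable p) (hpU : ∀ z, p (U z) = z.1) {φ : 𝒳 → ℝ} (hφ : Measurable φ)
    (hφC : ∃ C, ∀ u, |φ u| ≤ C) :
    ∫ w, φ (X w) * armScore full U ea ra μ M (arm a w) ∂P = 0 := by
  obtain ⟨C, hC⟩ := hφC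
  have me := h.measurable_e
  have mr := h.measurable_schemeProb (full := full)
  have b1 : ∀ x, |φ x * (ea x)⁻¹| ≤ C * ε⁻¹ := fun x => by
    rw [abs_mul]
    exact mul_le_mul (hC x) (h.abs_inv_le hε x) (abs_nonneg _) ((abs_nonneg _).trans (hC x))
  have b2 : ∀ x, |φ x * (ea x * schemeProb full ra x)⁻¹| ≤ C * (ε⁻¹ * ε⁻¹) := fun x => by
    rw [abs_mul]
    exact mul_le_mul (hC x) (h.abs_inv_mul_le hε x) (abs_nonneg _) ((abs_nonneg _).trans (hC x))
  have m1 : Measurable fun x => φ x * (ea x)⁻¹ := by fun_prop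
  have m2 : Measurable fun x => φ x * (ea x * schemeProb full ra x)⁻¹ := by fun_prop
  have z1 := hμ.integral_eq_zero (fun x => φ x * (ea x)⁻¹) m1 ⟨_, b1⟩
  have z2 := hM.integral_eq_zero (fun u => φ (p u) * (ea (p u))⁻¹) (m1.comp hp) ⟨_, fun u => b1 _⟩
  have z3 := hM.integral_eq_zero (fun u => φ (p u) * (ea (p u) * schemeProb full ra (p u))⁻¹)
    (m2.comp hp) ⟨_, fun u => b2 _⟩
  simp only [hpU] at z2 z3
  have i1 := (hY.sub hμ.memLp).integrable one_le_two
  have i2 := (hY.sub hM.memLp).integrable one_le_two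
  have j1 := integrable_mul_of_bounded (m1.comp measurable_X) (fun w => b1 (X w)) i1
  have j2 := integrable_mul_of_bounded (m1.comp measurable_X) (fun w => b1 (X w)) i2
  have j3 := integrable_mul_of_bounded (m2.comp measurable_X) (fun w => b2 (X w)) i2
  have j12 := integral_sub j1 j2
  have j123 := integral_add (j1.sub j2) j3
  simp only [Pi.sub_apply, Function.comp] at j12 j123
  rw [j12, z1, z2, z3, sub_zero, add_zero] at j123
  rw [← j123]
  refine integral_congr_ae (ae_of_all _ fun w => ?_)
  simp only [armScore, arm]
  ring

/-- Averaging over the outcomes of the unlabelled units. -/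
theorem Scheme.integral_unlabelled_eq_zero [IsFiniteMeasure P] (s : Scheme obs full U)
    (h : IsArmLaw ε P a ea ra) (hε : 0 < ε) (hY : MemLp (Ypot a) 2 P) (hM : IsArmMean P a U M)
    {G : O → ℝ} (hG : Measurable G) (hGC : ∃ C, ∀ u, |G u| ≤ C) :
    ∫ w, ind (T w == a) * (1 - ind (R w || full)) * (G (obs w)
      * ((Ypot a w - M (U (X w, Spot a w))) / (ea (X w) * schemeProb full ra (X w)))) ∂P = 0 := by
  cases full
  · obtain ⟨v, hv, hcode⟩ := s.unlabelled rfl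
    obtain ⟨C, hC⟩ := hGC
    have me := h.measurable_e
    have mr := h.measurable_schemeProb (full := false)
    have mp := s.measurable_proj
    have mU := s.measurable_U
    have mUa : Measurable fun w : FullData 𝒳 𝒮 => U (X w, Spot a w) := mU.comp (measurable_XSpot a)
    have mv := hv a
    let χ : 𝒰 → ℝ := fun u => G (v a u) * (ea (s.proj u) * schemeProb false ra (s.proj u))⁻¹
    have mχ : Measurable χ := by fun_prop
    have bχ : ∀ u, |χ u| ≤ C * (ε⁻¹ * ε⁻¹) := fun u => by
      rw [abs_mul]
      exact mul_le_mul (hC _) (h.abs_inv_mul_le hε _) (abs_nonneg _)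
          ((abs_nonneg _).trans (hC (v a u)))
    -- The factor 1 − L is the difference between observing every outcome of the arm and observing
    -- the labelled ones; in both cases the residual is orthogonal to functions of the regressor.
    have z1 := hM.integral_labelled_eq_zero (full := true) mU mp s.proj_eq h hε mχ ⟨_, bχ⟩
    have z2 := hM.integral_labelled_eq_zero (full := false) mU mp s.proj_eq h hε mχ ⟨_, bχ⟩
    have i0 := integrable_mul_of_bounded (mχ.comp mUa) (fun w => bχ _)
      ((hY.sub hM.memLp).integrable one_le_two)
    have hb : ∀ b, |ind b| ≤ 1 := fun b => by cases b <;> simp [ind]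
    have i1 : ∀ f : Bool, Integrable (fun w => ind (T w == a) * ind (R w || f)
        * (χ (U (X w, Spot a w)) * (Ypot a w - M (U (X w, Spot a w))))) P := fun f =>
      integrable_mul_of_bounded (C := 1) (((measurable_ind_eq a).comp measurable_T).mul
        (measurable_ind.comp ((measurable_of_finite fun b => (b || f)).comp measurable_R)))
        (fun w => by rw [abs_mul]; exact mul_le_one₀ (hb _) (abs_nonneg _) (hb _)) i0
    have z := integral_sub (i1 true) (i1 false)
    rw [z1, z2, sub_zero] at z
    rw [← z]
    refine integral_congr_ae (ae_of_all _ fun w => ?_)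
    simp only [χ, s.proj_eq]
    by_cases hT : T w = a
    · cases hR : R w
      -- On the unlabelled units of the arm the observed data are a function of the regressor, so
      -- the values of `G` there form an admissible test function.
      · have : obs w = v a (U (X w, Spot a w)) := by
          rw [s.obs_eq, hR, hT, S, hT]; exact hcode _ _ _ _
        rw [this]
        simp [hT, ind]
        ring
      · simp [ind]
    · have : (T w == a) = false := by simpa using hT
      simp [this, ind]
  · simp [ind]

/-- On the arm, the score and the influence term differ by (1 − L)(Y(a) − M)/(e r), which averages
to zero by `Scheme.integral_unlabelled_eq_zero`. -/
theorem Scheme.integral_arm_mul_armScore [IsFiniteMeasure P] (s : Scheme obs full U)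
    (h : IsArmLaw ε P a ea ra) (hε : 0 < ε) (hY : ∀ a, MemLp (Ypot a) 2 P)
    (hμ : IsArmMean P a Prod.fst μ) (hM : IsArmMean P a U M)
    {G : O → ℝ} (hG : Measurable G) (hGC : ∃ C, ∀ u, |G u| ≤ C) :
    ∫ w in {w | T w = a}, G (obs w) * armScore full U ea ra μ M (arm a w) ∂P
      = ∫ w, G (obs w) * (armPsi full U a ea ra μ M w - μ (X w)) ∂P := by
  obtain ⟨C, hC⟩ := hGC
  have hb : ∀ b, |ind b| ≤ 1 := fun b => by cases b <;> simp [ind]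
  have mG : Measurable fun w => G (obs w) := hG.comp s.measurable_obs
  have i1 := integrable_mul_of_bounded ((measurable_ind_eq a).comp measurable_T) (fun w => hb _)
    (integrable_mul_of_bounded mG (fun w => hC _)
      ((memLp_armScore (full := full) h hε (hY a) hμ hM).integrable one_le_two))
  have i2 := integrable_mul_of_bounded mG (fun w => hC _)
    (((memLp_armPsi (full := full) hε h hY s.measurable_U hμ hM).sub hμ.memLp).integrable one_le_two)
  have z := s.integral_unlabelled_eq_zero h hε (hY a) hM hG ⟨C, hC⟩
  have z' := integral_sub i1 i2
  rw [setIntegral_arm_eq, ← sub_eq_zero]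
  refine z'.symm.trans (Eq.trans ?_ z)
  refine integral_congr_ae (ae_of_all _ fun w => ?_)
  simp only [armPsi, armInfluence, armScore, arm, Function.comp, Pi.sub_apply]
  by_cases hT : T w = a
  · have e1 : Y w = Ypot a w := by simp only [Y, hT]
    have e2 : S w = Spot a w := by simp only [S, hT]
    have e3 : (T w == a) = true := by simpa using hT
    rw [e1, e2, e3]
    simp only [ind, if_true, one_mul]
    ring
  · have : (T w == a) = false := by simpa using hT
    simp [this, ind]

theorem Scheme.exists_armPsi_eq (s : Scheme obs full U) (h : IsArmLaw ε P a ea ra)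
    (hμ : Measurable μ) (hM : Measurable M) :
    ∃ Ψ : O → ℝ, Measurable Ψ ∧ ∀ w, armPsi full U a ea ra μ M w = Ψ (obs w) := by
  have m1 := h.measurable_e
  have m2 := h.measurable_schemeProb (full := full)
  have m3 : Measurable fun o => ind (s.treat o == a) :=
      (measurable_ind_eq a).comp s.measurable_treat
  have m4 : Measurable fun o => ind (s.label o) := measurable_ind.comp s.measurable_label
  have m5 := s.measurable_reg
  have m6 := s.measurable_proj
  have m7 := s.measurable_outcome
  refine ⟨armInfluence (fun o => s.proj (s.reg o)) (fun o => ind (s.treat o == a))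
    (fun o => ind (s.label o)) (fun o => ind (s.treat o == a) * M (s.reg o)) s.outcome ea
    (schemeProb full ra) μ, ?_, fun w => ?_⟩
  · unfold armInfluence
    fun_prop
  · simp only [armPsi, armInfluence, s.treat_eq, s.label_eq, s.reg_eq, s.proj_eq, s.outcome_eq]
    rcases ind_eq_zero_or_one (R w || full) with h0 | h0 <;> simp [h0]

/-- The least favourable score, as a function of the covariates and all potential variables. -/
noncomputable def fullScore (full : Bool) (U : 𝒳 × 𝒮 → 𝒰) (e r μ : Bool → 𝒳 → ℝ)
    (M : Bool → 𝒰 → ℝ) (δ : ℝ) (z : 𝒳 × (Bool → 𝒮) × (Bool → ℝ)) : ℝ :=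
  μ true z.1 - μ false z.1 - δ
    + armScore full U (e true) (r true) (μ true) (M true) (z.1, z.2.1 true, z.2.2 true)
    - armScore full U (e false) (r false) (μ false) (M false) (z.1, z.2.1 false, z.2.2 false)

theorem measurable_fullScore {e r μ : Bool → 𝒳 → ℝ} {M : Bool → 𝒰 → ℝ} {δ : ℝ}
    (h : ∀ a, IsArmLaw ε P a (e a) (r a)) (hU : Measurable U)
    (hμ : ∀ a, Measurable (μ a)) (hM : ∀ a, Measurable (M a)) :
    Measurable (fullScore full U e r μ M δ) := by
  have m1 := fun a => measurable_armScore (full := full) (h a) hU (hμ a) (hM a)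
  have m2 : ∀ a : Bool, Measurable fun z : 𝒳 × (Bool → 𝒮) × (Bool → ℝ) =>
      (z.1, z.2.1 a, z.2.2 a) := fun a => by fun_prop
  exact (((((hμ true).comp measurable_fst).sub ((hμ false).comp measurable_fst)).sub_const δ).add
    ((m1 true).comp (m2 true))).sub ((m1 false).comp (m2 false))

variable {K : Bool → Kernel 𝒳 (𝒮 × ℝ)} [∀ a, IsMarkovKernel (K a)] [IsProbabilityMeasure P]
  {e r : Bool → 𝒳 → ℝ}

theorem integral_coarse_recouple {F : 𝒳 × Bool × 𝒮 × ℝ × Bool → ℝ} (hF : Measurable F) :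
    ∫ w, F (coarse w) ∂recouple P K = ∫ w, F (coarse w) ∂P := by
  rw [← integral_map measurable_coarse.aemeasurable hF.aestronglyMeasurable, map_coarse_recouple,
    integral_map measurable_coarse.aemeasurable hF.aestronglyMeasurable]

theorem integrable_arm_recouple (h : ∀ a, IsArmLaw ε P a (e a) (r a)) (hε : 0 < ε)
    (hsum : ∀ x, e true x + e false x = 1) (hK : ∀ a, P.map X ⊗ₘ K a = P.map (arm a))
    {b : 𝒳 × 𝒮 × ℝ → ℝ} (hb : Measurable b) (a : Bool) :
    Integrable (fun w => b (arm a w)) (recouple P K) ↔ Integrable (fun w => b (arm a w)) P := by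
  have hm : Measurable (arm a : FullData 𝒳 𝒮 → _) := measurable_arm a
  have h1 := integrable_map_measure (μ := recouple P K) hb.aestronglyMeasurable hm.aemeasurable
  have h2 := integrable_map_measure (μ := P) hb.aestronglyMeasurable hm.aemeasurable
  rw [map_arm_recouple h hε hsum hK] at h1
  exact h1.symm.trans h2

theorem integral_arm_recouple (h : ∀ a, IsArmLaw ε P a (e a) (r a)) (hε : 0 < ε)
    (hsum : ∀ x, e true x + e false x = 1) (hK : ∀ a, P.map X ⊗ₘ K a = P.map (arm a))
    {b : 𝒳 × 𝒮 × ℝ → ℝ} (hb : Measurable b) (a : Bool) :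
    ∫ w, b (arm a w) ∂recouple P K = ∫ w, b (arm a w) ∂P := by
  have hm : Measurable (arm a : FullData 𝒳 𝒮 → _) := measurable_arm a
  rw [← integral_map hm.aemeasurable hb.aestronglyMeasurable, map_arm_recouple h hε hsum hK,
    integral_map hm.aemeasurable hb.aestronglyMeasurable]

/-- On the other arm the variables of arm a are redrawn and the score averages to zero given X. On
arm a the integrand is a function of the data that redrawing preserves, so the integral may be taken
under P. -/
theorem Scheme.integral_mul_armScore_recouple (s : Scheme obs full U)
    (h : ∀ a, IsArmLaw ε P a (e a) (r a)) (hε : 0 < ε)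
    (hsum : ∀ x, e true x + e false x = 1) (hK : ∀ a, P.map X ⊗ₘ K a = P.map (arm a))
    (hY : ∀ a, MemLp (Ypot a) 2 P)
    (hμ : IsArmMean P a Prod.fst μ) (hM : IsArmMean P a U M)
    {G : O → ℝ} (hG : Measurable G) (hGC : ∃ C, ∀ u, |G u| ≤ C) :
    ∫ w, G (obs w) * armScore full U (e a) (r a) μ M (arm a w) ∂recouple P K
      = ∫ w, G (obs w) * (armPsi full U a (e a) (r a) μ M w - μ (X w)) ∂P := by
  obtain ⟨C, hC⟩ := hGC
  have mb := measurable_armScore (full := full) (h a) s.measurable_U hμ.measurable_mean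
    hM.measurable_mean
  have mc := s.measurable_code
  have hbi := (memLp_armScore (full := full) (h a) hε (hY a) hμ hM).integrable one_le_two
  have mG : Measurable fun w => G (obs w) := hG.comp s.measurable_obs
  have i1 := integrable_mul_of_bounded mG (fun w => hC _)
    ((integrable_arm_recouple h hε hsum hK mb a).2 hbi)
  have hcompl : {w : FullData 𝒳 𝒮 | T w = a}ᶜ = {w | T w = !a} := by
    ext w; cases a <;> simp
  rw [← integral_add_compl (measurableSet_arm a) i1, hcompl,
    ← s.integral_arm_mul_armScore (h a) hε hY hμ hM hG ⟨C, hC⟩]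
  have z := setIntegral_other_arm_eq_zero h hε hsum hK a mb hbi
    (fun φ hφ hφC => integral_mul_armScore (h a) hε (hY a) hμ hM s.measurable_proj
      s.proj_eq hφ hφC) (G := fun c => G (s.code c)) (hG.comp mc) (fun u => hC _)
  have e1 : ∀ w, G (s.code (coarse w)) = G (obs w) := fun w => by rw [s.obs_eq]; rfl
  simp only [e1] at z
  simp only [z, add_zero]
  rw [setIntegral_arm_eq, setIntegral_arm_eq]
  have m1 : Measurable fun c : 𝒳 × Bool × 𝒮 × ℝ × Bool => ind (c.2.1 == a) * (G (s.code c)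
      * armScore full U (e a) (r a) μ M (c.1, c.2.2.1, c.2.2.2.1)) := by
    have m2 : Measurable fun c : 𝒳 × Bool × 𝒮 × ℝ × Bool => ind (c.2.1 == a) :=
      (measurable_ind_eq a).comp (measurable_fst.comp measurable_snd)
    have m3 : Measurable fun c : 𝒳 × Bool × 𝒮 × ℝ × Bool => (c.1, c.2.2.1, c.2.2.2.1) := by fun_prop
    exact m2.mul ((hG.comp mc).mul (mb.comp m3))
  have e2 : ∀ w : FullData 𝒳 𝒮, ind (T w == a) * (G (obs w) * armScore full U (e a) (r a)
      μ M (arm a w))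
      = ind (T w == a) * (G (s.code (coarse w))
        * armScore full U (e a) (r a) μ M (X w, S w, Y w)) := by
    intro w
    rw [e1]
    by_cases hT : T w = a
    · simp only [S, Y, hT, arm]
    · have : (T w == a) = false := by simpa using hT
      simp [this, ind]
  simp only [e2]
  exact integral_coarse_recouple m1

variable {μ : Bool → 𝒳 → ℝ} {M : Bool → 𝒰 → ℝ} {δ : ℝ}

theorem memLp_arm_recouple (h : ∀ a, IsArmLaw ε P a (e a) (r a)) (hε : 0 < ε)
    (hsum : ∀ x, e true x + e false x = 1) (hK : ∀ a, P.map X ⊗ₘ K a = P.map (arm a))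
    {b : 𝒳 × 𝒮 × ℝ → ℝ} (hb : Measurable b) {a : Bool} (hP : MemLp (fun w => b (arm a w)) 2 P) :
    MemLp (fun w => b (arm a w)) 2 (recouple P K) := by
  have hm : Measurable (arm a : FullData 𝒳 𝒮 → _) := measurable_arm a
  refine (memLp_two_iff_integrable_sq (hb.comp hm).aestronglyMeasurable).2 ?_
  exact (integrable_arm_recouple h hε hsum hK (hb.pow_const 2) a).2 hP.integrable_sq

theorem memLp_fullScore_recouple (h : ∀ a, IsArmLaw ε P a (e a) (r a)) (hε : 0 < ε)
    (hsum : ∀ x, e true x + e false x = 1) (hK : ∀ a, P.map X ⊗ₘ K a = P.map (arm a))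
    (hY : ∀ a, MemLp (Ypot a) 2 P) (hU : Measurable U)
    (hμ : ∀ a, IsArmMean P a Prod.fst (μ a)) (hM : ∀ a, IsArmMean P a U (M a)) :
    MemLp (fun w => fullScore full U e r μ M δ (core w)) 2 (recouple P K) := by
  have l1 := fun a => memLp_arm_recouple h hε hsum hK
    (measurable_armScore (full := full) (h a) hU (hμ a).measurable_mean (hM a).measurable_mean)
    (memLp_armScore (full := full) (h a) hε (hY a) (hμ a) (hM a))
  have l2 := fun a => memLp_arm_recouple h hε hsum hK (a := a)
    ((hμ a).measurable_mean.comp measurable_fst) (hμ a).memLp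
  exact ((((l2 true).sub (l2 false)).sub (memLp_const δ)).add (l1 true)).sub (l1 false)

/-- The efficient influence function is the conditional expectation of the least favourable score
given the observed data. -/
theorem Scheme.integral_mul_fullScore (s : Scheme obs full U)
    (h : ∀ a, IsArmLaw ε P a (e a) (r a)) (hε : 0 < ε)
    (hsum : ∀ x, e true x + e false x = 1) (hK : ∀ a, P.map X ⊗ₘ K a = P.map (arm a))
    (hY : ∀ a, MemLp (Ypot a) 2 P)
    (hμ : ∀ a, IsArmMean P a Prod.fst (μ a)) (hM : ∀ a, IsArmMean P a U (M a))
    {G : O → ℝ} (hG : Measurable G) (hGC : ∃ C, ∀ u, |G u| ≤ C) :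
    ∫ w, G (obs w) * fullScore full U e r μ M δ (core w) ∂recouple P K
      = ∫ w, G (obs w) * schemePsi full U e r μ M δ w ∂P := by
  obtain ⟨C, hC⟩ := hGC
  have mG : Measurable fun w => G (obs w) := hG.comp s.measurable_obs
  have ib : ∀ (m : Measure (FullData 𝒳 𝒮)) (f : FullData 𝒳 𝒮 → ℝ), Integrable f m →
      Integrable (fun w => G (obs w) * f w) m := fun m f hf =>
    integrable_mul_of_bounded mG (fun w => hC _) hf
  have lP := fun a => ((memLp_armPsi (full := full) hε (h a) hY s.measurable_U (hμ a) (hM a)).sub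
    (hμ a).memLp).integrable one_le_two
  have lQ := fun a => (memLp_arm_recouple h hε hsum hK
    (measurable_armScore (full := full) (h a) s.measurable_U (hμ a).measurable_mean
      (hM a).measurable_mean)
    (memLp_armScore (full := full) (h a) hε (hY a) (hμ a) (hM a))).integrable one_le_two
  have l2P : Integrable (fun w => μ true (X w) - μ false (X w) - δ) P :=
    (((hμ true).memLp.sub (hμ false).memLp).sub (memLp_const δ)).integrable one_le_two
  have l2 := fun a => memLp_arm_recouple h hε hsum hK (a := a)
    ((hμ a).measurable_mean.comp measurable_fst) (hμ a).memLp
  have l2Q : Integrable (fun w => μ true (X w) - μ false (X w) - δ) (recouple P K) :=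
    (((l2 true).sub (l2 false)).sub (memLp_const δ)).integrable one_le_two
  have key := fun a => s.integral_mul_armScore_recouple h hε hsum hK hY (hμ a) (hM a) hG ⟨C, hC⟩
  have key0 : ∫ w, G (obs w) * (μ true (X w) - μ false (X w) - δ) ∂recouple P K
      = ∫ w, G (obs w) * (μ true (X w) - μ false (X w) - δ) ∂P := by
    have m1 : Measurable fun c : 𝒳 × Bool × 𝒮 × ℝ × Bool =>
        G (s.code c) * (μ true c.1 - μ false c.1 - δ) :=
      (hG.comp s.measurable_code).mul ((((hμ true).measurable_mean.comp measurable_fst).sub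
        ((hμ false).measurable_mean.comp measurable_fst)).sub_const δ)
    have := integral_coarse_recouple (P := P) (K := K) m1
    have e1 : ∀ w, G (s.code (coarse w)) = G (obs w) := fun w => by rw [s.obs_eq]; rfl
    simp only [e1] at this
    exact this
  have q1 := integral_sub ((ib _ _ l2Q).add (ib _ _ (lQ true))) (ib _ _ (lQ false))
  have q2 := integral_add (ib _ _ l2Q) (ib _ _ (lQ true))
  have p1 := integral_sub ((ib _ _ l2P).add (ib _ _ (lP true))) (ib _ _ (lP false))
  have p2 := integral_add (ib _ _ l2P) (ib _ _ (lP true))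
  simp only [Pi.add_apply] at q1 p1
  rw [q2, key, key, key0] at q1
  simp only [Pi.sub_apply] at p1 p2
  rw [p2] at p1
  refine Eq.trans ?_ (q1.trans (p1.symm.trans ?_))
  · refine integral_congr_ae (ae_of_all _ fun w => ?_)
    simp only [fullScore, core, arm, Spot, Ypot]
    ring
  · refine integral_congr_ae (ae_of_all _ fun w => ?_)
    simp only [schemePsi]
    ring

end Score

/-! ### Laws with density 1 + t h -/

section Tilt

variable {F : Type*} [MeasurableSpace F]

/-- The parameter `t`, cut off where `t C` leaves `[-1, 1]`. -/
noncomputable def cutoff (C t : ℝ) : ℝ := if |t| * C ≤ 1 then t else 0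

theorem abs_cutoff_mul_le (C t : ℝ) : |cutoff C t| * C ≤ 1 := by
  unfold cutoff
  split_ifs with h
  · exact h
  · simp

theorem cutoff_zero (C : ℝ) : cutoff C 0 = 0 := by
  unfold cutoff; split_ifs <;> rfl

theorem eventually_cutoff_eq (C : ℝ) : ∀ᶠ t in 𝓝 0, cutoff C t = t := by
  have h : Tendsto (fun t : ℝ => |t| * C) (𝓝 0) (𝓝 (|0| * C)) :=
    (continuous_abs.mul continuous_const).tendsto 0
  rw [abs_zero, zero_mul] at h
  filter_upwards [h.eventually_le_const zero_lt_one] with t ht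
  exact if_pos ht

theorem cutoff_mul_mem {C t u : ℝ} (hu : |u| ≤ C) : 1 + cutoff C t * u ∈ Set.Icc 0 2 := by
  have h : |cutoff C t * u| ≤ 1 := by
    rw [abs_mul]
    exact (mul_le_mul_of_nonneg_left hu (abs_nonneg _)).trans (abs_cutoff_mul_le C t)
  constructor <;> linarith [(abs_le.1 h).1, (abs_le.1 h).2]

/-- The law with density `1 + t h`. -/
noncomputable def tilt (m : Measure F) (C : ℝ) (h : F → ℝ) (t : ℝ) : Measure F :=
  m.withDensity fun w => ENNReal.ofReal (1 + cutoff C t * h w)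

variable {m : Measure F} {C : ℝ} {h : F → ℝ}

theorem tilt_zero : tilt m C h 0 = m := by simp [tilt, cutoff_zero]

theorem integrable_of_bounded [IsFiniteMeasure m] (hh : Measurable h) (hC : ∀ w, |h w| ≤ C) :
    Integrable h m :=
  integrable_of_abs_le (integrable_const C) hh.aestronglyMeasurable hC

theorem isProbabilityMeasure_tilt [IsProbabilityMeasure m] (hh : Measurable h)
    (hC : ∀ w, |h w| ≤ C) (h0 : ∫ w, h w ∂m = 0) (t : ℝ) : IsProbabilityMeasure (tilt m C h t) := by
  have hi := integrable_of_bounded (m := m) hh hC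
  have hi1 : Integrable (fun w => 1 + cutoff C t * h w) m :=
      (integrable_const 1).add (hi.const_mul _)
  refine ⟨?_⟩
  rw [tilt, withDensity_apply _ MeasurableSet.univ, Measure.restrict_univ,
    ← ofReal_integral_eq_lintegral_ofReal hi1
      (ae_of_all _ fun w => (cutoff_mul_mem (hC w)).1),
    integral_add (integrable_const 1) (hi.const_mul _), integral_const_mul, h0]
  simp

theorem tilt_le (hC : ∀ w, |h w| ≤ C) (t : ℝ) : tilt m C h t ≤ (2 : ℝ≥0∞) • m := by
  have : tilt m C h t ≤ m.withDensity fun _ => 2 := by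
    refine withDensity_mono (ae_of_all _ fun w => ?_)
    rw [← ENNReal.ofReal_ofNat]
    exact ENNReal.ofReal_le_ofReal (cutoff_mul_mem (hC w)).2
  simpa using this

theorem memLp_tilt (hC : ∀ w, |h w| ≤ C) (t : ℝ) {f : F → ℝ} (hf : MemLp f 2 m) :
    MemLp f 2 (tilt m C h t) :=
  (hf.smul_measure (by simp)).mono_measure (tilt_le hC t)

theorem integral_tilt_le (hC : ∀ w, |h w| ≤ C) (t : ℝ) {f : F → ℝ} (hf : Integrable f m)
    (hf0 : ∀ w, 0 ≤ f w) : ∫ w, f w ∂tilt m C h t ≤ 2 * ∫ w, f w ∂m := by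
  have h1 := integral_mono_measure (tilt_le (m := m) hC t) (ae_of_all _ hf0)
    (hf.smul_measure (by simp))
  simpa using h1

/-- The density of the image law is the conditional mean of 1 + t h given the observed data, so the
observed laws are tilted by the conditional mean of h, with the same cutoff. -/
theorem map_tilt {O : Type*} [MeasurableSpace O] [IsFiniteMeasure m] {obs : F → O}
    (hobs : Measurable obs) (hh : Measurable h) (hC : ∀ w, |h w| ≤ C) {g : O → ℝ} (hg :
        Measurable g)
    (hgC : ∀ o, |g o| ≤ C)
    (heq : ∀ B, MeasurableSet B → ∫ w in obs ⁻¹' B, h w ∂m = ∫ w in obs ⁻¹' B, g (obs w) ∂m) (t : ℝ)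
        :
    (tilt m C h t).map obs = tilt (m.map obs) C g t := by
  ext B hB
  have hi := integrable_of_bounded (m := m) hh hC
  have hi' : Integrable (fun w => g (obs w)) m :=
    integrable_of_bounded (hg.comp hobs) fun w => hgC (obs w)
  have hi1 : Integrable (fun w => 1 + cutoff C t * h w) m :=
      (integrable_const 1).add (hi.const_mul _)
  have hi2 : Integrable (fun w => 1 + cutoff C t * g (obs w)) m :=
    (integrable_const 1).add (hi'.const_mul _)
  have hm : Measurable fun o => ENNReal.ofReal (1 + cutoff C t * g o) := by fun_prop
  rw [Measure.map_apply hobs hB, tilt, tilt, withDensity_apply _ (hobs hB), withDensity_apply _ hB,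
    setLIntegral_map hB hm hobs,
    ← ofReal_integral_eq_lintegral_ofReal hi1.integrableOn
      (ae_of_all _ fun w => (cutoff_mul_mem (hC w)).1),
    ← ofReal_integral_eq_lintegral_ofReal hi2.integrableOn
      (ae_of_all _ fun w => (cutoff_mul_mem (hgC (obs w))).1),
    integral_add (integrable_const 1) (hi.const_mul _).integrableOn,
    integral_add (integrable_const 1) (hi'.const_mul _).integrableOn, integral_const_mul,
    integral_const_mul, heq B hB]

theorem exists_bounded_condMean {O : Type*} [MeasurableSpace O] [IsProbabilityMeasure m] {obs : F →
    O}
    (hobs : Measurable obs) (hh : Measurable h) (hC0 : 0 ≤ C) (hC : ∀ w, |h w| ≤ C) :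
    ∃ g : O → ℝ, Measurable g ∧ (∀ o, |g o| ≤ C) ∧
      ∀ B, MeasurableSet B → ∫ w in obs ⁻¹' B, h w ∂m = ∫ w in obs ⁻¹' B, g (obs w) ∂m := by
  have hi := integrable_of_bounded (m := m) hh hC
  obtain ⟨g, hg⟩ := exists_isRegression m h Set.univ obs
  refine ⟨fun o => clamp (-C) C (g o), (measurable_clamp _ _).comp hg.1,
    fun o => abs_clamp_le hC0 _, fun B hB => ?_⟩
  have h1 := hg.setIntegral_eq hobs hi.integrableOn hB
  rw [Set.univ_inter] at h1
  rw [h1]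
  refine integral_congr_ae (ae_restrict_of_ae ?_)
  have h2 := hg.2
  rw [cond_univ] at h2
  -- A conditional mean of a function bounded by C is almost surely bounded by C, so clamping gives
  -- a version that is bounded everywhere.
  filter_upwards [h2, ae_bdd_abs_condExp_of_ae_bdd_abs
    (m := MeasurableSpace.comap obs inferInstance) (ae_of_all m hC)] with w w1 w2
  rw [← w1]
  exact (clamp_eq_self (abs_le.1 w2)).symm

end Tilt

/-! ### Regular submodels through a randomized law -/

section Submodel

variable {𝒳 𝒮 O : Type*} [MeasurableSpace 𝒳] [MeasurableSpace 𝒮] [MeasurableSpace O]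
  [StandardBorelSpace 𝒳] [StandardBorelSpace 𝒮] {obs : FullData 𝒳 𝒮 → O} {ε C : ℝ}
  {P Q : ProbabilityMeasure (FullData 𝒳 𝒮)} {e : 𝒳 → ℝ} {r : Bool → 𝒳 → ℝ} {knowE knowR : Prop}
  {h : 𝒳 × (Bool → 𝒮) × (Bool → ℝ) → ℝ}

theorem IsRegression.of_ae_eq {F 𝒰 : Type*} [MeasurableSpace F] [MeasurableSpace 𝒰]
    {Q : Measure F} {Z : F → ℝ} {A : Set F} {U : F → 𝒰} {m m' : 𝒰 → ℝ} (h : IsRegression Q Z A U m)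
    (hm' : Measurable m') (he : ∀ᵐ w ∂Q, m (U w) = m' (U w)) : IsRegression Q Z A U m' := by
  refine ⟨hm', h.2.trans ?_⟩
  have : Q[|A] ≪ Q := ProbabilityTheory.cond_absolutelyContinuous
  exact this.ae_le he

/-- Tilting a randomized law in the direction of a bounded function of the covariates and all
potential variables yields a regular submodel. -/
theorem exists_isRegularSubmodel (hobs : Measurable obs) (hε : 0 < ε)
    (hQ : IsRandomized ε (Q : Measure (FullData 𝒳 𝒮)) (treatProb ε e) (labelProb ε r))
    (he : Measurable e) (hr : ∀ a, Measurable (r a))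
    (hee : ∀ᵐ w ∂(Q : Measure (FullData 𝒳 𝒮)), treatProb ε e true (X w) = e (X w))
    (hre : ∀ a, ∀ᵐ w ∂(Q : Measure (FullData 𝒳 𝒮)), labelProb ε r a (X w) = r a (X w))
    (hY : ∀ a, MemLp (Ypot a) 2 (Q : Measure (FullData 𝒳 𝒮)))
    (hobsQ : (Q : Measure (FullData 𝒳 𝒮)).map obs = (P : Measure (FullData 𝒳 𝒮)).map obs)
    (hh : Measurable h) (hC0 : 0 ≤ C) (hC : ∀ z, |h z| ≤ C)
    (h0 : ∫ w, h (core w) ∂(Q : Measure (FullData 𝒳 𝒮)) = 0) :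
    ∃ D g, IsRegularSubmodel (model ε e r knowE knowR) obs P D g ∧ Measurable g ∧ (∀ o, |g o| ≤ C) ∧
      ∀ B, MeasurableSet B → ∫ w in obs ⁻¹' B, h (core w) ∂(Q : Measure (FullData 𝒳 𝒮))
        = ∫ w in obs ⁻¹' B, g (obs w) ∂(Q : Measure (FullData 𝒳 𝒮)) := by
  have hhc : Measurable fun w : FullData 𝒳 𝒮 => h (core w) := hh.comp measurable_core
  have hCc : ∀ w : FullData 𝒳 𝒮, |h (core w)| ≤ C := fun w => hC _
  obtain ⟨g, hg, hgC, hgeq⟩ := exists_bounded_condMean (m := (Q : Measure (FullData 𝒳 𝒮))) hobs hhc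
    hC0 hCc
  have hprob := isProbabilityMeasure_tilt hhc hCc h0
  let D : ℝ → ProbabilityMeasure (FullData 𝒳 𝒮) := fun t =>
    ⟨tilt (Q : Measure (FullData 𝒳 𝒮)) C (fun w => h (core w)) t, hprob t⟩
  have hDY : ∀ t a, MemLp (Ypot a) 2 (D t : Measure (FullData 𝒳 𝒮)) := fun t a =>
    memLp_tilt hCc t (hY a)
  -- The direction is a function of `core`, so the scores do not move with t; this is why `knowE`
  -- and `knowR` are irrelevant.
  have hrand : ∀ t, IsRandomized ε (D t : Measure (FullData 𝒳 𝒮)) (treatProb ε e) (labelProb ε r) :=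
    fun t => hQ.withDensity (f := fun z => ENNReal.ofReal (1 + cutoff C t * h z)) (by fun_prop)
  have hac : ∀ t, (D t : Measure (FullData 𝒳 𝒮)) ≪ (Q : Measure (FullData 𝒳 𝒮)) := fun t =>
    withDensity_absolutelyContinuous _ _
  have hmap : ∀ t, (D t : Measure (FullData 𝒳 𝒮)).map obs
      = tilt ((Q : Measure (FullData 𝒳 𝒮)).map obs) C g t := fun t =>
    map_tilt hobs hhc hCc hg hgC hgeq t
  have hpQ : IsProbabilityMeasure ((Q : Measure (FullData 𝒳 𝒮)).map obs) :=
    Measure.isProbabilityMeasure_map hobs.aemeasurable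
  refine ⟨D, g, ⟨fun t => ⟨(hrand t).assumptions hε (hDY t), fun _ => ?_, fun _ a => ?_⟩, ?_, ?_,
      ?_⟩,
    hg, hgC, hgeq⟩
  · exact ((hrand t).isTreatmentPropensity hε).of_ae_eq he ((hac t).ae_le hee)
  · exact ((hrand t).isLabelPropensity hε a).of_ae_eq (hr a) ((hac t).ae_le (hre a))
  · rw [hmap 0, tilt_zero, hobsQ]
  · exact isQMD_of_withDensity hg hgC (abs_cutoff_mul_le C) (cutoff_zero C) (eventually_cutoff_eq C)
      hmap
  · refine ⟨2 * ∫ w, Ypot true w ^ 2 ∂(Q : Measure (FullData 𝒳 𝒮))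
      + 2 * ∫ w, Ypot false w ^ 2 ∂(Q : Measure (FullData 𝒳 𝒮)), fun t a => ?_⟩
    have h1 := integral_tilt_le (m := (Q : Measure (FullData 𝒳 𝒮))) hCc t (hY a).integrable_sq
      fun w => sq_nonneg _
    have h2 : ∀ a, 0 ≤ ∫ w, Ypot a w ^ 2 ∂(Q : Measure (FullData 𝒳 𝒮)) := fun a =>
      integral_nonneg fun w => sq_nonneg _
    refine h1.trans ?_
    cases a <;> linarith [h2 true, h2 false]

end Submodel

/-! ### Efficiency for a general observation scheme -/

section Efficient

variable {𝒳 𝒮 𝒰 O : Type*} [MeasurableSpace 𝒳] [MeasurableSpace 𝒮] [MeasurableSpace 𝒰]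
  [MeasurableSpace O] {obs : FullData 𝒳 𝒮 → O} {full : Bool} {U : 𝒳 × 𝒮 → 𝒰} {ε : ℝ}

theorem integral_sub_mean_sq_le {F : Type*} [MeasurableSpace F] {m : Measure F}
    [IsProbabilityMeasure m] {f : F → ℝ} (hf : MemLp f 2 m) {c : ℝ} (hc : ∫ w, f w ∂m = c) :
    ∫ w, (f w - c) ^ 2 ∂m ≤ ∫ w, f w ^ 2 ∂m := by
  have i1 := hf.integrable_sq
  have i2 := (hf.integrable one_le_two).const_mul (2 * c)
  have h1 := integral_add (i1.sub i2) (integrable_const (c ^ 2))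
  have h2 := integral_sub i1 i2
  simp only [Pi.sub_apply] at h1
  rw [h2, integral_const_mul, hc, integral_const, probReal_univ, one_smul] at h1
  have h3 : ∫ w, (f w - c) ^ 2 ∂m = ∫ w, f w ^ 2 - 2 * c * f w + c ^ 2 ∂m :=
    integral_congr_ae (ae_of_all _ fun w => by ring)
  rw [h3, h1]
  nlinarith [sq_nonneg c]

theorem integral_fullScore_recouple {P : Measure (FullData 𝒳 𝒮)} [IsProbabilityMeasure P]
    {K : Bool → Kernel 𝒳 (𝒮 × ℝ)} [∀ a, IsMarkovKernel (K a)]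
    {e r μ : Bool → 𝒳 → ℝ} {M : Bool → 𝒰 → ℝ}
    (h : ∀ a, IsArmLaw ε P a (e a) (r a)) (hε : 0 < ε)
    (hsum : ∀ x, e true x + e false x = 1) (hK : ∀ a, P.map X ⊗ₘ K a = P.map (arm a))
    (hY : ∀ a, MemLp (Ypot a) 2 P) (hU : Measurable U) {p : 𝒰 → 𝒳} (hp : Measurable p)
    (hpU : ∀ z, p (U z) = z.1)
    (hμ : ∀ a, IsArmMean P a Prod.fst (μ a)) (hM : ∀ a, IsArmMean P a U (M a)) :
    ∫ w, fullScore full U e r μ M (∫ w, Ypot true w ∂P - ∫ w, Ypot false w ∂P) (core w)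
      ∂recouple P K = 0 := by
  set δ := ∫ w, Ypot true w ∂P - ∫ w, Ypot false w ∂P with hδ
  have mb := fun a => measurable_armScore (full := full) (h a) hU (hμ a).measurable_mean
    (hM a).measurable_mean
  have mm : ∀ a, Measurable fun z : 𝒳 × 𝒮 × ℝ => μ a z.1 := fun a =>
    (hμ a).measurable_mean.comp measurable_fst
  have l1 := fun a => (memLp_arm_recouple h hε hsum hK (mb a)
    (memLp_armScore (full := full) (h a) hε (hY a) (hμ a) (hM a))).integrable one_le_two
  have l2 := fun a => (memLp_arm_recouple h hε hsum hK (a := a) (mm a)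
    (hμ a).memLp).integrable one_le_two
  have z1 : ∀ a, ∫ w, armScore full U (e a) (r a) (μ a) (M a) (arm a w) ∂recouple P K = 0 := by
    intro a
    rw [integral_arm_recouple h hε hsum hK (mb a)]
    simpa using integral_mul_armScore (full := full) (h a) hε (hY a) (hμ a) (hM a) hp hpU
      (φ := fun _ => 1) measurable_const ⟨1, by simp⟩
  have z2 : ∀ a, ∫ w, μ a (arm a w).1 ∂recouple P K = ∫ w, Ypot a w ∂P := by
    intro a
    rw [integral_arm_recouple h hε hsum hK (mm a)]
    have h1 := (hμ a).integral_eq_zero (fun _ => 1) measurable_const ⟨1, by simp⟩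
    simp only [one_mul] at h1
    rw [integral_sub ((hY a).integrable one_le_two) ((hμ a).memLp.integrable one_le_two)] at h1
    exact (sub_eq_zero.1 h1).symm
  have s1 := integral_sub (l2 true) (l2 false)
  have s2 := integral_sub ((l2 true).sub (l2 false)) (integrable_const δ)
  have s3 := integral_add (((l2 true).sub (l2 false)).sub (integrable_const δ)) (l1 true)
  have s4 := integral_sub ((((l2 true).sub (l2 false)).sub (integrable_const δ)).add (l1 true))
    (l1 false)
  simp only [Pi.sub_apply, Pi.add_apply] at s2 s3 s4
  rw [s3, s2, s1, z1, z1, z2, z2, integral_const, probReal_univ, one_smul, ← hδ, sub_self, add_zero,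
    sub_zero] at s4
  exact s4

variable [StandardBorelSpace 𝒳] [StandardBorelSpace 𝒮]

/-- The influence function is the conditional mean of `fullScore` given the observed data under the
recoupled law. Truncated and recentred versions of `fullScore` are bounded directions of regular
submodels, and their conditional means are scores converging to the influence function. -/
theorem Scheme.isEfficient (s : Scheme obs full U) (hε₀ : 0 < ε) (hε₁ : ε < 1 / 2)
    {P : ProbabilityMeasure (FullData 𝒳 𝒮)} (hP : Assumptions ε P) {e : 𝒳 → ℝ} {r μ : Bool → 𝒳 → ℝ}
    {M : Bool → 𝒰 → ℝ} (he : IsTreatmentPropensity (P : Measure (FullData 𝒳 𝒮)) e)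
    (hr : IsLabelPropensity (P : Measure (FullData 𝒳 𝒮)) r)
    (hμ : ∀ a, IsArmMean (P : Measure (FullData 𝒳 𝒮)) a Prod.fst (μ a))
    (hM : ∀ a, IsArmMean (P : Measure (FullData 𝒳 𝒮)) a U (M a)) (knowE knowR : Prop) :
    IsEfficient (model ε e r knowE knowR) obs ate P
      (schemePsi full U (treatProb ε e) (labelProb ε r) μ M (ate P)) := by
  have hobs := s.measurable_obs
  have h := hP.isArmLaw hε₀ hε₁ he hr
  have hsum := sum_treatProb ε e
  have hY := hP.memLp
  obtain ⟨w₀⟩ : Nonempty (FullData 𝒳 𝒮) := (P : Measure (FullData 𝒳 𝒮)).nonempty_of_neZero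
  have : Nonempty 𝒮 := ⟨S w₀⟩
  let K : Bool → Kernel 𝒳 (𝒮 × ℝ) := fun a =>
    condDistrib (fun w => (Spot a w, Ypot a w)) X (P : Measure (FullData 𝒳 𝒮))
  have hKm : ∀ a, IsMarkovKernel (K a) := fun a => by unfold K; infer_instance
  have hK : ∀ a, (P : Measure (FullData 𝒳 𝒮)).map X ⊗ₘ K a
      = (P : Measure (FullData 𝒳 𝒮)).map (arm a) := fun a =>
    compProd_map_condDistrib ((measurable_Spot a).prodMk (measurable_Ypot a)).aemeasurable
  set Q : Measure (FullData 𝒳 𝒮) := recouple (P : Measure (FullData 𝒳 𝒮)) K with hQdef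
  have hQp : IsProbabilityMeasure Q := by unfold Q; infer_instance
  have hQ : IsRandomized ε Q (treatProb ε e) (labelProb ε r) := isRandomized_recouple h hε₀ hsum hK
  have hcoarse : Q.map coarse = (P : Measure (FullData 𝒳 𝒮)).map coarse := map_coarse_recouple
  have hobsQ : Q.map obs = (P : Measure (FullData 𝒳 𝒮)).map obs := by
    have e1 : obs = s.code ∘ coarse := funext s.obs_eq
    rw [e1, ← Measure.map_map s.measurable_code measurable_coarse, hcoarse,
      Measure.map_map s.measurable_code measurable_coarse]
  have hXQ : Q.map X = (P : Measure (FullData 𝒳 𝒮)).map X := by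
    have e1 : (X : FullData 𝒳 𝒮 → 𝒳) = Prod.fst ∘ coarse := rfl
    rw [e1, ← Measure.map_map measurable_fst measurable_coarse, hcoarse,
      Measure.map_map measurable_fst measurable_coarse]
  have haeX : ∀ f g : 𝒳 → ℝ, Measurable f → Measurable g →
      (∀ᵐ w ∂(P : Measure (FullData 𝒳 𝒮)), f (X w) = g (X w)) → ∀ᵐ w ∂Q, f (X w) = g (X w) := by
    intro f g hf hg hfg
    have hs : MeasurableSet {x | f x = g x} := measurableSet_eq_fun hf hg
    refine (ae_map_iff measurable_X.aemeasurable hs).1 ?_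
    rw [hXQ]
    exact (ae_map_iff measurable_X.aemeasurable hs).2 hfg
  have hYQ : ∀ a, MemLp (Ypot a) 2 Q := fun a =>
    memLp_arm_recouple h hε₀ hsum hK (b := fun z => z.2.2) (by fun_prop) (hY a)
  let H : 𝒳 × (Bool → 𝒮) × (Bool → ℝ) → ℝ :=
    fullScore full U (treatProb ε e) (labelProb ε r) μ M (ate P)
  have mH : Measurable H := measurable_fullScore h s.measurable_U (fun a => (hμ a).measurable_mean)
    fun a => (hM a).measurable_mean
  have mHc : Measurable fun w : FullData 𝒳 𝒮 => H (core w) := mH.comp measurable_core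
  have lH : MemLp (fun w => H (core w)) 2 Q :=
    memLp_fullScore_recouple h hε₀ hsum hK hY s.measurable_U hμ hM
  have zH : ∫ w, H (core w) ∂Q = 0 := integral_fullScore_recouple h hε₀ hsum hK hY s.measurable_U
    s.measurable_proj s.proj_eq hμ hM
  let c : ℕ → ℝ := fun n => ∫ w, clamp (-n) n (H (core w)) ∂Q
  -- Truncation destroys the mean zero, which a tilt needs in order to remain a probability;
  -- subtracting the mean restores it and leaves the bound 2n.
  let Hn : ℕ → 𝒳 × (Bool → 𝒮) × (Bool → ℝ) → ℝ := fun n z => clamp (-n) n (H z) - c n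
  have mHn : ∀ n, Measurable (Hn n) := fun n => ((measurable_clamp _ _).comp mH).sub_const _
  have bcl : ∀ (n : ℕ) z, |clamp (-n) n (H z)| ≤ n := fun n z => abs_clamp_le n.cast_nonneg _
  have icl : ∀ n : ℕ, Integrable (fun w => clamp (-n) n (H (core w))) Q := fun n =>
    integrable_of_bounded ((measurable_clamp _ _).comp mHc) fun w => bcl n _
  have bc : ∀ n : ℕ, |c n| ≤ n := fun n => by
    have h1 := norm_integral_le_of_norm_le_const (μ := Q) (C := n)
      (f := fun w => clamp (-n) n (H (core w))) (ae_of_all _ fun w => bcl n (core w))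
    simpa using h1
  have bHn : ∀ (n : ℕ) z, |Hn n z| ≤ n + n := fun n z =>
    (abs_sub _ _).trans (add_le_add (bcl n z) (bc n))
  have zHn : ∀ n, ∫ w, Hn n (core w) ∂Q = 0 := fun n => by
    simp only [Hn]
    rw [integral_sub (icl n) (integrable_const _), integral_const, probReal_univ, one_smul]
    exact sub_self _
  choose D g hD mg bg hg using fun n : ℕ => exists_isRegularSubmodel (knowE := knowE)
    (knowR := knowR) (P := P) (Q := ⟨Q, hQp⟩) hobs hε₀ hQ he.1 (fun a => (hr a).1)
    (haeX _ _ (measurable_treatProb he.1 true) he.1 (hP.ae_treatProb_true_eq he))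
    (fun a => haeX _ _ (measurable_labelProb (hr a).1) (hr a).1 (hP.ae_labelProb_eq hε₀ hε₁ hr a))
    hYQ hobsQ (mHn n) (by positivity : (0 : ℝ) ≤ n + n) (bHn n) (zHn n)
  have lψ := memLp_schemePsi (full := full) hε₀ h hY s.measurable_U hμ hM (ate P)
  refine isEfficient_of_tendsto hobs lψ
    (fun D g hD => hD.hasDerivAt_ate (fun _ hQ => hQ.1) hε₀ hε₁ s hY h hμ hM (ate P)) hD ?_
  choose Ψa mΨa hΨa using fun a => s.exists_armPsi_eq (h a) (hμ a).measurable_mean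
    (hM a).measurable_mean
  let Ψ : O → ℝ := fun o => Ψa true o - Ψa false o - ate P
  have mΨ : Measurable Ψ := ((mΨa true).sub (mΨa false)).sub_const _
  have hΨ : ∀ w, schemePsi full U (treatProb ε e) (labelProb ε r) μ M (ate P) w = Ψ (obs w) :=
    fun w => by simp only [schemePsi, hΨa, Ψ]
  have lΨQ : MemLp (fun w => Ψ (obs w)) 2 Q := by
    have h1 : MemLp (fun w => Ψ (obs w)) 2 (P : Measure (FullData 𝒳 𝒮)) :=
      lψ.ae_eq (ae_of_all _ hΨ)
    refine (memLp_map_measure_iff mΨ.aestronglyMeasurable hobs.aemeasurable).1 ?_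
    rw [hobsQ]
    exact (memLp_map_measure_iff mΨ.aestronglyMeasurable hobs.aemeasurable).2 h1
  -- The difference between influence function and score is the conditional mean of H − Hn given the
  -- observed data, so its L² norm is at most that of H − Hn. As H has mean zero, recentring does
  -- not increase the truncation error.
  have hbound : ∀ n, ∫ w, (schemePsi full U (treatProb ε e) (labelProb ε r) μ M (ate P) w
      - g n (obs w)) ^ 2 ∂(P : Measure (FullData 𝒳 𝒮))
      ≤ ∫ w, (H (core w) - clamp (-n) n (H (core w))) ^ 2 ∂Q := by
    intro n
    have m1 : Measurable fun o => (Ψ o - g n o) ^ 2 := (mΨ.sub (mg n)).pow_const 2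
    have e1 : ∫ w, (schemePsi full U (treatProb ε e) (labelProb ε r) μ M (ate P) w
        - g n (obs w)) ^ 2 ∂(P : Measure (FullData 𝒳 𝒮)) = ∫ w, (Ψ (obs w) - g n (obs w)) ^ 2 ∂Q :=
            by
      simp only [hΨ]
      rw [← integral_map hobs.aemeasurable m1.aestronglyMeasurable, ← hobsQ,
        integral_map hobs.aemeasurable m1.aestronglyMeasurable]
    have lcl : MemLp (fun w => clamp (-n) n (H (core w))) 2 Q :=
      MemLp.of_bound ((measurable_clamp _ _).comp mHc).aestronglyMeasurable n
        (ae_of_all _ fun w => bcl n _)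
    have lHn : MemLp (fun w => Hn n (core w)) 2 Q := lcl.sub (memLp_const _)
    have ig : Integrable (fun w => g n (obs w)) Q :=
      integrable_of_bounded ((mg n).comp hobs) fun w => bg n _
    have iΨ := lΨQ.integrable one_le_two
    rw [e1]
    refine (integral_sq_comp_le hobs (lH.sub lHn) (mΨ.sub (mg n)) (iΨ.sub ig) fun B hB =>
        ?_).trans ?_
    · simp only [Pi.sub_apply]
      rw [integral_sub iΨ.integrableOn ig.integrableOn,
        integral_sub (lH.integrable one_le_two).integrableOn (lHn.integrable one_le_two).integrableOn]
      congr 1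
      · have mB : Measurable (B.indicator (1 : O → ℝ)) := measurable_one.indicator hB
        have h1 := s.integral_mul_fullScore (δ := ate P) h hε₀ hsum hK hY hμ hM mB
          ⟨1, fun u => by by_cases hu : u ∈ B <;> simp [hu]⟩
        simp only [hΨ] at h1
        have e2 : ∀ (m : Measure (FullData 𝒳 𝒮)) (f : FullData 𝒳 𝒮 → ℝ),
            ∫ w in obs ⁻¹' B, f w ∂m = ∫ w, B.indicator (1 : O → ℝ) (obs w) * f w ∂m := by
          intro m f
          rw [← integral_indicator (hobs hB)]
          refine integral_congr_ae (ae_of_all _ fun w => ?_)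
          by_cases hw : obs w ∈ B <;> simp [hw, Set.indicator]
        rw [e2, e2, ← hQdef] at *
        refine Eq.trans ?_ h1.symm
        have m2 : Measurable fun o => B.indicator (1 : O → ℝ) o * Ψ o := mB.mul mΨ
        rw [← integral_map (f := fun o => B.indicator (1 : O → ℝ) o * Ψ o) hobs.aemeasurable
          m2.aestronglyMeasurable, hobsQ, integral_map hobs.aemeasurable m2.aestronglyMeasurable]
      · exact (hg n B hB).symm
    · have h2 : ∫ w, (H (core w) - clamp (-n) n (H (core w))) ∂Q = - c n := by
        rw [integral_sub (lH.integrable one_le_two) (icl n), zH, zero_sub]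
      refine le_trans (le_of_eq ?_) (integral_sub_mean_sq_le (lH.sub lcl) h2)
      refine integral_congr_ae (ae_of_all _ fun w => ?_)
      simp only [Hn, Pi.sub_apply]
      ring
  exact tendsto_of_tendsto_of_tendsto_of_le_of_le tendsto_const_nhds
    (tendsto_integral_sub_clamp_sq lH) (fun n => integral_nonneg fun w => sq_nonneg _) hbound

end Efficient

/-! ### The four settings as observation schemes -/

section Schemes

variable {𝒳 𝒮 : Type*} [MeasurableSpace 𝒳] [MeasurableSpace 𝒮]

theorem measurableSet_labelled :
    MeasurableSet {c : 𝒳 × Bool × 𝒮 × ℝ × Bool | c.2.2.2.2 = true} := by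
  have : Measurable fun c : 𝒳 × Bool × 𝒮 × ℝ × Bool => c.2.2.2.2 := by fun_prop
  exact measurableSet_eq_bool this true

/-- Setting I as an observation scheme. -/
def schemeI : Scheme (obsI : FullData 𝒳 𝒮 → _) false (Prod.fst : 𝒳 × 𝒮 → 𝒳) where
  code c := if c.2.2.2.2 = true then Sum.inl (c.1, c.2.1, c.2.2.2.1) else Sum.inr (c.1, c.2.1)
  measurable_code := Measurable.ite measurableSet_labelled
    (measurable_inl.comp (by fun_prop)) (measurable_inr.comp (by fun_prop))
  obs_eq _ := rfl
  proj := id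
  measurable_proj := measurable_id
  proj_eq _ := rfl
  measurable_U := measurable_fst
  unlabelled _ := ⟨fun a x => Sum.inr (x, a),
    fun _ => measurable_inr.comp (measurable_id.prodMk measurable_const), fun _ _ _ _ => rfl⟩
  treat := Sum.elim (fun o => o.2.1) fun o => o.2
  measurable_treat := Measurable.sumElim (by fun_prop) (by fun_prop)
  treat_eq w := by unfold obsI; split_ifs <;> rfl
  label := Sum.elim (fun _ => true) fun _ => false
  measurable_label := Measurable.sumElim measurable_const measurable_const
  label_eq w := by cases h : R w <;> simp [obsI, h]
  outcome := Sum.elim (fun o => o.2.2) fun _ => 0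
  measurable_outcome := Measurable.sumElim (by fun_prop) measurable_const
  outcome_eq w := by cases h : R w <;> simp [obsI, h, ind]
  reg := Sum.elim (fun o => o.1) fun o => o.1
  measurable_reg := Measurable.sumElim (by fun_prop) (by fun_prop)
  reg_eq w := by unfold obsI; split_ifs <;> rfl

/-- Setting II as an observation scheme. -/
def schemeII : Scheme (obsII : FullData 𝒳 𝒮 → _) false (Prod.fst : 𝒳 × 𝒮 → 𝒳) where
  code c := if c.2.2.2.2 = true then Sum.inl (c.1, c.2.1, c.2.2.1, c.2.2.2.1)
    else Sum.inr (c.1, c.2.1)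
  measurable_code := Measurable.ite measurableSet_labelled
    (measurable_inl.comp (by fun_prop)) (measurable_inr.comp (by fun_prop))
  obs_eq _ := rfl
  proj := id
  measurable_proj := measurable_id
  proj_eq _ := rfl
  measurable_U := measurable_fst
  unlabelled _ := ⟨fun a x => Sum.inr (x, a),
    fun _ => measurable_inr.comp (measurable_id.prodMk measurable_const), fun _ _ _ _ => rfl⟩
  treat := Sum.elim (fun o => o.2.1) fun o => o.2
  measurable_treat := Measurable.sumElim (by fun_prop) (by fun_prop)
  treat_eq w := by unfold obsII; split_ifs <;> rfl
  label := Sum.elim (fun _ => true) fun _ => false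
  measurable_label := Measurable.sumElim measurable_const measurable_const
  label_eq w := by cases h : R w <;> simp [obsII, h]
  outcome := Sum.elim (fun o => o.2.2.2) fun _ => 0
  measurable_outcome := Measurable.sumElim (by fun_prop) measurable_const
  outcome_eq w := by cases h : R w <;> simp [obsII, h, ind]
  reg := Sum.elim (fun o => o.1) fun o => o.1
  measurable_reg := Measurable.sumElim (by fun_prop) (by fun_prop)
  reg_eq w := by unfold obsII; split_ifs <;> rfl

/-- Setting III as an observation scheme. -/
def schemeIII : Scheme (obsIII : FullData 𝒳 𝒮 → _) false (fun z : 𝒳 × 𝒮 => z) where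
  code c := if c.2.2.2.2 = true then Sum.inl (c.1, c.2.1, c.2.2.1, c.2.2.2.1)
    else Sum.inr (c.1, c.2.1, c.2.2.1)
  measurable_code := Measurable.ite measurableSet_labelled
    (measurable_inl.comp (by fun_prop)) (measurable_inr.comp (by fun_prop))
  obs_eq _ := rfl
  proj := Prod.fst
  measurable_proj := measurable_fst
  proj_eq _ := rfl
  measurable_U := measurable_id
  unlabelled _ := ⟨fun a z => Sum.inr (z.1, a, z.2),
    fun _ => measurable_inr.comp (measurable_fst.prodMk (measurable_const.prodMk measurable_snd)),
    fun _ _ _ _ => rfl⟩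
  treat := Sum.elim (fun o => o.2.1) fun o => o.2.1
  measurable_treat := Measurable.sumElim (by fun_prop) (by fun_prop)
  treat_eq w := by unfold obsIII; split_ifs <;> rfl
  label := Sum.elim (fun _ => true) fun _ => false
  measurable_label := Measurable.sumElim measurable_const measurable_const
  label_eq w := by cases h : R w <;> simp [obsIII, h]
  outcome := Sum.elim (fun o => o.2.2.2) fun _ => 0
  measurable_outcome := Measurable.sumElim (by fun_prop) measurable_const
  outcome_eq w := by cases h : R w <;> simp [obsIII, h, ind]
  reg := Sum.elim (fun o => (o.1, o.2.2.1)) fun o => (o.1, o.2.2)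
  measurable_reg := Measurable.sumElim (by fun_prop) (by fun_prop)
  reg_eq w := by unfold obsIII; split_ifs <;> rfl

/-- Setting IV as an observation scheme. -/
def schemeIV : Scheme (obsIV : FullData 𝒳 𝒮 → _) true (Prod.fst : 𝒳 × 𝒮 → 𝒳) where
  code c := (c.1, c.2.1, c.2.2.1, c.2.2.2.1)
  measurable_code := by fun_prop
  obs_eq _ := rfl
  proj := id
  measurable_proj := measurable_id
  proj_eq _ := rfl
  measurable_U := measurable_fst
  unlabelled h := by simp at h
  treat o := o.2.1
  measurable_treat := by fun_prop
  treat_eq _ := rfl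
  label _ := true
  measurable_label := measurable_const
  label_eq _ := by simp
  outcome o := o.2.2.2
  measurable_outcome := by fun_prop
  outcome_eq _ := by simp [obsIV, ind]
  reg o := o.1
  measurable_reg := by fun_prop
  reg_eq _ := rfl

end Schemes

/-! ### Explicit form of the influence functions -/

section InfluenceFunctions

variable {𝒳 𝒮 : Type*} {ε δ : ℝ} {e : 𝒳 → ℝ} {r μ : Bool → 𝒳 → ℝ} {μS : Bool → 𝒳 × 𝒮 → ℝ}
  {w : FullData 𝒳 𝒮}

theorem treatProb_false (x : 𝒳) : treatProb ε e false x = 1 - treatProb ε e true x := by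
  linarith [sum_treatProb ε e x]

theorem schemePsi_eq_psiIII (he : treatProb ε e true (X w) = e (X w))
    (hr : ∀ a, labelProb ε r a (X w) = r a (X w)) :
    schemePsi false (fun z => z) (treatProb ε e) (labelProb ε r) μ μS δ w
      = psiIII e r μ μS δ w := by
  simp only [schemePsi, armPsi, armInfluence, schemeProb, psiIII, treatProb_false, he, hr,
    Bool.or_false, Bool.false_eq_true, if_false]
  cases T w <;> simp [ind] <;> ring

theorem schemePsi_eq_psiI (he : treatProb ε e true (X w) = e (X w))
    (hr : ∀ a, labelProb ε r a (X w) = r a (X w)) :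
    schemePsi false Prod.fst (treatProb ε e) (labelProb ε r) μ μ δ w = psiI e r μ δ w := by
  simp only [schemePsi, armPsi, armInfluence, schemeProb, psiI, treatProb_false, he, hr,
    Bool.or_false, Bool.false_eq_true, if_false]
  cases T w <;> simp [ind] <;> ring

theorem schemePsi_eq_psiIV (he : treatProb ε e true (X w) = e (X w)) :
    schemePsi true Prod.fst (treatProb ε e) (labelProb ε r) μ μ δ w = psiIV e μ δ w := by
  simp only [schemePsi, armPsi, armInfluence, schemeProb, psiIV, treatProb_false, he,
    Bool.or_true, if_true]
  cases T w <;> simp [ind] <;> ring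

theorem psiIII_eq_psiGeneral {rS : Bool → 𝒳 × 𝒮 → ℝ}
    (h : ∀ a, T w = a → rS a (X w, Spot a w) = r a (X w)) :
    psiIII e r μ μS δ w = psiGeneral e rS μ μS δ w := by
  have h' := h _ rfl
  cases hT : T w <;> rw [hT] at h' <;> simp [psiIII, psiGeneral, ind, hT, S, h']

end InfluenceFunctions

end SurrogateATE

/-! ### The theorem -/

theorem theorem2 {𝒳 𝒮 : Type*} [MeasurableSpace 𝒳] [StandardBorelSpace 𝒳]
    [MeasurableSpace 𝒮] [StandardBorelSpace 𝒮]
    (ε : ℝ) (hε₀ : 0 < ε) (hε₁ : ε < 1 / 2)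
    (P : ProbabilityMeasure (SurrogateATE.FullData 𝒳 𝒮))
    (hP : SurrogateATE.Assumptions ε P)
    (e : 𝒳 → ℝ) (r μ : Bool → 𝒳 → ℝ) (rS μS : Bool → 𝒳 × 𝒮 → ℝ)
    (he : SurrogateATE.IsTreatmentPropensity (P : Measure (SurrogateATE.FullData 𝒳 𝒮)) e)
    (hr : SurrogateATE.IsLabelPropensity (P : Measure (SurrogateATE.FullData 𝒳 𝒮)) r)
    (hrS : SurrogateATE.IsLabelPropensityS (P : Measure (SurrogateATE.FullData 𝒳 𝒮)) rS)
    (hμ : SurrogateATE.IsOutcomeRegression (P : Measure (SurrogateATE.FullData 𝒳 𝒮)) μ)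
    (hμS : SurrogateATE.IsOutcomeRegressionS (P : Measure (SurrogateATE.FullData 𝒳 𝒮)) μS) :
    (∀ knowE knowR : Prop,
      SurrogateATE.IsEfficient (SurrogateATE.model ε e r knowE knowR)
        SurrogateATE.obsI SurrogateATE.ate P
        (SurrogateATE.psiI e r μ (SurrogateATE.ate P)) ∧
      SurrogateATE.IsEfficient (SurrogateATE.model ε e r knowE knowR)
        SurrogateATE.obsII SurrogateATE.ate P
        (SurrogateATE.psiI e r μ (SurrogateATE.ate P)) ∧
      SurrogateATE.IsEfficient (SurrogateATE.model ε e r knowE knowR)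
        SurrogateATE.obsIII SurrogateATE.ate P
        (SurrogateATE.psiIII e r μ μS (SurrogateATE.ate P)) ∧
      SurrogateATE.IsEfficient (SurrogateATE.model ε e r knowE knowR)
        SurrogateATE.obsIV SurrogateATE.ate P
        (SurrogateATE.psiIV e μ (SurrogateATE.ate P))) ∧
    SurrogateATE.psiIII e r μ μS (SurrogateATE.ate P)
      =ᵐ[(P : Measure (SurrogateATE.FullData 𝒳 𝒮))]
        SurrogateATE.psiGeneral e rS μ μS (SurrogateATE.ate P)
 := by
  have h := hP.isArmLaw hε₀ hε₁ he hr
  have hmean : ∀ a, SurrogateATE.IsArmMean (P : Measure (SurrogateATE.FullData 𝒳 𝒮))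
      a Prod.fst (μ a) :=
    fun a => (h a).isArmMean hε₀ (hP.memLp a) measurable_fst measurable_id (fun _ => rfl) (hμ a)
  have hmeanS : ∀ a, SurrogateATE.IsArmMean (P : Measure (SurrogateATE.FullData 𝒳 𝒮)) a
      (fun z => z) (μS a) :=
    fun a => (h a).isArmMean hε₀ (hP.memLp a) measurable_id measurable_fst (fun _ => rfl) (hμS a)
  have hr' : ∀ᵐ w ∂(P : Measure (SurrogateATE.FullData 𝒳 𝒮)), ∀ a,
      SurrogateATE.labelProb ε r a (SurrogateATE.X w) = r a (SurrogateATE.X w) :=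
    ae_all_iff.2 (hP.ae_labelProb_eq hε₀ hε₁ hr)
  have he' := hP.ae_treatProb_true_eq he
  refine ⟨fun knowE knowR => ⟨?_, ?_, ?_, ?_⟩, ?_⟩
  · refine (SurrogateATE.schemeI.isEfficient hε₀ hε₁ hP he hr hmean hmean knowE knowR).congr ?_
    filter_upwards [he', hr'] with w h1 h2 using SurrogateATE.schemePsi_eq_psiI h1 h2
  · refine (SurrogateATE.schemeII.isEfficient hε₀ hε₁ hP he hr hmean hmean knowE knowR).congr ?_
    filter_upwards [he', hr'] with w h1 h2 using SurrogateATE.schemePsi_eq_psiI h1 h2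
  · refine (SurrogateATE.schemeIII.isEfficient hε₀ hε₁ hP he hr hmean hmeanS knowE knowR).congr ?_
    filter_upwards [he', hr'] with w h1 h2 using SurrogateATE.schemePsi_eq_psiIII h1 h2
  · refine (SurrogateATE.schemeIV.isEfficient hε₀ hε₁ hP he hr hmean hmean knowE knowR).congr ?_
    filter_upwards [he'] with w h1 using SurrogateATE.schemePsi_eq_psiIV h1
  -- The two labelling scores agree only on the arm T = a. That is enough, since the score of the
  -- unassigned arm is multiplied by zero.
  · have h1 := fun a => (ae_restrict_iff' (SurrogateATE.measurableSet_arm a)).1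
      (hP.ae_label_eq hr hrS a)
    filter_upwards [ae_all_iff.2 h1] with w hw using SurrogateATE.psiIII_eq_psiGeneral hw
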